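/- A $3$-graph $H$ consists of a finite vertex set $V(H)$ and a set $E(H)$ of $3$-element subsets of $V(H)$, called edges. The degree $\deg(v)$ of a vertex $v$ is the number of edges containing $v$; a vertex is isolated if it lies in no edge; two distinct vertices are adjacent if some edge contains both of them. A perfect matching of $H$ is a set of pairwise disjoint edges of $H$ that together cover $V(H)$. For $n$ a positive multiple of $3$, let $H^2_{n,n/3}$ be the $3$-graph whose vertex set is the disjoint union of two sets $S$ and $T$ with $|S| = n/3+1$ and $|T| = 2n/3-1$, and whose edges are all the $3$-element sets of vertices with at least two elements in $T$. **Theorem 1.6.** For every real $\gamma > 0$ there is an $n_0 \in \mathbb{N}$ such that the following holds for every integer $n \ge n_0$ divisible by $3$. Let $H$ be a $3$-graph on $n$ vertices with no isolated vertex, and suppose that $$\deg(u) + \deg(v) > \left(\tfrac35 + \gamma\right) n^2$$ for every pair of adjacent vertices $u, v$ of $H$. Then $H$ has a perfect matching if and only if $H$ is not isomorphic to a subgraph of $H^2_{n,n/3}$ (that is, there is no injective map $V(H) \to V(H^2_{n,n/3})$ that sends every edge of $H$ to an edge of $H^2_{n,n/3}$). -/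

import Mathlib

namespace Hypergraph

/-- `H` is a `k`-graph: every edge has exactly `k` vertices. -/
def IsUniform {α : Type*} (H : Hypergraph α) (k : ℕ) : Prop :=
  ∀ e ∈ H.edgeSet, e.ncard = k

/-- The degree of a vertex: the number of edges containing it. -/
noncomputable def degree {α : Type*} (H : Hypergraph α) (v : α) : ℕ :=
  {e | e ∈ H.edgeSet ∧ v ∈ e}.ncard

/-- A matching of `H` is a set of pairwise disjoint edges of `H`. -/
def IsMatching {α : Type*} (H : Hypergraph α) (M : Set (Set α)) : Prop :=
  M ⊆ H.edgeSet ∧ M.PairwiseDisjoint id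

/-- A perfect matching of `H` is a matching that covers every vertex of `H`. -/
def IsPerfectMatching {α : Type*} (H : Hypergraph α) (M : Set (Set α)) : Prop :=
  H.IsMatching M ∧ ⋃₀ M = H.vertexSet

/-- `H` is (isomorphic to) a subgraph of `G`: some map that is injective on the vertices of `H`
sends vertices of `H` to vertices of `G` and edges of `H` to edges of `G`. -/
def IsSubgraphOf {α β : Type*} (H : Hypergraph α) (G : Hypergraph β) : Prop :=
  ∃ f : α → β, Set.InjOn f H.vertexSet ∧
    (H.image f).vertexSet ⊆ G.vertexSet ∧ (H.image f).edgeSet ⊆ G.edgeSet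

/-- The 3-graph `H^ℓ_{n,s}` on the vertex set `{0, …, n - 1}`, partitioned into
`T = {i | i < s ℓ - 1}` and its complement `S`, so that `|T| = s ℓ - 1` and `|S| = n - s ℓ + 1`
(for `1 ≤ s ℓ ≤ n + 1`); its edges are all the triples with at least `ℓ` vertices in `T`. -/
def extremal (ℓ n s : ℕ) : Hypergraph (Fin n) where
  vertexSet := Set.univ
  edgeSet := {e | e.ncard = 3 ∧ ℓ ≤ (e ∩ {i : Fin n | (i : ℕ) < s * ℓ - 1}).ncard}
  subset_vertexSet_of_mem_edgeSet' := fun _ _ => Set.subset_univ _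

end Hypergraph

/-
Call a vertex light if its degree is less than half of the bound in the degree condition. An edge
contains at most one light vertex, so `H` embeds in the extremal `3`-graph as soon as more than
`n / 3` vertices are light, and an embedding rules out a perfect matching by counting. If at most
`n / 3` vertices are light, then a perfect matching is found by absorption.

* Absorption: any two vertices of the same kind have many common neighbouring pairs, so that every
  triple of suitable kinds has many absorbing gadgets. Conditional expectations of an exponential
  potential select a small family of disjoint gadgets that is good for all such triples at once.
* Almost perfect matching: the linear programming dual of a fractional perfect matching assigns to
  the vertices weights of nonpositive sum that are nonnegative on edges. At an optimum the uniform
  weight decomposes into tight edges, so degree sums are averages of counts in the `3 × 3` tables of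
  pairwise sums of the weights of two tight edges; bounding these counts shows that the optimum
  is `0`. An edge drawn from the fractional perfect matching preserves in expectation the densities
  of all links, hence the degree condition, and one can go on until few vertices are left.
* The leftover has to meet the light vertices in the proportion the absorber needs. If there are
  clearly fewer than `n / 3` light vertices, then pairs reserved in advance cover the leftover light
  ones. If there are almost `n / 3` of them, then a few edges without light vertices reduce to the
  case of exactly a third, where only edges with one light vertex are used.
-/

namespace ThreeGraph

/-! ### Tables of pairwise sums of two triples -/

section SumTables

open scoped Classical in
/-- The indicator of a proposition, as a natural number. -/
noncomputable def ind (p : Prop) : ℕ := if p then 1 else 0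

lemma ind_le_one (p : Prop) : ind p ≤ 1 := by grind [ind]

lemma ind_of {p : Prop} (h : p) : ind p = 1 := if_pos h

lemma ind_of_not {p : Prop} (h : ¬ p) : ind p = 0 := if_neg h

lemma ind_mono {p q : Prop} (h : p → q) : ind p ≤ ind q := by grind [ind]

lemma ind_and (p q : Prop) : ind (p ∧ q) = ind p * ind q := by grind [ind]

/-- A triple of reals that are at least `-1` and have a sum of at most `0`. -/
structure LowTriple (e : Fin 3 → ℝ) : Prop where
  neg_one_le : ∀ i, -1 ≤ e i
  sum_nonpos : ∑ i, e i ≤ 0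

/-- A low triple in increasing order. Only the inequalities that are not implied by the others are
recorded. -/
structure SortedLowTriple (e : Fin 3 → ℝ) : Prop where
  le₀₁ : e 0 ≤ e 1
  le₁₂ : e 1 ≤ e 2
  neg_one_le : -1 ≤ e 0
  sum_nonpos : e 0 + e 1 + e 2 ≤ 0

/-- The number of entries of the sum table of two triples that are at least `s`. -/
noncomputable def sumCount (s : ℝ) (e f : Fin 3 → ℝ) : ℕ := ∑ i, ∑ j, ind (s ≤ e i + f j)

/-- The number of entries of the sum table of two triples that are at least `1` and come from
summands that are at least `α`. -/
noncomputable def restrictedCount (α : ℝ) (e f : Fin 3 → ℝ) : ℕ :=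
  ∑ i, ∑ j, ind (α ≤ e i ∧ α ≤ f j ∧ 1 ≤ e i + f j)

/-- A permutation of the triple `(-1, 1/2, 1/2)`, encoded by its possible entries and its sum. -/
def IsSplit (e : Fin 3 → ℝ) : Prop := (∀ i, e i = -1 ∨ e i = 1 / 2) ∧ ∑ i, e i = 0

/-- At most one entry of the triple is negative, or the triple is constantly `-1`. -/
def AlmostNonneg (e : Fin 3 → ℝ) : Prop :=
  (∀ i j, i ≠ j → e i < 0 → 0 ≤ e j) ∨ ∀ i, e i = -1

lemma LowTriple.exists_perm_sorted {e : Fin 3 → ℝ} (he : LowTriple e) :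
    ∃ σ : Equiv.Perm (Fin 3), SortedLowTriple (e ∘ σ) := by
  refine ⟨Tuple.sort e, Tuple.monotone_sort e (by decide), Tuple.monotone_sort e (by decide),
    he.neg_one_le _, ?_⟩
  have hsum := Equiv.sum_comp (Tuple.sort e) e
  rw [Fin.sum_univ_three] at hsum
  exact hsum.trans_le he.sum_nonpos

lemma sum_sum_comp_perm {κ M : Type*} [Fintype κ] [AddCommMonoid M] (ψ : κ → κ → M)
    (σ τ : Equiv.Perm κ) : ∑ i, ∑ j, ψ (σ i) (τ j) = ∑ i, ∑ j, ψ i j :=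
  (Finset.sum_congr rfl fun i _ => Equiv.sum_comp τ (ψ (σ i))).trans
    (Equiv.sum_comp σ fun i => ∑ j, ψ i j)

lemma sumCount_comp_perm (s : ℝ) (e f : Fin 3 → ℝ) (σ τ : Equiv.Perm (Fin 3)) :
    sumCount s (e ∘ σ) (f ∘ τ) = sumCount s e f :=
  sum_sum_comp_perm (fun i j => ind (s ≤ e i + f j)) σ τ

lemma restrictedCount_comp_perm (α : ℝ) (e f : Fin 3 → ℝ) (σ τ : Equiv.Perm (Fin 3)) :
    restrictedCount α (e ∘ σ) (f ∘ τ) = restrictedCount α e f :=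
  sum_sum_comp_perm (fun i j => ind (α ≤ e i ∧ α ≤ f j ∧ 1 ≤ e i + f j)) σ τ

lemma isSplit_comp_perm {e : Fin 3 → ℝ} (σ : Equiv.Perm (Fin 3)) :
    IsSplit (e ∘ σ) ↔ IsSplit e :=
  and_congr (σ.forall_congr_right (q := fun i => e i = -1 ∨ e i = 1 / 2))
    (by rw [← Equiv.sum_comp σ e]; rfl)

lemma comp_perm_eq_zero_iff {e : Fin 3 → ℝ} (σ : Equiv.Perm (Fin 3)) : e ∘ σ = 0 ↔ e = 0 :=
  σ.surjective.injective_comp_right.eq_iff' rfl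

lemma IsSplit.ne_zero {e : Fin 3 → ℝ} (he : IsSplit e) : e ≠ 0 := by
  rintro rfl
  simpa using he.1 0

lemma sumCount_comm (s : ℝ) (e f : Fin 3 → ℝ) : sumCount s e f = sumCount s f e := by
  unfold sumCount
  rw [Finset.sum_comm]
  simp only [add_comm]

lemma restrictedCount_comm (α : ℝ) (e f : Fin 3 → ℝ) :
    restrictedCount α e f = restrictedCount α f e := by
  unfold restrictedCount
  rw [Finset.sum_comm]
  simp only [add_comm, and_left_comm]

lemma sumCount_eq (s : ℝ) (e f : Fin 3 → ℝ) : sumCount s e f =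
    ind (s ≤ e 0 + f 0) + ind (s ≤ e 0 + f 1) + ind (s ≤ e 0 + f 2) +
    (ind (s ≤ e 1 + f 0) + ind (s ≤ e 1 + f 1) + ind (s ≤ e 1 + f 2)) +
    (ind (s ≤ e 2 + f 0) + ind (s ≤ e 2 + f 1) + ind (s ≤ e 2 + f 2)) := by
  simp only [sumCount, Fin.sum_univ_three]

lemma restrictedCount_eq (α : ℝ) (e f : Fin 3 → ℝ) : restrictedCount α e f =
    ind (α ≤ e 0 ∧ α ≤ f 0 ∧ 1 ≤ e 0 + f 0) + ind (α ≤ e 0 ∧ α ≤ f 1 ∧ 1 ≤ e 0 + f 1) +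
    ind (α ≤ e 0 ∧ α ≤ f 2 ∧ 1 ≤ e 0 + f 2) +
    (ind (α ≤ e 1 ∧ α ≤ f 0 ∧ 1 ≤ e 1 + f 0) + ind (α ≤ e 1 ∧ α ≤ f 1 ∧ 1 ≤ e 1 + f 1) +
      ind (α ≤ e 1 ∧ α ≤ f 2 ∧ 1 ≤ e 1 + f 2)) +
    (ind (α ≤ e 2 ∧ α ≤ f 0 ∧ 1 ≤ e 2 + f 0) + ind (α ≤ e 2 ∧ α ≤ f 1 ∧ 1 ≤ e 2 + f 1) +
      ind (α ≤ e 2 ∧ α ≤ f 2 ∧ 1 ≤ e 2 + f 2)) := by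
  simp only [restrictedCount, Fin.sum_univ_three]

lemma sumCount_le_nine (s : ℝ) (e f : Fin 3 → ℝ) : sumCount s e f ≤ 9 :=
  (Finset.sum_le_sum fun _ _ => Finset.sum_le_sum fun _ _ => ind_le_one _).trans_eq (by simp)

lemma restrictedCount_le_sumCount (α : ℝ) (e f : Fin 3 → ℝ) :
    restrictedCount α e f ≤ sumCount 1 e f :=
  Finset.sum_le_sum fun _ _ => Finset.sum_le_sum fun _ _ => ind_mono fun h => h.2.2

namespace SortedLowTriple

variable {e f : Fin 3 → ℝ}

lemma isSplit_iff (he : SortedLowTriple e) :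
    IsSplit e ↔ e 0 = -1 ∧ e 1 = 1 / 2 ∧ e 2 = 1 / 2 := by
  simp only [IsSplit, Fin.forall_fin_succ, Fin.sum_univ_three]
  grind [cases SortedLowTriple]

lemma eq_zero_iff (he : SortedLowTriple e) : e = 0 ↔ 0 ≤ e 0 := by
  refine ⟨fun h => h ▸ le_rfl, fun h => funext fun i => ?_⟩
  fin_cases i <;> simp <;> grind [cases SortedLowTriple]

lemma sumCount_one_le (he : SortedLowTriple e) (hf : SortedLowTriple f) :
    sumCount 1 e f ≤ 5 := by
  rw [sumCount_eq]
  grind [ind, cases SortedLowTriple]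

lemma sumCount_le_of_pos (he : SortedLowTriple e) (hf : SortedLowTriple f) {s : ℝ}
    (hs : 0 < s) : sumCount s e f ≤ 6 := by
  rw [sumCount_eq]
  grind [ind, cases SortedLowTriple]

lemma sumCount_one_add_sumCount_le (he : SortedLowTriple e) (hf : SortedLowTriple f) {s : ℝ}
    (hs : 0 < s) (hs1 : s ≤ 1) : sumCount 1 e f + sumCount s e f ≤ 10 := by
  rw [sumCount_eq, sumCount_eq]
  grind (splits := 20) [ind, cases SortedLowTriple]

lemma restrictedCount_add_sumCount_le_of_le (he : SortedLowTriple e) (hf : SortedLowTriple f)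
    {α : ℝ} (hα : 0 ≤ α) (h₀ : α ≤ e 0) : restrictedCount α e f + sumCount (-α) e f ≤ 10 := by
  rw [restrictedCount_eq, sumCount_eq]
  grind (splits := 30) [ind, cases SortedLowTriple]

lemma restrictedCount_add_sumCount_le_of_lt (he : SortedLowTriple e) (hf : SortedLowTriple f)
    {α : ℝ} (hα : 0 ≤ α) (h₀ : e 0 < α) (h₀' : f 0 < α) :
    restrictedCount α e f + sumCount (-α) e f ≤ 10 ∨ α = 1 / 2 ∧ IsSplit e ∧ IsSplit f := by
  rw [he.isSplit_iff, hf.isSplit_iff, restrictedCount_eq, sumCount_eq]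
  simp only [h₀.not_ge, h₀'.not_ge, false_and, and_false, ind_of_not not_false, zero_add, add_zero]
  by_cases h₁₁ : α ≤ e 1 ∧ α ≤ f 1 ∧ 1 ≤ e 1 + f 1
  · grind [ind, cases SortedLowTriple]
  rw [ind_of_not h₁₁]
  by_cases h₁₂ : α ≤ e 1 ∧ α ≤ f 2 ∧ 1 ≤ e 1 + f 2 <;>
    by_cases h₂₁ : α ≤ e 2 ∧ α ≤ f 1 ∧ 1 ≤ e 2 + f 1 <;>
    grind (splits := 30) [ind, cases SortedLowTriple]

lemma restrictedCount_add_sumCount_le (he : SortedLowTriple e) (hf : SortedLowTriple f) {α : ℝ}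
    (hα : -1 ≤ α) :
    restrictedCount α e f + sumCount (-α) e f ≤ 10 ∨ α = 1 / 2 ∧ IsSplit e ∧ IsSplit f := by
  rcases lt_or_ge α 0 with hneg | hα₀
  · exact .inl <| (Nat.add_le_add_right (restrictedCount_le_sumCount α e f) _).trans <|
      he.sumCount_one_add_sumCount_le hf (neg_pos.2 hneg) (neg_le.1 hα)
  rcases le_or_gt α (e 0) with he₀ | he₀
  · exact .inl (he.restrictedCount_add_sumCount_le_of_le hf hα₀ he₀)
  rcases le_or_gt α (f 0) with hf₀ | hf₀
  · rw [restrictedCount_comm, sumCount_comm]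
    exact .inl (hf.restrictedCount_add_sumCount_le_of_le he hα₀ hf₀)
  exact he.restrictedCount_add_sumCount_le_of_lt hf hα₀ he₀ hf₀

lemma count_half_le_of_isSplit (he : SortedLowTriple e) (hf : SortedLowTriple f)
    (hes : IsSplit e) (hfs : IsSplit f) :
    restrictedCount (1 / 2) e f + sumCount (-(1 / 2)) e f ≤ 12 := by
  obtain ⟨e₀, e₁, e₂⟩ := he.isSplit_iff.1 hes
  obtain ⟨f₀, f₁, f₂⟩ := hf.isSplit_iff.1 hfs
  rw [restrictedCount_eq, sumCount_eq, e₀, e₁, e₂, f₀, f₁, f₂]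
  norm_num [ind]

lemma count_half_zero_le_of_isSplit (he : SortedLowTriple e) (hes : IsSplit e) :
    restrictedCount (1 / 2) e 0 + sumCount (-(1 / 2)) e 0 ≤ 6 := by
  obtain ⟨e₀, e₁, e₂⟩ := he.isSplit_iff.1 hes
  rw [restrictedCount_eq, sumCount_eq, e₀, e₁, e₂]
  norm_num [ind]

lemma sumCount_le_of_isSplit (he : SortedLowTriple e) (hf : SortedLowTriple f) {s : ℝ}
    (hs : 0 ≤ s) (hes : IsSplit e) (hfs : IsSplit f) : sumCount s e f ≤ 4 := by
  obtain ⟨e₀, e₁, e₂⟩ := he.isSplit_iff.1 hes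
  obtain ⟨f₀, f₁, f₂⟩ := hf.isSplit_iff.1 hfs
  have h₀₂ : e 0 + f 2 < s := by linarith
  have h₂₀ : e 2 + f 0 < s := by linarith
  rw [sumCount_eq]
  grind [ind, cases SortedLowTriple]

lemma sumCount_zero_le_of_eq_neg_one (he : SortedLowTriple e) (hf : SortedLowTriple f)
    (h : e 2 = -1) : sumCount 0 e f ≤ 3 := by
  rw [sumCount_eq]
  grind [ind, cases SortedLowTriple]

lemma sumCount_zero_le_of_nonneg (he : SortedLowTriple e) (hf : SortedLowTriple f)
    (he₁ : 0 ≤ e 1) (hf₁ : 0 ≤ f 1) (hne : ¬ (e = 0 ∧ f = 0)) : sumCount 0 e f ≤ 6 := by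
  rw [he.eq_zero_iff, hf.eq_zero_iff] at hne
  rw [sumCount_eq]
  grind (splits := 20) [ind, cases SortedLowTriple]

lemma sumCount_zero_le (he : SortedLowTriple e) (hf : SortedLowTriple f)
    (he' : 0 ≤ e 1 ∨ e 2 = -1) (hf' : 0 ≤ f 1 ∨ f 2 = -1) (hne : ¬ (e = 0 ∧ f = 0)) :
    sumCount 0 e f ≤ 6 := by
  rcases he' with he₁ | he₂
  · rcases hf' with hf₁ | hf₂
    · exact he.sumCount_zero_le_of_nonneg hf he₁ hf₁ hne
    · exact sumCount_comm 0 e f ▸ (hf.sumCount_zero_le_of_eq_neg_one he hf₂).trans (by norm_num)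
  · exact (he.sumCount_zero_le_of_eq_neg_one hf he₂).trans (by norm_num)

lemma count_half_le (he : SortedLowTriple e) (hf : SortedLowTriple f) :
    restrictedCount (1 / 2) e f + sumCount (-(1 / 2)) e f
        + 4 * (ind (IsSplit e) * ind (f = 0)) + 4 * (ind (e = 0) * ind (IsSplit f)) ≤
      10 + 2 * (ind (IsSplit e) * ind (IsSplit f)) := by
  have hgeneral := he.restrictedCount_add_sumCount_le hf (α := 1 / 2) (by norm_num)
  by_cases hes : IsSplit e <;> by_cases hfs : IsSplit f
  · have hle := he.count_half_le_of_isSplit hf hes hfs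
    simp only [ind_of hes, ind_of hfs, ind_of_not hes.ne_zero, ind_of_not hfs.ne_zero]
    omega
  · have hle : f = 0 → restrictedCount (1 / 2) e f + sumCount (-(1 / 2)) e f ≤ 6 :=
      fun h => h ▸ he.count_half_zero_le_of_isSplit hes
    simp only [ind_of hes, ind_of_not hfs]
    grind [ind]
  · have hle : e = 0 → restrictedCount (1 / 2) e f + sumCount (-(1 / 2)) e f ≤ 6 := fun h => by
      rw [h, restrictedCount_comm, sumCount_comm]
      exact hf.count_half_zero_le_of_isSplit hfs
    simp only [ind_of_not hes, ind_of hfs]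
    grind [ind]
  · simp only [ind_of_not hes, ind_of_not hfs]
    grind

lemma sumCount_le (he : SortedLowTriple e) (hf : SortedLowTriple f) {s : ℝ} (hs : 0 ≤ s)
    (he' : s = 0 → 0 ≤ e 1 ∨ e 2 = -1) (hf' : s = 0 → 0 ≤ f 1 ∨ f 2 = -1) :
    sumCount s e f + 2 * (ind (IsSplit e) * ind (IsSplit f)) ≤
      6 + 3 * (ind (e = 0) * ind (f = 0)) := by
  by_cases hsplit : IsSplit e ∧ IsSplit f
  · have hle := he.sumCount_le_of_isSplit hf hs hsplit.1 hsplit.2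
    rw [ind_of hsplit.1, ind_of hsplit.2]
    omega
  rw [← ind_and, ← ind_and, ind_of_not hsplit]
  by_cases hzero : e = 0 ∧ f = 0
  · rw [ind_of hzero]
    exact sumCount_le_nine s e f
  rw [ind_of_not hzero]
  rcases hs.eq_or_lt with rfl | hpos
  · exact he.sumCount_zero_le hf (he' rfl) (hf' rfl) hzero
  · exact he.sumCount_le_of_pos hf hpos

lemma nonneg_or_eq_neg_one {σ : Equiv.Perm (Fin 3)} (hσ : SortedLowTriple (e ∘ σ))
    (h : AlmostNonneg e) : 0 ≤ (e ∘ σ) 1 ∨ (e ∘ σ) 2 = -1 := by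
  refine h.imp (fun h => ?_) fun h => h _
  by_contra! hneg
  exact (h (σ 1) (σ 0) (by simp) hneg).not_gt (hσ.le₀₁.trans_lt hneg)

end SortedLowTriple

namespace LowTriple

variable {e f : Fin 3 → ℝ}

lemma sumCount_one_le (he : LowTriple e) (hf : LowTriple f) : sumCount 1 e f ≤ 5 := by
  obtain ⟨σ, hσ⟩ := he.exists_perm_sorted
  obtain ⟨τ, hτ⟩ := hf.exists_perm_sorted
  exact sumCount_comp_perm 1 e f σ τ ▸ hσ.sumCount_one_le hτ

lemma restrictedCount_add_sumCount_le (he : LowTriple e) (hf : LowTriple f) {α : ℝ}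
    (hα : -1 ≤ α) :
    restrictedCount α e f + sumCount (-α) e f ≤ 10 ∨ α = 1 / 2 ∧ IsSplit e ∧ IsSplit f := by
  obtain ⟨σ, hσ⟩ := he.exists_perm_sorted
  obtain ⟨τ, hτ⟩ := hf.exists_perm_sorted
  simpa only [sumCount_comp_perm, restrictedCount_comp_perm, isSplit_comp_perm] using
    hσ.restrictedCount_add_sumCount_le hτ hα

lemma count_half_le (he : LowTriple e) (hf : LowTriple f) :
    restrictedCount (1 / 2) e f + sumCount (-(1 / 2)) e f
        + 4 * (ind (IsSplit e) * ind (f = 0)) + 4 * (ind (e = 0) * ind (IsSplit f)) ≤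
      10 + 2 * (ind (IsSplit e) * ind (IsSplit f)) := by
  obtain ⟨σ, hσ⟩ := he.exists_perm_sorted
  obtain ⟨τ, hτ⟩ := hf.exists_perm_sorted
  simpa only [sumCount_comp_perm, restrictedCount_comp_perm, isSplit_comp_perm,
    comp_perm_eq_zero_iff] using hσ.count_half_le hτ

lemma sumCount_le (he : LowTriple e) (hf : LowTriple f) {s : ℝ} (hs : 0 ≤ s)
    (he' : s = 0 → AlmostNonneg e) (hf' : s = 0 → AlmostNonneg f) :
    sumCount s e f + 2 * (ind (IsSplit e) * ind (IsSplit f)) ≤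
      6 + 3 * (ind (e = 0) * ind (f = 0)) := by
  obtain ⟨σ, hσ⟩ := he.exists_perm_sorted
  obtain ⟨τ, hτ⟩ := hf.exists_perm_sorted
  simpa only [sumCount_comp_perm, isSplit_comp_perm, comp_perm_eq_zero_iff] using
    hσ.sumCount_le hτ hs (fun h => hσ.nonneg_or_eq_neg_one (he' h))
      fun h => hτ.nonneg_or_eq_neg_one (hf' h)

end LowTriple

end SumTables

/-! ### Linear programming duality -/

section LinearProgram

variable {ι κ : Type*} [Fintype ι] [Fintype κ]

/-- The feasible region of the dual of the fractional matching program: weights that are at least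
`-1`, nonnegative on every tuple of `F`, and have a nonpositive sum. -/
def feasible (F : Set (κ → ι)) : Set (ι → ℝ) :=
  {z | (∀ v, -1 ≤ z v) ∧ (∀ f ∈ F, 0 ≤ ∑ i, z (f i)) ∧ ∑ v, z v ≤ 0}

/-- The tuples whose dual constraint is tight for the weight `z`; the constraint `-1 ≤ z v` is
represented by the constant tuple at `v`. -/
def tight (F : Set (κ → ι)) (z : ι → ℝ) : Set (κ → ι) :=
  {f | (f ∈ F ∧ ∑ i, z (f i) = 0) ∨ ∃ v, z v = -1 ∧ f = fun _ => v}

lemma zero_mem_feasible (F : Set (κ → ι)) : (0 : ι → ℝ) ∈ feasible F := by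
  simp [feasible]

lemma isClosed_feasible (F : Set (κ → ι)) : IsClosed (feasible F) := by
  simp only [feasible, Set.ofPred_and, Set.ofPred_forall]
  refine .inter (isClosed_iInter fun v => ?_) <| .inter
    (isClosed_iInter fun f => isClosed_iInter fun _ => ?_) ?_ <;>
  exact isClosed_le (by fun_prop) (by fun_prop)

lemma le_card_of_mem_feasible {F : Set (κ → ι)} {z : ι → ℝ} (hz : z ∈ feasible F) (v : ι) :
    z v ≤ Fintype.card ι := by
  obtain ⟨hlow, -, hsum⟩ := hz
  have hsingle : z v + 1 ≤ ∑ w, (z w + 1) :=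
    Finset.single_le_sum (f := fun w => z w + 1) (fun w _ => neg_le_iff_add_nonneg.1 (hlow w))
      (Finset.mem_univ v)
  rw [Finset.sum_add_distrib, Finset.sum_const, Finset.card_univ, nsmul_one] at hsingle
  linarith

lemma isCompact_feasible (F : Set (κ → ι)) : IsCompact (feasible F) :=
  (isCompact_univ_pi fun _ => isCompact_Icc).of_isClosed_subset (isClosed_feasible F)
    fun _ hz v _ => ⟨hz.1 v, le_card_of_mem_feasible hz v⟩

lemma exists_minimizer (F : Set (κ → ι)) :
    ∃ z ∈ feasible F, ∀ y ∈ feasible F, ∑ v, z v ≤ ∑ v, y v :=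
  (isCompact_feasible F).exists_isMinOn ⟨0, zero_mem_feasible F⟩
    (f := fun z : ι → ℝ => ∑ v, z v) (by fun_prop)

lemma eventually_nonneg_add_mul {a b : ℝ} (ha : 0 ≤ a) (hb : a = 0 → 0 < b) :
    ∀ᶠ ε in nhdsWithin (0 : ℝ) (Set.Ioi 0), 0 ≤ a + ε * b := by
  rcases ha.eq_or_lt with rfl | ha
  · filter_upwards [self_mem_nhdsWithin] with ε hε
    rw [zero_add]
    exact (mul_pos hε (hb rfl)).le
  · have hlim : Filter.Tendsto (fun ε : ℝ => a + ε * b) (nhds 0) (nhds a) := by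
      simpa using (continuous_const.add (continuous_id.mul continuous_const)).tendsto
        (f := fun ε : ℝ => a + ε * b) 0
    filter_upwards [(hlim.mono_left nhdsWithin_le_nhds).eventually_const_lt ha] with ε hε
    exact hε.le

lemma exists_feasible_add_smul [Nonempty κ] {F : Set (κ → ι)} {z d : ι → ℝ} (hz : z ∈ feasible F)
    (hd : ∀ f ∈ tight F z, 0 < ∑ i, d (f i)) (hneg : ∑ v, d v < 0) :
    ∃ ε : ℝ, 0 < ε ∧ z + ε • d ∈ feasible F := by
  obtain ⟨hlow, hF, hsum⟩ := hz
  have hlow' : ∀ v, ∀ᶠ ε in nhdsWithin (0 : ℝ) (Set.Ioi 0), 0 ≤ (z v + 1) + ε * d v := by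
    refine fun v => eventually_nonneg_add_mul (neg_le_iff_add_nonneg.1 (hlow v)) fun hv => ?_
    have hpos := hd _ (.inr ⟨v, by linarith, rfl⟩)
    rw [Finset.sum_const, nsmul_eq_mul] at hpos
    exact pos_of_mul_pos_right hpos (Nat.cast_nonneg _)
  have hF' : ∀ f, ∀ᶠ ε in nhdsWithin (0 : ℝ) (Set.Ioi 0),
      f ∈ F → 0 ≤ ∑ i, z (f i) + ε * ∑ i, d (f i) := by
    intro f
    by_cases hf : f ∈ F
    · filter_upwards [eventually_nonneg_add_mul (hF f hf) fun h => hd f (.inl ⟨hf, h⟩)]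
        with ε hε _ using hε
    · exact .of_forall fun _ h => absurd h hf
  obtain ⟨ε, ⟨hεlow, hεF⟩, hε⟩ := ((Filter.eventually_all.2 hlow').and
    (Filter.eventually_all.2 hF') |>.and self_mem_nhdsWithin).exists
  refine ⟨ε, hε, fun v => ?_, fun f hf => ?_, ?_⟩ <;>
    simp only [Pi.add_apply, Pi.smul_apply, smul_eq_mul, Finset.sum_add_distrib, ← Finset.mul_sum]
  · linarith [hεlow v]
  · exact hεF f hf
  · linarith [mul_neg_of_pos_of_neg (Set.mem_Ioi.1 hε) hneg]

open scoped Classical in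
/-- The number of times that a tuple takes each value, as a real vector. -/
noncomputable def occupancy (f : κ → ι) : ι → ℝ := ∑ i, Pi.single (f i) 1

lemma sum_occupancy_mul (f : κ → ι) (φ : ι → ℝ) :
    ∑ v, occupancy f v * φ v = ∑ i, φ (f i) := by
  classical
  simp only [occupancy, Finset.sum_apply, Finset.sum_mul]
  rw [Finset.sum_comm]
  exact Finset.sum_congr rfl fun i _ => by simp [Pi.single_apply]

variable [DecidableEq κ]

/-- A fractional decomposition of the uniform weight into tuples from `F`: a probability
distribution on `F` under which the expected number of occurrences of a vertex does not depend on
the vertex. -/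
structure IsDecomposition (F : Set (κ → ι)) (x : (κ → ι) → ℝ) : Prop where
  nonneg : ∀ f, 0 ≤ x f
  mem : ∀ f, x f ≠ 0 → f ∈ F
  sum_eq_one : ∑ f, x f = 1
  marginal : ∀ φ : ι → ℝ, ∑ f, x f * ∑ i, φ (f i) = Fintype.card κ / Fintype.card ι * ∑ v, φ v

lemma IsDecomposition.mono {F G : Set (κ → ι)} {x : (κ → ι) → ℝ} (hx : IsDecomposition F x)
    (hFG : F ⊆ G) : IsDecomposition G x :=
  ⟨hx.nonneg, fun f hf => hFG (hx.mem f hf), hx.sum_eq_one, hx.marginal⟩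

lemma exists_isDecomposition_of_mem_convexHull {T : Set (κ → ι)}
    (hT : (fun _ => (Fintype.card κ / Fintype.card ι : ℝ)) ∈ convexHull ℝ (occupancy '' T)) :
    ∃ x, IsDecomposition T x := by
  classical
  obtain ⟨J, _, w, y, hw, hw₁, hy, hwy⟩ := mem_convexHull_iff_exists_fintype.1 hT
  choose g hgT hg using hy
  have hfiber : ∀ Φ : (κ → ι) → ℝ, ∑ f, (∑ j with g j = f, w j) * Φ f = ∑ j, w j * Φ (g j) := by
    intro Φ
    rw [← Finset.sum_fiberwise Finset.univ g fun j => w j * Φ (g j)]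
    refine Finset.sum_congr rfl fun f _ => ?_
    rw [Finset.sum_mul]
    exact Finset.sum_congr rfl fun j hj => by rw [(Finset.mem_filter.1 hj).2]
  refine ⟨fun f => ∑ j with g j = f, w j, fun f => Finset.sum_nonneg fun j _ => hw j,
    fun f hf => ?_, ?_, fun φ => ?_⟩
  · obtain ⟨j, hj, -⟩ := Finset.exists_ne_zero_of_sum_ne_zero hf
    exact (Finset.mem_filter.1 hj).2 ▸ hgT j
  · simpa [hw₁] using hfiber fun _ => 1
  · rw [hfiber fun f => ∑ i, φ (f i), Finset.mul_sum]
    calc ∑ j, w j * ∑ i, φ (g j i) = ∑ v, (∑ j, w j • y j) v * φ v := by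
          simp only [← sum_occupancy_mul, hg, Finset.sum_apply, Finset.sum_mul, Finset.mul_sum,
            Pi.smul_apply, smul_eq_mul, mul_assoc]
          exact Finset.sum_comm
      _ = _ := by rw [hwy]

lemma exists_direction [Nonempty ι] [Nonempty κ] (T : Set (κ → ι))
    (hT : ¬ ∃ x, IsDecomposition T x) :
    ∃ d : ι → ℝ, (∀ f ∈ T, 0 < ∑ i, d (f i)) ∧ ∑ v, d v < 0 := by
  classical
  have hι : (0 : ℝ) < Fintype.card ι := by exact_mod_cast Fintype.card_pos
  have hκ : (0 : ℝ) < Fintype.card κ := by exact_mod_cast Fintype.card_pos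
  obtain ⟨g, s, hgu, hgT⟩ := geometric_hahn_banach_point_closed (convex_convexHull ℝ _)
    ((T.toFinite.image occupancy).isClosed_convexHull ℝ)
    (mt exists_isDecomposition_of_mem_convexHull hT)
  have hg : ∀ y : ι → ℝ, g y = ∑ v, y v * g (Pi.single v 1) := fun y => by
    conv_lhs => rw [pi_eq_sum_univ' y]
    simp only [map_sum, map_smul, smul_eq_mul]
  refine ⟨fun v => g (Pi.single v 1) - s / Fintype.card κ, fun f hf => ?_, ?_⟩
  · have hpos := hgT _ (subset_convexHull ℝ _ ⟨f, hf, rfl⟩)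
    rw [hg, sum_occupancy_mul] at hpos
    rw [Finset.sum_sub_distrib, Finset.sum_const, Finset.card_univ, nsmul_eq_mul,
      mul_div_cancel₀ _ hκ.ne']
    linarith
  · rw [hg, ← Finset.mul_sum, div_mul_eq_mul_div, div_lt_iff₀ hι] at hgu
    rw [Finset.sum_sub_distrib, Finset.sum_const, Finset.card_univ, nsmul_eq_mul, sub_neg,
      mul_div_assoc', lt_div_iff₀ hκ]
    linarith

lemma exists_isDecomposition_tight [Nonempty ι] [Nonempty κ] {F : Set (κ → ι)} {z : ι → ℝ}
    (hz : z ∈ feasible F) (hmin : ∀ y ∈ feasible F, ∑ v, z v ≤ ∑ v, y v) :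
    ∃ x, IsDecomposition (tight F z) x := by
  by_contra hcon
  obtain ⟨d, hd, hneg⟩ := exists_direction _ hcon
  obtain ⟨ε, hε, hfeas⟩ := exists_feasible_add_smul hz hd hneg
  have hle := hmin _ hfeas
  simp only [Pi.add_apply, Pi.smul_apply, smul_eq_mul, Finset.sum_add_distrib,
    ← Finset.mul_sum] at hle
  linarith [mul_neg_of_pos_of_neg hε hneg]

end LinearProgram

/-! ### Fractional perfect matchings -/

section PairCount

variable {V : Type*}

/-- The number of ordered pairs of elements of `S` that satisfy `P`. -/
noncomputable def pairCount (P : V → V → Prop) (S : Finset V) : ℕ :=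
  ∑ a ∈ S, ∑ b ∈ S, ind (P a b)

end PairCount

section FractionalMatching

variable {ι : Type*} [Fintype ι]

section Averaging

variable {κ : Type*} [Fintype κ] [DecidableEq κ] {T : Set (κ → ι)} {x : (κ → ι) → ℝ}

lemma IsDecomposition.sum_eq [Nonempty ι] [Nonempty κ] (hx : IsDecomposition T x) (φ : ι → ℝ) :
    ∑ v, φ v = Fintype.card ι / Fintype.card κ * ∑ f, x f * ∑ i, φ (f i) := by
  rw [hx.marginal φ]
  field_simp

lemma IsDecomposition.sum_sum_eq [Nonempty ι] [Nonempty κ] (hx : IsDecomposition T x)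
    (ψ : ι → ι → ℝ) :
    ∑ a, ∑ b, ψ a b = (Fintype.card ι / Fintype.card κ : ℝ) ^ 2 *
      ∑ f, ∑ f', x f * x f' * ∑ i, ∑ j, ψ (f i) (f' j) := by
  rw [hx.sum_eq, pow_two, mul_assoc]
  congr 1
  rw [Finset.mul_sum]
  refine Finset.sum_congr rfl fun f _ => ?_
  simp only [hx.sum_eq (ψ _), Finset.mul_sum]
  rw [Finset.sum_comm]
  refine Finset.sum_congr rfl fun f' _ => Finset.sum_congr rfl fun i _ =>
    Finset.sum_congr rfl fun j _ => ?_
  ring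

lemma IsDecomposition.mul_sq_le_sum_sum [Nonempty ι] [Nonempty κ] (hx : IsDecomposition T x)
    {ψ : ι → ι → ℕ} {B : (κ → ι) → (κ → ι) → ℝ} {c : ℝ}
    (hc : c * (Fintype.card ι : ℝ) ^ 2 ≤ (∑ a, ∑ b, ψ a b : ℕ))
    (hB : ∀ f ∈ T, ∀ f' ∈ T, (∑ i, ∑ j, ψ (f i) (f' j) : ℕ) ≤ B f f') :
    c * (Fintype.card κ : ℝ) ^ 2 ≤ ∑ f, ∑ f', x f * x f' * B f f' := by
  have hpos : 0 < (Fintype.card ι / Fintype.card κ : ℝ) ^ 2 := by positivity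
  refine le_of_mul_le_mul_left ?_ hpos
  calc (Fintype.card ι / Fintype.card κ : ℝ) ^ 2 * (c * (Fintype.card κ : ℝ) ^ 2)
      = c * (Fintype.card ι : ℝ) ^ 2 := by field_simp
    _ ≤ _ := by
      refine hc.trans ?_
      push_cast
      rw [hx.sum_sum_eq]
      gcongr ?_ * (∑ f, ∑ f', ?_) with f _ f' _
      rcases eq_or_ne (x f) 0 with hf | hf
      · simp [hf]
      rcases eq_or_ne (x f') 0 with hf' | hf'
      · simp [hf']
      exact mul_le_mul_of_nonneg_left (by exact_mod_cast hB f (hx.mem f hf) f' (hx.mem f' hf'))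
        (mul_nonneg (hx.nonneg f) (hx.nonneg f'))

lemma IsDecomposition.sum_sum_mul_const (hx : IsDecomposition T x) (B : ℝ) :
    ∑ f, ∑ f', x f * x f' * B = B := by
  simp only [← Finset.sum_mul, ← Finset.sum_mul_sum, hx.sum_eq_one, one_mul]

/-- The total mass that `x` gives to the tuples that satisfy `p`. -/
noncomputable def mass (x : (κ → ι) → ℝ) (p : (κ → ι) → Prop) : ℝ := ∑ f, x f * ind (p f)

lemma sum_sum_mul_ind_mul_ind (x : (κ → ι) → ℝ) (p q : (κ → ι) → Prop) (c : ℝ) :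
    ∑ f, ∑ f', x f * x f' * (c * (ind (p f) * ind (q f'))) = c * (mass x p * mass x q) := by
  simp_rw [mass, Finset.sum_mul_sum, Finset.mul_sum]
  exact Finset.sum_congr rfl fun f _ => Finset.sum_congr rfl fun f' _ => by ring

lemma IsDecomposition.mass_nonneg (hx : IsDecomposition T x) (p : (κ → ι) → Prop) :
    0 ≤ mass x p :=
  Finset.sum_nonneg fun f _ => mul_nonneg (hx.nonneg f) (Nat.cast_nonneg _)

lemma IsDecomposition.mass_le_one (hx : IsDecomposition T x) (p : (κ → ι) → Prop) :
    mass x p ≤ 1 := by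
  rw [← hx.sum_eq_one]
  exact Finset.sum_le_sum fun f _ => mul_le_of_le_one_right (hx.nonneg f) <| by
    exact_mod_cast ind_le_one _

lemma IsDecomposition.exists_const_ne_zero [Nonempty ι] [Nonempty κ] {F : Set (κ → ι)} {z : ι → ℝ}
    (hx : IsDecomposition (tight F z) x) (hneg : ∑ v, z v < 0) :
    ∃ v, z v = -1 ∧ x (fun _ => v) ≠ 0 := by
  by_contra! hcon
  have hzero : ∑ f, x f * ∑ i, z (f i) = 0 := by
    refine Finset.sum_eq_zero fun f _ => mul_eq_zero.2 (or_iff_not_imp_left.2 fun hf => ?_)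
    rcases hx.mem f hf with ⟨-, hsum⟩ | ⟨v, hv, rfl⟩
    · exact hsum
    · exact absurd (hcon v hv) hf
  have hsum := hx.sum_eq z
  rw [hzero, mul_zero] at hsum
  exact hneg.ne hsum

lemma IsDecomposition.exists_forall_not [Nonempty ι] (hx : IsDecomposition T x) {P : ι → Prop}
    (hcard : Fintype.card κ * {v | P v}.ncard ≤ Fintype.card ι) (hκ : 1 < Fintype.card κ) {v : ι}
    (hv : P v) (hxv : x (fun _ => v) ≠ 0) : ∃ f, x f ≠ 0 ∧ ∀ i, ¬ P (f i) := by
  classical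
  by_contra! hcon
  have hle : ∑ f, x f * ∑ i, (ind (P (f i)) : ℝ) ≤ 1 := by
    have hncard : ∑ v, ind (P v) = {v | P v}.ncard := by
      rw [Set.ncard_eq_toFinset_card']
      simp [ind]
    rw [hx.marginal fun v => (ind (P v) : ℝ), div_mul_eq_mul_div,
      div_le_one (by exact_mod_cast Fintype.card_pos), ← Nat.cast_sum, hncard]
    exact_mod_cast hcard
  refine hle.not_gt ?_
  rw [← hx.sum_eq_one]
  refine Finset.sum_lt_sum (fun f _ => ?_) ⟨fun _ => v, Finset.mem_univ _, ?_⟩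
  · rcases eq_or_ne (x f) 0 with hf | hf
    · simp [hf]
    obtain ⟨i, hi⟩ := hcon f hf
    refine le_mul_of_one_le_right (hx.nonneg f) ?_
    exact_mod_cast (ind_of hi).ge.trans (Finset.single_le_sum (f := fun i => ind (P (f i)))
      (fun _ _ => Nat.zero_le _) (Finset.mem_univ i))
  · beta_reduce
    rw [ind_of hv, Finset.sum_const, Finset.card_univ, nsmul_eq_mul, Nat.cast_one, mul_one]
    exact lt_mul_of_one_lt_right ((hx.nonneg _).lt_of_ne' hxv) (by exact_mod_cast hκ)

end Averaging

section OreRelation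

variable {R : ι → ι → ι → Prop} {z : ι → ℝ} {x : (Fin 3 → ι) → ℝ}

/-- The triples that are related by a ternary relation. -/
def triples (R : ι → ι → ι → Prop) : Set (Fin 3 → ι) := {f | R (f 0) (f 1) (f 2)}

/-- The edge relation of a `3`-graph with an Ore-type degree condition: ordered edges are counted,
so `6 / 5 * |ι| ^ 2` corresponds to a degree sum of `3 / 5 * |ι| ^ 2`. -/
structure IsOreRelation (R : ι → ι → ι → Prop) : Prop where
  swap_left : ∀ a b c, R a b c → R b a c
  swap_right : ∀ a b c, R a b c → R a c b
  exists_rel : ∀ v, ∃ a b, R v a b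
  le_pairCount_add : ∀ u v w, R u v w →
    6 / 5 * (Fintype.card ι : ℝ) ^ 2 ≤
      pairCount (R u) Finset.univ + pairCount (R v) Finset.univ

/-- An element whose degree is less than half of the degree sum in `IsOreRelation`. -/
def IsLight (R : ι → ι → ι → Prop) (v : ι) : Prop :=
  (pairCount (R v) Finset.univ : ℝ) < 3 / 5 * (Fintype.card ι : ℝ) ^ 2

lemma IsOreRelation.exists_rel_apply (hR : IsOreRelation R) {f : Fin 3 → ι} (hf : f ∈ triples R)
    {i j : Fin 3} (hij : i ≠ j) : ∃ w, R (f i) (f j) w := by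
  have h₀₁₂ : R (f 0) (f 1) (f 2) := hf
  have h₁₀₂ := hR.swap_left _ _ _ h₀₁₂
  have h₀₂₁ := hR.swap_right _ _ _ h₀₁₂
  have h₁₂₀ := hR.swap_right _ _ _ h₁₀₂
  have h₂₀₁ := hR.swap_left _ _ _ h₀₂₁
  have h₂₁₀ := hR.swap_left _ _ _ h₁₂₀
  fin_cases i <;> fin_cases j <;>
    first | exact absurd rfl hij | exact ⟨_, by assumption⟩

lemma IsOreRelation.not_isLight_or (hR : IsOreRelation R) {u v w : ι} (h : R u v w) :
    ¬ IsLight R u ∨ ¬ IsLight R v := by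
  by_contra! hcon
  have hle := hR.le_pairCount_add u v w h
  unfold IsLight at hcon
  linarith

lemma add_add_nonneg_of_mem_feasible (hz : z ∈ feasible (triples R)) {a b c : ι} (h : R a b c) :
    0 ≤ z a + z b + z c := by
  simpa [Fin.sum_univ_three] using hz.2.1 ![a, b, c] h

lemma lowTriple_of_mem_tight {F : Set (Fin 3 → ι)} (hz : z ∈ feasible F) {f : Fin 3 → ι}
    (hf : f ∈ tight F z) : LowTriple (z ∘ f) := by
  refine ⟨fun i => hz.1 _, ?_⟩
  rcases hf with ⟨-, hsum⟩ | ⟨v, hv, rfl⟩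
  · exact hsum.le
  · simp [hv]

lemma IsDecomposition.le_of_not_isLight [Nonempty ι] (hz : z ∈ feasible (triples R))
    (hx : IsDecomposition (tight (triples R) z) x) {u : ι} (hu : ¬ IsLight R u)
    {B : (Fin 3 → ι) → (Fin 3 → ι) → ℝ}
    (hB : ∀ f ∈ tight (triples R) z, ∀ f' ∈ tight (triples R) z,
      (sumCount (-z u) (z ∘ f) (z ∘ f') : ℝ) ≤ B f f') :
    27 / 5 ≤ ∑ f, ∑ f', x f * x f' * B f f' := by
  have hcount : pairCount (R u) Finset.univ ≤ ∑ a, ∑ b, ind (-z u ≤ z a + z b) :=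
    Finset.sum_le_sum fun a _ => Finset.sum_le_sum fun b _ =>
      ind_mono fun h => by linarith [add_add_nonneg_of_mem_feasible hz h]
  have hle : 3 / 5 * (Fintype.card ι : ℝ) ^ 2 ≤
      (∑ a, ∑ b, ind (-z u ≤ z a + z b) : ℕ) :=
    (not_lt.1 hu).trans (by exact_mod_cast hcount)
  refine le_trans ?_ (hx.mul_sq_le_sum_sum hle hB)
  norm_num

lemma IsDecomposition.isLight_of_eq_neg_one [Nonempty ι] (hz : z ∈ feasible (triples R))
    (hx : IsDecomposition (tight (triples R) z) x) {v : ι} (hv : z v = -1) : IsLight R v := by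
  by_contra hcon
  have hle := hx.le_of_not_isLight hz hcon (B := fun _ _ => 5) fun f hf f' hf' => by
    rw [hv, neg_neg]
    exact_mod_cast (lowTriple_of_mem_tight hz hf).sumCount_one_le (lowTriple_of_mem_tight hz hf')
  rw [hx.sum_sum_mul_const] at hle
  norm_num at hle

/-- `a` has minimum weight among the elements that share a triple with `v`. -/
def IsMinNeighbor (R : ι → ι → ι → Prop) (z : ι → ℝ) (v a : ι) : Prop :=
  (∃ b, R v a b) ∧ ∀ a', (∃ b, R v a' b) → z a ≤ z a'

lemma IsOreRelation.exists_isMinNeighbor (hR : IsOreRelation R) (z : ι → ℝ) (v : ι) :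
    ∃ a, IsMinNeighbor R z v a := by
  obtain ⟨a, ha, hmin⟩ := Set.exists_min_image {a | ∃ b, R v a b} z (Set.toFinite _)
    (hR.exists_rel v)
  exact ⟨a, ha, hmin⟩

lemma IsDecomposition.le_of_isMinNeighbor [Nonempty ι] (hR : IsOreRelation R)
    (hz : z ∈ feasible (triples R)) (hx : IsDecomposition (tight (triples R) z) x) {v a : ι}
    (hv : z v = -1) (ha : IsMinNeighbor R z v a) {B : (Fin 3 → ι) → (Fin 3 → ι) → ℝ}
    (hB : ∀ f ∈ tight (triples R) z, ∀ f' ∈ tight (triples R) z,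
      (restrictedCount (z a) (z ∘ f) (z ∘ f') + sumCount (-z a) (z ∘ f) (z ∘ f') : ℕ) ≤ B f f') :
    54 / 5 ≤ ∑ f, ∑ f', x f * x f' * B f f' := by
  obtain ⟨⟨b, hab⟩, hmin⟩ := ha
  have hcount : pairCount (R v) Finset.univ + pairCount (R a) Finset.univ ≤
      ∑ a', ∑ b', (ind (z a ≤ z a' ∧ z a ≤ z b' ∧ 1 ≤ z a' + z b') + ind (-z a ≤ z a' + z b')) := by
    simp only [Finset.sum_add_distrib]
    refine add_le_add
      (Finset.sum_le_sum fun a' _ => Finset.sum_le_sum fun b' _ => ind_mono fun h => ?_)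
      (Finset.sum_le_sum fun a' _ => Finset.sum_le_sum fun b' _ => ind_mono fun h => ?_) <;>
    have hnonneg := add_add_nonneg_of_mem_feasible hz h
    · exact ⟨hmin a' ⟨b', h⟩, hmin b' ⟨a', hR.swap_right _ _ _ h⟩, by linarith⟩
    · linarith
  have hle := (hR.le_pairCount_add v a b hab).trans_eq (Nat.cast_add _ _).symm
  replace hle := hle.trans (Nat.cast_le.2 hcount)
  refine le_trans ?_ (hx.mul_sq_le_sum_sum hle fun f hf f' hf' => ?_)
  · norm_num
  · simpa only [restrictedCount, sumCount, Function.comp_apply, Finset.sum_add_distrib]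
      using hB f hf f' hf'

lemma IsDecomposition.eq_half_of_isMinNeighbor [Nonempty ι] (hR : IsOreRelation R)
    (hz : z ∈ feasible (triples R)) (hx : IsDecomposition (tight (triples R) z) x) {v a : ι}
    (hv : z v = -1) (ha : IsMinNeighbor R z v a) : z a = 1 / 2 := by
  by_contra hne
  have hle := hx.le_of_isMinNeighbor hR hz hv ha (B := fun _ _ => 10) fun f hf f' hf' => by
    exact_mod_cast ((lowTriple_of_mem_tight hz hf).restrictedCount_add_sumCount_le
      (lowTriple_of_mem_tight hz hf') (hz.1 a)).resolve_right fun h => hne h.1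
  rw [hx.sum_sum_mul_const] at hle
  norm_num at hle

lemma IsDecomposition.le_mass_isSplit [Nonempty ι] (hR : IsOreRelation R)
    (hz : z ∈ feasible (triples R)) (hx : IsDecomposition (tight (triples R) z) x) {v : ι}
    (hv : z v = -1) :
    2 / 5 + 4 * (mass x (fun f => IsSplit (z ∘ f)) * mass x (fun f => z ∘ f = 0)) ≤
      mass x (fun f => IsSplit (z ∘ f)) * mass x (fun f => IsSplit (z ∘ f)) := by
  obtain ⟨a, ha⟩ := hR.exists_isMinNeighbor z v
  have hle := hx.le_of_isMinNeighbor hR hz hv ha (B := fun f f' =>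
      10 + 2 * (ind (IsSplit (z ∘ f)) * ind (IsSplit (z ∘ f'))) +
        (-4) * (ind (IsSplit (z ∘ f)) * ind (z ∘ f' = 0)) +
        (-4) * (ind (z ∘ f = 0) * ind (IsSplit (z ∘ f')))) fun f hf f' hf' => by
    have hcount := (lowTriple_of_mem_tight hz hf).count_half_le (lowTriple_of_mem_tight hz hf')
    rw [hx.eq_half_of_isMinNeighbor hR hz hv ha]
    rify at hcount ⊢
    linarith
  simp only [mul_add (_ * _), Finset.sum_add_distrib, hx.sum_sum_mul_const,
    sum_sum_mul_ind_mul_ind] at hle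
  linarith

lemma IsOreRelation.almostNonneg_of_mem_tight (hR : IsOreRelation R)
    (hz : ∀ u, ¬ IsLight R u → 0 ≤ z u) {f : Fin 3 → ι} (hf : f ∈ tight (triples R) z) :
    AlmostNonneg (z ∘ f) := by
  rcases hf with ⟨hf, -⟩ | ⟨v, hv, rfl⟩
  · refine .inl fun i j hij hi => ?_
    obtain ⟨w, hw⟩ := hR.exists_rel_apply hf hij
    exact hz _ ((hR.not_isLight_or hw).resolve_left fun hli => (hz _ hli).not_gt hi)
  · exact .inr fun _ => hv

/-- `u` has minimum weight among the elements that are not light. -/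
def IsMinHeavy (R : ι → ι → ι → Prop) (z : ι → ℝ) (u : ι) : Prop :=
  ¬ IsLight R u ∧ ∀ u', ¬ IsLight R u' → z u ≤ z u'

lemma IsDecomposition.exists_isMinHeavy [Nonempty ι] (hz : z ∈ feasible (triples R))
    (hx : IsDecomposition (tight (triples R) z) x)
    (hlight : 3 * {v | IsLight R v}.ncard ≤ Fintype.card ι) {v : ι} (hv : z v = -1)
    (hxv : x (fun _ => v) ≠ 0) : ∃ u, IsMinHeavy R z u ∧ z u ≤ 0 := by
  obtain ⟨f, hf, hheavy⟩ := hx.exists_forall_not (by simpa using hlight) (by simp)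
    (hx.isLight_of_eq_neg_one hz hv) hxv
  obtain ⟨u, hu, hmin⟩ := Set.exists_min_image {u | ¬ IsLight R u} z (Set.toFinite _)
    ⟨f 0, hheavy 0⟩
  refine ⟨u, ⟨hu, hmin⟩, ?_⟩
  by_contra! hpos
  have hsum : 0 < ∑ i, z (f i) :=
    Finset.sum_pos (fun i _ => hpos.trans_le (hmin _ (hheavy i))) Finset.univ_nonempty
  exact hsum.not_ge (lowTriple_of_mem_tight hz (hx.mem f hf)).sum_nonpos

lemma IsDecomposition.mass_isSplit_le [Nonempty ι] (hR : IsOreRelation R)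
    (hz : z ∈ feasible (triples R)) (hx : IsDecomposition (tight (triples R) z) x) {u : ι}
    (hu : IsMinHeavy R z u) (hu₀ : z u ≤ 0) :
    2 * (mass x (fun f => IsSplit (z ∘ f)) * mass x (fun f => IsSplit (z ∘ f))) ≤
      3 / 5 + 3 * (mass x (fun f => z ∘ f = 0) * mass x (fun f => z ∘ f = 0)) := by
  have halmost : -z u = 0 → ∀ f ∈ tight (triples R) z, AlmostNonneg (z ∘ f) := fun h f hf =>
    hR.almostNonneg_of_mem_tight (fun u' hu' => (neg_eq_zero.1 h).ge.trans (hu.2 u' hu')) hf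
  have hle := hx.le_of_not_isLight hz hu.1 (B := fun f f' =>
      6 + (-2) * (ind (IsSplit (z ∘ f)) * ind (IsSplit (z ∘ f'))) +
        3 * (ind (z ∘ f = 0) * ind (z ∘ f' = 0))) fun f hf f' hf' => by
    have hcount := (lowTriple_of_mem_tight hz hf).sumCount_le (lowTriple_of_mem_tight hz hf')
      (neg_nonneg.2 hu₀) (halmost · f hf) (halmost · f' hf')
    rify at hcount
    linarith
  simp only [mul_add (_ * _), Finset.sum_add_distrib, hx.sum_sum_mul_const,
    sum_sum_mul_ind_mul_ind] at hle
  linarith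

/-- With `q` the mass of the split triples and `o` the mass of the zero triples, a negative optimum
of the dual program would give `2 / 5 + 4 q o ≤ q ^ 2` and `2 q ^ 2 ≤ 3 / 5 + 3 o ^ 2`. -/
lemma IsOreRelation.sum_eq_zero_of_isMin [Nonempty ι] (hR : IsOreRelation R)
    (hlight : 3 * {v | IsLight R v}.ncard ≤ Fintype.card ι) (hz : z ∈ feasible (triples R))
    (hmin : ∀ y ∈ feasible (triples R), ∑ v, z v ≤ ∑ v, y v) : ∑ v, z v = 0 := by
  refine hz.2.2.eq_or_lt.resolve_right fun hneg => ?_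
  obtain ⟨x, hx⟩ := exists_isDecomposition_tight hz hmin
  obtain ⟨v, hv, hxv⟩ := hx.exists_const_ne_zero hneg
  obtain ⟨u, hu, hu₀⟩ := hx.exists_isMinHeavy hz hlight hv hxv
  have hlower := hx.le_mass_isSplit hR hz hv
  have hupper := hx.mass_isSplit_le hR hz hu hu₀
  have ho₁ := hx.mass_le_one fun f => z ∘ f = 0
  have ho₀ := hx.mass_nonneg fun f => z ∘ f = 0
  have hq₀ := hx.mass_nonneg fun f => IsSplit (z ∘ f)
  generalize mass x (fun f => IsSplit (z ∘ f)) = q at *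
  generalize mass x (fun f => z ∘ f = 0) = o at *
  have hq : 3 / 5 ≤ q := by
    by_contra! hlt
    nlinarith [mul_nonneg hq₀ ho₀]
  nlinarith [mul_le_mul_of_nonneg_right hq ho₀, mul_le_mul_of_nonneg_right ho₁ ho₀]

theorem IsOreRelation.exists_isDecomposition [Nonempty ι] (hR : IsOreRelation R)
    (hlight : 3 * {v | IsLight R v}.ncard ≤ Fintype.card ι) :
    ∃ x, IsDecomposition (triples R) x := by
  obtain ⟨z, hz, hmin⟩ := exists_minimizer (triples R)
  have hzero := hR.sum_eq_zero_of_isMin hlight hz hmin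
  obtain ⟨x, hx⟩ := exists_isDecomposition_tight (zero_mem_feasible (triples R))
    fun y hy => by simpa [hzero] using hmin y hy
  refine ⟨x, hx.mono ?_⟩
  rintro f (⟨hf, -⟩ | ⟨v, hv, -⟩)
  · exact hf
  · norm_num at hv

end OreRelation

end FractionalMatching

/-! ### Removing edges while preserving densities -/

section Matchable

variable {V : Type*} [DecidableEq V] {E E' : Finset (Finset V)} {S T : Finset V}

/-- A set of vertices is matchable if it is a disjoint union of edges. -/
def Matchable (E : Finset (Finset V)) (S : Finset V) : Prop :=
  ∃ M ⊆ E, (M : Set (Finset V)).PairwiseDisjoint id ∧ M.biUnion id = S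

lemma matchable_empty (E : Finset (Finset V)) : Matchable E ∅ :=
  ⟨∅, Finset.empty_subset _, by simp, rfl⟩

lemma matchable_of_mem {e : Finset V} (he : e ∈ E) : Matchable E e :=
  ⟨{e}, by simpa using he, by simp, by simp⟩

lemma Matchable.mono (h : Matchable E S) (hE : E ⊆ E') : Matchable E' S := by
  obtain ⟨M, hM, hdisj, hS⟩ := h
  exact ⟨M, hM.trans hE, hdisj, hS⟩

lemma Matchable.union (hS : Matchable E S) (hT : Matchable E T) (h : Disjoint S T) :
    Matchable E (S ∪ T) := by
  obtain ⟨M, hM, hMdisj, rfl⟩ := hS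
  obtain ⟨N, hN, hNdisj, rfl⟩ := hT
  refine ⟨M ∪ N, Finset.union_subset hM hN, ?_, Finset.union_biUnion⟩
  rw [Finset.coe_union, Set.pairwiseDisjoint_union]
  exact ⟨hMdisj, hNdisj, fun e he f hf _ =>
    h.mono (Finset.subset_biUnion_of_mem id he) (Finset.subset_biUnion_of_mem id hf)⟩

lemma Matchable.biUnion {κ : Type*} (s : Finset κ) (t : κ → Finset V)
    (h : ∀ i ∈ s, Matchable E (t i)) (hd : (s : Set κ).PairwiseDisjoint t) :
    Matchable E (s.biUnion t) := by
  classical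
  induction s using Finset.induction_on with
  | empty => exact matchable_empty E
  | insert a s ha ih =>
    rw [Finset.biUnion_insert]
    refine (h a (Finset.mem_insert_self _ _)).union
      (ih (fun i hi => h i (Finset.mem_insert_of_mem hi)) (hd.subset (by simp))) ?_
    exact (Finset.disjoint_biUnion_right _ _ _).2 fun i hi =>
      hd (by simp) (by simp [hi]) (ne_of_mem_of_not_mem hi ha).symm

lemma Matchable.union_edge {S₀ e : Finset V} (h : Matchable E (S₀ \ S)) (he : e ∈ E)
    (hS : S ⊆ S₀) (heS : e ⊆ S) : Matchable E (S₀ \ (S \ e)) := by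
  rw [sdiff_sdiff_right', Finset.sup_eq_union, Finset.inf_eq_inter,
    Finset.inter_eq_right.2 (heS.trans hS)]
  exact h.union (matchable_of_mem he) (Finset.sdiff_disjoint.mono_right heS)

end Matchable

section Density

variable {V : Type*} (P : V → V → Prop)

/-- The number of ordered pairs of elements of `S` that satisfy `P` and involve `a`, where the pair
`(a, a)` is counted twice. -/
noncomputable def incidence (S : Finset V) (a : V) : ℕ :=
  ∑ b ∈ S, ind (P a b) + ∑ b ∈ S, ind (P b a)

/-- The proportion of the ordered pairs of elements of `S` that satisfy `P`. -/
noncomputable def density (S : Finset V) : ℝ := pairCount P S / (S.card : ℝ) ^ 2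

lemma pairCount_mono_right {S T : Finset V} (h : S ⊆ T) : pairCount P S ≤ pairCount P T :=
  (Finset.sum_le_sum fun _ _ => Finset.sum_le_sum_of_subset h).trans
    (Finset.sum_le_sum_of_subset h)

lemma sum_ind_le_card {α : Type*} (p : α → Prop) (S : Finset α) : ∑ a ∈ S, ind (p a) ≤ S.card :=
  (Finset.sum_le_card_nsmul _ _ _ fun _ _ => ind_le_one _).trans_eq (by simp)

lemma pairCount_le_sq (S : Finset V) : pairCount P S ≤ S.card ^ 2 :=
  (Finset.sum_le_card_nsmul _ _ _ fun _ _ => sum_ind_le_card _ S).trans_eq (by simp [pow_two])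

lemma incidence_le (S : Finset V) (a : V) : incidence P S a ≤ 2 * S.card :=
  (add_le_add (sum_ind_le_card _ S) (sum_ind_le_card _ S)).trans_eq (two_mul _).symm

lemma sum_incidence (S : Finset V) : ∑ a ∈ S, incidence P S a = 2 * pairCount P S := by
  unfold incidence pairCount
  rw [Finset.sum_add_distrib, Finset.sum_comm (f := fun a b => ind (P b a)), two_mul]

lemma pairCount_le_sdiff_add [DecidableEq V] {S e : Finset V} (he : e ⊆ S) :
    pairCount P S ≤ pairCount P (S \ e) + ∑ a ∈ e, incidence P S a := by
  unfold pairCount incidence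
  rw [← Finset.sum_sdiff he, Finset.sum_add_distrib]
  have hrows : ∑ a ∈ S \ e, ∑ b ∈ S, ind (P a b) =
      ∑ a ∈ S \ e, ∑ b ∈ S \ e, ind (P a b) + ∑ a ∈ S \ e, ∑ b ∈ e, ind (P a b) := by
    rw [← Finset.sum_add_distrib]
    exact Finset.sum_congr rfl fun a _ => (Finset.sum_sdiff he).symm
  have hcols : ∑ a ∈ S \ e, ∑ b ∈ e, ind (P a b) ≤ ∑ b ∈ e, ∑ a ∈ S, ind (P a b) := by
    rw [Finset.sum_comm (s := e)]
    exact Finset.sum_le_sum_of_subset Finset.sdiff_subset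
  omega

end Density

section RemovalEstimate

variable {s D lam : ℝ}

lemma abs_div_sq_sub_div_sq_le {D' : ℝ} (hs : 6 ≤ s) (hD₀ : 0 ≤ D) (hD : D ≤ s ^ 2) (hD' : D' ≤ D)
    (hDD' : D - 6 * s ≤ D') : |D / s ^ 2 - D' / (s - 3) ^ 2| ≤ 24 / s := by
  have hs₀ : 0 < s := by linarith
  have hs₃ : 0 < s - 3 := by linarith
  have hbig : 6 * s / (s - 3) ^ 2 ≤ 24 / s := by
    rw [div_le_div_iff₀ (by positivity) hs₀]
    nlinarith
  have hle : D / s ^ 2 ≤ D / (s - 3) ^ 2 :=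
    div_le_div_of_nonneg_left hD₀ (by positivity) (by nlinarith)
  have hdiff : D / (s - 3) ^ 2 - D / s ^ 2 ≤ 6 * s / (s - 3) ^ 2 := by
    calc D / (s - 3) ^ 2 - D / s ^ 2 = D / s ^ 2 * ((6 * s - 9) / (s - 3) ^ 2) := by
          field_simp
          ring
      _ ≤ 1 * ((6 * s - 9) / (s - 3) ^ 2) := by
          gcongr
          · exact div_nonneg (by linarith) (by positivity)
          · exact (div_le_one (by positivity)).2 hD
      _ ≤ 6 * s / (s - 3) ^ 2 := by
          rw [one_mul]
          gcongr
          linarith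
  have hupper : D' / (s - 3) ^ 2 ≤ D / (s - 3) ^ 2 := by gcongr
  have hlower : D / (s - 3) ^ 2 - 6 * s / (s - 3) ^ 2 ≤ D' / (s - 3) ^ 2 := by
    rw [← sub_div]
    gcongr
  rw [abs_le]
  constructor <;> linarith

lemma exp_mul_le {t r : ℝ} (hlam : 0 ≤ lam) (ht : |t| ≤ r) (hr : lam * r ≤ 1) :
    Real.exp (lam * t) ≤ 1 + lam * t + lam ^ 2 * r ^ 2 := by
  have habs : |lam * t| ≤ lam * r := by
    rw [abs_mul, abs_of_nonneg hlam]
    gcongr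
  have hexp := (abs_le.1 (Real.abs_exp_sub_one_sub_id_le (habs.trans hr))).2
  have hsq : (lam * t) ^ 2 ≤ (lam * r) ^ 2 := sq_le_sq' (abs_le.1 habs).1 (abs_le.1 habs).2
  rw [mul_pow lam r] at hsq
  linarith

/-- The linear terms almost cancel, since deleting three vertices that each have the average
incidence `2 D / s` changes the density `D / s ^ 2` by `O(1 / s ^ 2)` only. -/
lemma one_add_mul_removal_le (hs : 6 ≤ s) (hD : D ≤ s ^ 2) (hlam : 1 ≤ lam) :
    1 + lam * (D / s ^ 2 - (D - 6 * D / s) / (s - 3) ^ 2) + lam ^ 2 * (24 / s) ^ 2 ≤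
      1 + 612 * lam ^ 2 / s ^ 2 := by
  have : 0 < s := by linarith
  have : 0 < s - 3 := by linarith
  have hinv : 9 / (s - 3) ^ 2 ≤ 36 / s ^ 2 := by
    rw [div_le_div_iff₀ (by positivity) (by positivity)]
    nlinarith
  have hlinear : lam * (D / s ^ 2 - (D - 6 * D / s) / (s - 3) ^ 2) ≤ lam ^ 2 * (36 / s ^ 2) :=
    calc lam * (D / s ^ 2 - (D - 6 * D / s) / (s - 3) ^ 2)
        = lam * (D / s ^ 2 * (9 / (s - 3) ^ 2)) := by
          field_simp
          ring
      _ ≤ lam * (1 * (36 / s ^ 2)) := by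
          gcongr
          exact (div_le_one (by positivity)).2 hD
      _ ≤ lam ^ 2 * (36 / s ^ 2) := by
          rw [one_mul]
          gcongr
          nlinarith
  calc _ ≤ 1 + lam ^ 2 * (36 / s ^ 2) + lam ^ 2 * (24 / s) ^ 2 := by linarith
    _ = 1 + 612 * lam ^ 2 / s ^ 2 := by
      field_simp
      ring

lemma sum_mul_exp_removal_le {κ : Type*} [Fintype κ] {x D' ρ : κ → ℝ} (hs : 6 ≤ s) (hD₀ : 0 ≤ D)
    (hD : D ≤ s ^ 2) (hlam : 1 ≤ lam) (hlams : 24 * lam ≤ s) (hx : ∀ f, 0 ≤ x f)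
    (hx₁ : ∑ f, x f = 1) (hρ : ∑ f, x f * ρ f = 6 * D / s) (hρ' : ∀ f, ρ f ≤ 6 * s)
    (hD' : ∀ f, D' f ≤ D) (hDD' : ∀ f, D - ρ f ≤ D' f) :
    ∑ f, x f * Real.exp (lam * (D / s ^ 2 - D' f / (s - 3) ^ 2)) ≤ 1 + 612 * lam ^ 2 / s ^ 2 := by
  have hs₀ : 0 < s := by linarith
  have hpoint : ∀ f, Real.exp (lam * (D / s ^ 2 - D' f / (s - 3) ^ 2)) ≤
      1 + lam * (D / s ^ 2 - (D - ρ f) / (s - 3) ^ 2) + lam ^ 2 * (24 / s) ^ 2 := fun f => by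
    refine (exp_mul_le (by linarith) (abs_div_sq_sub_div_sq_le hs hD₀ hD (hD' f) (by
      linarith [hρ' f, hDD' f])) ?_).trans ?_
    · rwa [← mul_div_assoc, mul_comm, div_le_one hs₀]
    · gcongr
      exact hDD' f
  calc ∑ f, x f * Real.exp (lam * (D / s ^ 2 - D' f / (s - 3) ^ 2))
      ≤ ∑ f, x f * (1 + lam * (D / s ^ 2 - (D - ρ f) / (s - 3) ^ 2) + lam ^ 2 * (24 / s) ^ 2) :=
        Finset.sum_le_sum fun f _ => mul_le_mul_of_nonneg_left (hpoint f) (hx f)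
    _ = (1 + lam * (D / s ^ 2 - D / (s - 3) ^ 2) + lam ^ 2 * (24 / s) ^ 2) * ∑ f, x f +
          lam / (s - 3) ^ 2 * ∑ f, x f * ρ f := by
        rw [Finset.mul_sum, Finset.mul_sum, ← Finset.sum_add_distrib]
        exact Finset.sum_congr rfl fun f _ => by ring
    _ = 1 + lam * (D / s ^ 2 - (D - 6 * D / s) / (s - 3) ^ 2) + lam ^ 2 * (24 / s) ^ 2 := by
        rw [hx₁, hρ]
        ring
    _ ≤ 1 + 612 * lam ^ 2 / s ^ 2 := one_add_mul_removal_le hs hD hlam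

end RemovalEstimate

section GuidedRemoval

variable {V : Type*} {E : Finset (Finset V)} {S V₀ : Finset V}
  {J : Type*} [Fintype J] {P : J → V → V → Prop} {lam L ξ : ℝ}

/-- The potential that keeps the densities of the relations `P j` from dropping much below their
values on `V₀` while edges are removed. -/
noncomputable def potential (P : J → V → V → Prop) (V₀ : Finset V) (lam : ℝ) (S : Finset V) : ℝ :=
  ∑ j, Real.exp (lam * (density (P j) V₀ - density (P j) S))

lemma potential_nonneg (P : J → V → V → Prop) (V₀ : Finset V) (lam : ℝ) (S : Finset V) :
    0 ≤ potential P V₀ lam S :=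
  Finset.sum_nonneg fun _ _ => Real.exp_nonneg _

lemma density_sub_le_of_potential_le (hlam : 0 < lam)
    (h : potential P V₀ lam S ≤ Real.exp (lam * ξ)) (j : J) :
    density (P j) V₀ - ξ ≤ density (P j) S := by
  have hle : Real.exp (lam * (density (P j) V₀ - density (P j) S)) ≤ potential P V₀ lam S :=
    Finset.single_le_sum
      (f := fun j => Real.exp (lam * (density (P j) V₀ - density (P j) S)))
      (fun _ _ => Real.exp_nonneg _) (Finset.mem_univ j)
  linarith [le_of_mul_le_mul_left (Real.exp_le_exp.1 (hle.trans h)) hlam]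

lemma sum_incidence_coe (P : V → V → Prop) (S : Finset V) :
    ∑ a : S, (incidence P S a : ℝ) = 2 * pairCount P S := by
  rw [Finset.sum_coe_sort S fun a => (incidence P S a : ℝ)]
  exact_mod_cast sum_incidence P S

variable [DecidableEq V]

/-- The set of vertices of a tuple in `S`. -/
def entries {κ : Type*} [Fintype κ] (f : κ → S) : Finset V := Finset.univ.image fun i => (f i : V)

/-- The ordered edges inside `S`, as triples of elements of `S`. -/
def edgeTriples (E : Finset (Finset V)) (S : Finset V) : Set (Fin 3 → S) := {f | entries f ∈ E}

lemma entries_subset {κ : Type*} [Fintype κ] (f : κ → S) : entries f ⊆ S :=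
  Finset.image_subset_iff.2 fun i _ => (f i).2

lemma IsDecomposition.sum_mul_exp_density_le (hE : ∀ e ∈ E, e.card = 3) (P : V → V → Prop)
    (hs : (6 : ℝ) ≤ S.card) (hlam : 1 ≤ lam) (hlams : 24 * lam ≤ S.card) {x : (Fin 3 → S) → ℝ}
    (hx : IsDecomposition (edgeTriples E S) x) :
    ∑ f, x f * Real.exp (lam * (density P S - density P (S \ entries f))) ≤
      1 + 612 * lam ^ 2 / (S.card : ℝ) ^ 2 := by
  have hcard : ∀ f, x f ≠ 0 → ((S \ entries f).card : ℝ) = S.card - 3 := fun f hf => by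
    have hf₃ : (entries f).card = 3 := hE _ (hx.mem f hf)
    rw [Finset.cast_card_sdiff (entries_subset f), hf₃, Nat.cast_ofNat]
  refine (Finset.sum_congr rfl fun f _ => ?_).trans_le (sum_mul_exp_removal_le (x := x)
    (D := pairCount P S) (D' := fun f => pairCount P (S \ entries f))
    (ρ := fun f => ∑ i, (incidence P S (f i) : ℝ)) hs (by positivity)
    (by exact_mod_cast pairCount_le_sq P S) hlam hlams hx.nonneg hx.sum_eq_one ?_
    (fun f => ?_) (fun f => ?_) (fun f => ?_))
  · rcases eq_or_ne (x f) 0 with hf | hf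
    · rw [hf, zero_mul, zero_mul]
    · rw [density, density, hcard f hf]
  · rw [hx.marginal fun a : S => (incidence P S a : ℝ), sum_incidence_coe, Fintype.card_coe,
      Fintype.card_fin]
    push_cast
    ring
  · have hle : ∑ i, incidence P S (f i) ≤ ∑ _i : Fin 3, 2 * S.card :=
      Finset.sum_le_sum fun i _ => incidence_le P S (f i)
    rw [Finset.sum_const, Finset.card_univ, Fintype.card_fin, smul_eq_mul, ← mul_assoc] at hle
    exact_mod_cast hle
  · exact_mod_cast pairCount_mono_right P Finset.sdiff_subset
  · have himage : ∑ a ∈ entries f, incidence P S a ≤ ∑ i, incidence P S (f i) :=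
      Finset.sum_image_le_of_nonneg fun _ _ => Nat.zero_le _
    rw [sub_le_iff_le_add]
    exact_mod_cast (pairCount_le_sdiff_add P (entries_subset f)).trans
      (Nat.add_le_add_left himage _)

lemma IsDecomposition.exists_mem_le {ι κ : Type*} [Fintype ι] [Fintype κ] [DecidableEq κ]
    {T : Set (κ → ι)} {x Φ : (κ → ι) → ℝ} {c : ℝ} (hx : IsDecomposition T x)
    (h : ∑ f, x f * Φ f ≤ c) : ∃ f ∈ T, Φ f ≤ c := by
  by_contra! hcon
  have hle : ∀ f, x f * c ≤ x f * Φ f := fun f => by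
    rcases eq_or_ne (x f) 0 with hf | hf
    · rw [hf, zero_mul, zero_mul]
    · exact mul_le_mul_of_nonneg_left (hcon f (hx.mem f hf)).le (hx.nonneg f)
  obtain ⟨f, -, hf⟩ := Finset.exists_ne_zero_of_sum_ne_zero (hx.sum_eq_one.trans_ne one_ne_zero)
  have hlt : ∑ f, x f * c < ∑ f, x f * Φ f :=
    Finset.sum_lt_sum (fun f _ => hle f) ⟨f, Finset.mem_univ f,
      mul_lt_mul_of_pos_left (hcon f (hx.mem f hf)) ((hx.nonneg f).lt_of_ne' hf)⟩
  rw [← Finset.sum_mul, hx.sum_eq_one, one_mul] at hlt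
  exact hlt.not_ge h

lemma exists_edge_potential_le (hE : ∀ e ∈ E, e.card = 3) (P : J → V → V → Prop) (V₀ : Finset V)
    (hs : (6 : ℝ) ≤ S.card) (hlam : 1 ≤ lam) (hlams : 24 * lam ≤ S.card) {x : (Fin 3 → S) → ℝ}
    (hx : IsDecomposition (edgeTriples E S) x) :
    ∃ e ∈ E, e ⊆ S ∧ potential P V₀ lam (S \ e) ≤
      potential P V₀ lam S * (1 + 612 * lam ^ 2 / (S.card : ℝ) ^ 2) := by
  have havg : ∑ f, x f * potential P V₀ lam (S \ entries f) ≤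
      potential P V₀ lam S * (1 + 612 * lam ^ 2 / (S.card : ℝ) ^ 2) := by
    unfold potential
    simp only [Finset.sum_mul, Finset.mul_sum]
    rw [Finset.sum_comm]
    refine Finset.sum_le_sum fun j _ => le_trans (le_of_eq ?_) (mul_le_mul_of_nonneg_left
      (hx.sum_mul_exp_density_le hE (P j) hs hlam hlams) (Real.exp_nonneg _))
    rw [Finset.mul_sum]
    refine Finset.sum_congr rfl fun f _ => ?_
    rw [mul_left_comm, ← Real.exp_add]
    ring_nf
  obtain ⟨f, hf, hle⟩ := hx.exists_mem_le havg
  exact ⟨entries f, hf, entries_subset f, hle⟩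

/-- Edges are removed one at a time; the invariant is that the potential of the remainder `S` is at
most `|J| exp (δ |V₀ \ S|)`, which never exceeds `3 |J|`. -/
theorem exists_matchable_sdiff_card_lt (hE : ∀ e ∈ E, e.card = 3) (hL : 6 ≤ L) (hlam : 1 ≤ lam)
    (hlamL : 24 * lam ≤ L) (hδ : 612 * lam ^ 2 / L ^ 2 * V₀.card ≤ 1)
    (hJ : 3 * (Fintype.card J : ℝ) ≤ Real.exp (lam * ξ))
    (hfrac : ∀ S ⊆ V₀, Matchable E (V₀ \ S) → L ≤ S.card →
      (∀ j, density (P j) V₀ - ξ ≤ density (P j) S) → ∃ x, IsDecomposition (edgeTriples E S) x) :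
    ∃ S ⊆ V₀, Matchable E (V₀ \ S) ∧ (S.card : ℝ) < L := by
  set δ := 612 * lam ^ 2 / L ^ 2 with hδdef
  have : 0 ≤ δ := by positivity
  obtain ⟨S, ⟨hS, hM, hpot⟩, hmin⟩ := Set.exists_min_image
    {S | S ⊆ V₀ ∧ Matchable E (V₀ \ S) ∧
      potential P V₀ lam S ≤ Fintype.card J * Real.exp (δ * (V₀ \ S).card)} Finset.card
    (V₀.powerset.finite_toSet.subset fun S hS => Finset.mem_coe.2 (Finset.mem_powerset.2 hS.1))
    ⟨V₀, subset_rfl, by simpa using matchable_empty E, by simp [potential]⟩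
  refine ⟨S, hS, hM, lt_of_not_ge fun hSL => ?_⟩
  have hexp : Real.exp (δ * (V₀ \ S).card) ≤ 3 :=
    calc Real.exp (δ * (V₀ \ S).card) ≤ Real.exp (δ * V₀.card) := by
          gcongr
          exact Finset.sdiff_subset
      _ ≤ Real.exp 1 := Real.exp_le_exp.2 hδ
      _ ≤ 3 := by linarith [Real.exp_one_lt_d9]
  have hpot₃ : potential P V₀ lam S ≤ Real.exp (lam * ξ) :=
    (hpot.trans (by rw [mul_comm]; gcongr)).trans hJ
  obtain ⟨x, hx⟩ := hfrac S hS hM hSL (density_sub_le_of_potential_le (by linarith) hpot₃)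
  obtain ⟨e, he, heS, hle⟩ := exists_edge_potential_le hE P V₀ (hL.trans hSL) hlam
    (hlamL.trans hSL) hx
  have hlt : (S \ e).card < S.card :=
    Finset.card_lt_card (Finset.sdiff_ssubset heS (Finset.card_pos.1 (by simp [hE e he])))
  refine (hmin (S \ e) ⟨Finset.sdiff_subset.trans hS, hM.union_edge he hS heS, ?_⟩).not_gt hlt
  have hgain : ((V₀ \ S).card : ℝ) + 1 ≤ (V₀ \ (S \ e)).card := by
    rw [Finset.card_sdiff_of_subset hS, Finset.card_sdiff_of_subset (Finset.sdiff_subset.trans hS)]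
    exact_mod_cast (by have := Finset.card_le_card hS; omega)
  calc potential P V₀ lam (S \ e)
      ≤ potential P V₀ lam S * (1 + 612 * lam ^ 2 / (S.card : ℝ) ^ 2) := hle
    _ ≤ potential P V₀ lam S * (1 + δ) := by
        have := potential_nonneg P V₀ lam S
        rw [hδdef]
        gcongr
    _ ≤ Fintype.card J * Real.exp (δ * (V₀ \ S).card) * Real.exp δ := by
        gcongr
        linarith [Real.add_one_le_exp δ]
    _ = Fintype.card J * Real.exp (δ * ((V₀ \ S).card + 1)) := by
        rw [mul_assoc, ← Real.exp_add, mul_add, mul_one]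
    _ ≤ Fintype.card J * Real.exp (δ * (V₀ \ (S \ e)).card) := by gcongr

end GuidedRemoval

/-! ### Selection by conditional expectation -/

section Selection

variable {V α I : Type*} [DecidableEq α] [Fintype I]

/-- The exponential potential that measures how rarely a selection `T` hits the families `F x`: it
bounds `exp (-#(T ∩ F x))` for every `x`. -/
noncomputable def hitPotential (F : I → Finset α) (T : Finset α) : ℝ :=
  ∑ x, Real.exp (-((T ∩ F x).card : ℝ))

variable {F : I → Finset α} {T A : Finset α} {N B τ : ℝ}

lemma hitPotential_nonneg (F : I → Finset α) (T : Finset α) : 0 ≤ hitPotential F T :=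
  Finset.sum_nonneg fun _ _ => Real.exp_nonneg _

lemma exp_neg_card_le_hitPotential (F : I → Finset α) (T : Finset α) (x : I) :
    Real.exp (-((T ∩ F x).card : ℝ)) ≤ hitPotential F T :=
  Finset.single_le_sum (f := fun x => Real.exp (-((T ∩ F x).card : ℝ)))
    (fun _ _ => Real.exp_nonneg _) (Finset.mem_univ x)

lemma sum_hitPotential_insert_le {G : Finset α} (hTG : Disjoint T G)
    (hF : ∀ x, τ ≤ (F x ∩ G).card) :
    ∑ a ∈ G, hitPotential F (insert a T) ≤ hitPotential F T * (G.card - τ / 2) := by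
  unfold hitPotential
  rw [Finset.sum_comm, Finset.sum_mul]
  refine Finset.sum_le_sum fun x _ => ?_
  have hterm : ∀ a ∈ G, Real.exp (-((insert a T ∩ F x).card : ℝ)) ≤
      Real.exp (-((T ∩ F x).card : ℝ)) * (1 - 1 / 2 * (if a ∈ F x then 1 else 0)) := by
    intro a ha
    split_ifs with h
    · have haT : a ∉ T ∩ F x := fun h' =>
        Finset.disjoint_left.1 hTG (Finset.mem_inter.1 h').1 ha
      rw [Finset.insert_inter_of_mem h, Finset.card_insert_of_notMem haT, Nat.cast_succ, neg_add,
        Real.exp_add]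
      refine mul_le_mul_of_nonneg_left ?_ (Real.exp_nonneg _)
      rw [Real.exp_neg, inv_le_comm₀ (Real.exp_pos _) (by norm_num)]
      linarith [Real.exp_one_gt_d9]
    · rw [Finset.insert_inter_of_notMem h]
      simp
  refine (Finset.sum_le_sum hterm).trans ?_
  rw [← Finset.mul_sum, Finset.sum_sub_distrib, ← Finset.mul_sum, Finset.sum_boole,
    Finset.filter_mem_eq_inter, Finset.inter_comm G]
  refine mul_le_mul_of_nonneg_left ?_ (Real.exp_nonneg _)
  simp only [Finset.sum_const, nsmul_eq_mul, mul_one]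
  linarith [hF x]

lemma exists_hitPotential_insert_le {G : Finset α} (hTG : Disjoint T G) (hG : G.Nonempty)
    (hGN : G.card ≤ N) (hτ : 0 ≤ τ) (hF : ∀ x, τ ≤ (F x ∩ G).card) :
    ∃ a ∈ G, hitPotential F (insert a T) ≤ hitPotential F T * Real.exp (-(τ / N / 2)) := by
  have hN : 0 < N := (Nat.cast_pos.2 hG.card_pos).trans_le hGN
  have hτG : G.card * (τ / N) ≤ τ := by
    rw [mul_div_assoc', div_le_iff₀ hN, mul_comm]
    exact mul_le_mul_of_nonneg_left hGN hτ
  refine Finset.exists_le_of_sum_le hG ((sum_hitPotential_insert_le hTG hF).trans ?_)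
  rw [Finset.sum_const, nsmul_eq_mul, mul_left_comm]
  refine mul_le_mul_of_nonneg_left ?_ (hitPotential_nonneg F T)
  calc (G.card : ℝ) - τ / 2 ≤ G.card * (-(τ / N / 2) + 1) := by linarith
    _ ≤ G.card * Real.exp (-(τ / N / 2)) :=
        mul_le_mul_of_nonneg_left (Real.add_one_le_exp _) (Nat.cast_nonneg _)

variable [DecidableEq V] {supp : α → Finset V}

omit [DecidableEq α] in
lemma card_filter_not_disjoint_le (hB : ∀ v, ((A.filter (v ∈ supp ·)).card : ℝ) ≤ B)
    (U : Finset V) : ((A.filter fun a => ¬ Disjoint (supp a) U).card : ℝ) ≤ U.card * B := by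
  classical
  have hsub : A.filter (fun a => ¬ Disjoint (supp a) U) ⊆
      U.biUnion fun v => A.filter (v ∈ supp ·) := by
    intro a ha
    obtain ⟨haA, ha⟩ := Finset.mem_filter.1 ha
    obtain ⟨v, hva, hvU⟩ := Finset.not_disjoint_iff.1 ha
    exact Finset.mem_biUnion.2 ⟨v, hvU, Finset.mem_filter.2 ⟨haA, hva⟩⟩
  calc ((A.filter fun a => ¬ Disjoint (supp a) U).card : ℝ)
      ≤ ∑ v ∈ U, ((A.filter (v ∈ supp ·)).card : ℝ) := by
        exact_mod_cast (Finset.card_le_card hsub).trans Finset.card_biUnion_le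
    _ ≤ U.card * B := by
        rw [← nsmul_eq_mul]
        exact Finset.sum_le_card_nsmul _ _ _ fun v _ => hB v

lemma exists_disjoint_hitPotential_insert_le [Nonempty I] (hN : A.card ≤ N) (hτ : 0 < τ)
    (hB : ∀ v, ((A.filter (v ∈ supp ·)).card : ℝ) ≤ B) (hFA : ∀ x, F x ⊆ A)
    (hF : ∀ x, 2 * τ ≤ (F x).card) {U : Finset V} (hU : U.card * B ≤ τ)
    (hTU : ∀ a ∈ T, ¬ Disjoint (supp a) U) :
    ∃ a ∈ A, Disjoint (supp a) U ∧
      hitPotential F (insert a T) ≤ hitPotential F T * Real.exp (-(τ / N / 2)) := by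
  set G := A.filter fun a => Disjoint (supp a) U
  have hFG (x : I) : τ ≤ (F x ∩ G).card := by
    have hsub : F x ⊆ (F x ∩ G) ∪ A.filter fun a => ¬ Disjoint (supp a) U := by
      intro a ha
      by_cases h : Disjoint (supp a) U <;> simp [G, ha, hFA x ha, h]
    have hcard : ((F x).card : ℝ) ≤
        (F x ∩ G).card + (A.filter fun a => ¬ Disjoint (supp a) U).card := by
      exact_mod_cast (Finset.card_le_card hsub).trans (Finset.card_union_le _ _)
    linarith [hF x, card_filter_not_disjoint_le hB U]
  have hTG : Disjoint T G :=
    Finset.disjoint_left.2 fun a ha haG => hTU a ha (Finset.mem_filter.1 haG).2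
  have hG : G.Nonempty := by
    obtain ⟨x⟩ := ‹Nonempty I›
    have hpos : 0 < (F x ∩ G).card := by exact_mod_cast hτ.trans_le (hFG x)
    exact (Finset.card_pos.1 hpos).mono Finset.inter_subset_right
  have hGN : (G.card : ℝ) ≤ N :=
    (Nat.cast_le.2 (Finset.card_le_card (Finset.filter_subset _ _))).trans hN
  obtain ⟨a, haG, ha⟩ := exists_hitPotential_insert_le hTG hG hGN hτ.le hFG
  exact ⟨a, (Finset.mem_filter.1 haG).1, (Finset.mem_filter.1 haG).2, ha⟩

lemma exists_disjoint_hitPotential_le [Nonempty I] {k : ℕ} (hk : ∀ a ∈ A, (supp a).card ≤ k)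
    (hne : ∀ a ∈ A, (supp a).Nonempty) (hN : A.card ≤ N) (hτ : 0 < τ) (hB₀ : 0 ≤ B)
    (hB : ∀ v, ((A.filter (v ∈ supp ·)).card : ℝ) ≤ B) (hFA : ∀ x, F x ⊆ A)
    (hF : ∀ x, 2 * τ ≤ (F x).card) (Z : Finset V) (m : ℕ) (hm : (Z.card + k * m) * B ≤ τ) :
    ∃ T ⊆ A, T.card = m ∧ (T : Set α).PairwiseDisjoint supp ∧ (∀ a ∈ T, Disjoint (supp a) Z) ∧
      hitPotential F T ≤ Fintype.card I * Real.exp (-(τ / N / 2)) ^ m := by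
  induction m with
  | zero => exact ⟨∅, by simp, by simp, by simp, by simp, by simp [hitPotential]⟩
  | succ m ih =>
    obtain ⟨T, hTA, hTm, hTd, hTZ, hT⟩ := ih (le_trans (by gcongr; simp) hm)
    set U := Z ∪ T.biUnion supp
    have hUcard : U.card ≤ Z.card + k * (m + 1) := calc
      U.card ≤ Z.card + T.card * k := (Finset.card_union_le _ _).trans <|
        Nat.add_le_add_left
          (Finset.card_biUnion_le_card_mul _ _ _ fun a ha => hk a (hTA ha)) _
      _ ≤ Z.card + k * (m + 1) := by rw [hTm, mul_comm]; gcongr; omega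
    have hsuppU : ∀ a ∈ T, supp a ⊆ U := fun a ha =>
      (Finset.subset_biUnion_of_mem supp ha).trans Finset.subset_union_right
    obtain ⟨a, haA, haU, ha⟩ := exists_disjoint_hitPotential_insert_le hN hτ hB hFA hF
      (le_trans (by gcongr; exact_mod_cast hUcard) hm)
      fun a ha h => (hne a (hTA ha)).ne_empty (disjoint_self.1 (h.mono_right (hsuppU a ha)))
    have haT : a ∉ T := fun h =>
      (hne a haA).ne_empty (disjoint_self.1 (haU.mono_right (hsuppU a h)))
    refine ⟨insert a T, Finset.insert_subset haA hTA, by rw [Finset.card_insert_of_notMem haT, hTm],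
      ?_, ?_, ?_⟩
    · rw [Finset.coe_insert]
      exact hTd.insert fun b hb _ => haU.mono_right (hsuppU b hb)
    · exact (Finset.forall_mem_insert _ _ _).2 ⟨haU.mono_right Finset.subset_union_left, hTZ⟩
    · rw [pow_succ, ← mul_assoc]
      exact ha.trans (mul_le_mul_of_nonneg_right hT (Real.exp_nonneg _))

lemma exists_disjoint_selection [Nonempty I] {k : ℕ} (hk : ∀ a ∈ A, (supp a).card ≤ k)
    (hne : ∀ a ∈ A, (supp a).Nonempty) (hN : A.card ≤ N) (hτ : 0 < τ) (hB₀ : 0 ≤ B)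
    (hB : ∀ v, ((A.filter (v ∈ supp ·)).card : ℝ) ≤ B) (hFA : ∀ x, F x ⊆ A)
    (hF : ∀ x, 2 * τ ≤ (F x).card) (Z : Finset V) (m : ℕ) (hm : (Z.card + k * m) * B ≤ τ) :
    ∃ T ⊆ A, T.card = m ∧ (T : Set α).PairwiseDisjoint supp ∧ (∀ a ∈ T, Disjoint (supp a) Z) ∧
      ∀ x, τ / N * m / 2 - Real.log (Fintype.card I) ≤ ((T ∩ F x).card : ℝ) := by
  obtain ⟨T, hTA, hTm, hTd, hTZ, hT⟩ :=
    exists_disjoint_hitPotential_le hk hne hN hτ hB₀ hB hFA hF Z m hm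
  refine ⟨T, hTA, hTm, hTd, hTZ, fun x => ?_⟩
  have hexp := (exp_neg_card_le_hitPotential F T x).trans hT
  rw [← Real.exp_nat_mul, ← Real.exp_log (Nat.cast_pos.2 (Fintype.card_pos (α := I))),
    ← Real.exp_add, Real.exp_le_exp] at hexp
  linarith

end Selection

/-! ### Absorbing gadgets -/

section TupleCounting

variable {ι V : Type*} [Fintype ι] [DecidableEq ι] [Fintype V]

lemma card_filter_le_pow (q : ι) (p : (ι → V) → Prop) [DecidablePred p]
    (hp : ∀ g g' : ι → V, p g → p g' → (∀ j, j ≠ q → g j = g' j) → g q = g' q) :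
    (Finset.univ.filter p).card ≤ Fintype.card V ^ (Fintype.card ι - 1) := by
  have hcard : Fintype.card ({j // j ≠ q} → V) = Fintype.card V ^ (Fintype.card ι - 1) := by
    rw [Fintype.card_fun, Fintype.card_subtype_compl, Fintype.card_subtype_eq]
  rw [← hcard, ← Finset.card_univ]
  refine Finset.card_le_card_of_injOn (fun g j => g j.1) (fun _ _ => Finset.mem_univ _) ?_
  intro g hg g' hg' heq
  have hne : ∀ j, j ≠ q → g j = g' j := fun j hj => congrFun heq ⟨j, hj⟩
  ext j
  rcases eq_or_ne j q with rfl | h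
  · exact hp g g' (by simpa using hg) (by simpa using hg') hne
  · exact hne j h

variable [DecidableEq V]

lemma card_filter_mem_range_le (v : V) :
    (Finset.univ.filter fun g : ι → V => ∃ j, g j = v).card ≤
      Fintype.card ι * Fintype.card V ^ (Fintype.card ι - 1) := by
  have hsub : (Finset.univ.filter fun g : ι → V => ∃ j, g j = v) ⊆
      Finset.univ.biUnion fun j => Finset.univ.filter fun g : ι → V => g j = v := by
    intro g hg
    simpa using hg
  refine (Finset.card_le_card hsub).trans (Finset.card_biUnion_le_card_mul _ _ _ fun j _ => ?_)
  exact card_filter_le_pow j _ fun g g' h h' _ => h.trans h'.symm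

lemma card_filter_not_injective_le :
    (Finset.univ.filter fun g : ι → V => ¬ Function.Injective g).card ≤
      Fintype.card ι ^ 2 * Fintype.card V ^ (Fintype.card ι - 1) := by
  have hsub : (Finset.univ.filter fun g : ι → V => ¬ Function.Injective g) ⊆
      (Finset.univ.filter fun p : ι × ι => p.1 ≠ p.2).biUnion
        fun p => Finset.univ.filter fun g : ι → V => g p.1 = g p.2 := by
    intro g hg
    obtain ⟨a, b, hab, hne⟩ := Function.not_injective_iff.1 (Finset.mem_filter.1 hg).2
    simp only [Finset.mem_biUnion, Finset.mem_filter, Finset.mem_univ, true_and]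
    exact ⟨(a, b), hne, hab⟩
  have hpair : ∀ p ∈ Finset.univ.filter fun p : ι × ι => p.1 ≠ p.2,
      (Finset.univ.filter fun g : ι → V => g p.1 = g p.2).card ≤
        Fintype.card V ^ (Fintype.card ι - 1) := by
    refine fun p hp => card_filter_le_pow p.2 _ fun g g' h h' hj => ?_
    rw [← h, ← h']
    exact hj _ (Finset.mem_filter.1 hp).2
  refine (Finset.card_le_card hsub).trans ((Finset.card_biUnion_le_card_mul _ _ _ hpair).trans
    (Nat.mul_le_mul_right _ ((Finset.card_le_univ _).trans_eq ?_)))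
  rw [Fintype.card_prod, pow_two]

end TupleCounting

lemma exists_injective_mem_of_card_le {α β : Type*} [Fintype β] (t : β → Finset α)
    (h : ∀ b, Fintype.card β ≤ (t b).card) :
    ∃ g : β → α, Function.Injective g ∧ ∀ b, g b ∈ t b := by
  classical
  refine (Finset.all_card_le_biUnion_card_iff_exists_injective t).1 fun s => ?_
  rcases s.eq_empty_or_nonempty with rfl | ⟨b, hb⟩
  · simp
  · exact (Finset.card_le_univ s).trans
      ((h b).trans (Finset.card_le_card (Finset.subset_biUnion_of_mem t hb)))

section Absorption

variable {V : Type*} [DecidableEq V] {E : Finset (Finset V)}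

lemma Matchable.biUnion_union_biUnion {α β : Type*} {t : α → Finset V} {w : β → Finset V}
    {T : Finset α} {s : Finset β} {g : β → α} (hT : ∀ a ∈ T, Matchable E (t a))
    (hTd : (T : Set α).PairwiseDisjoint t) (hsd : (s : Set β).PairwiseDisjoint w)
    (hTs : ∀ a ∈ T, ∀ b ∈ s, Disjoint (t a) (w b)) (hg : Set.MapsTo g s T) (hinj : Set.InjOn g s)
    (hgw : ∀ b ∈ s, Matchable E (t (g b) ∪ w b)) :
    Matchable E (T.biUnion t ∪ s.biUnion w) := by
  classical
  induction s using Finset.induction_on generalizing T with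
  | empty => simpa using Matchable.biUnion T t hT hTd
  | insert b s hb ih =>
    rw [Finset.coe_insert] at hsd hg hinj
    have hgb : g b ∈ T := hg (Set.mem_insert _ _)
    have hTe : T.erase (g b) ⊆ T := Finset.erase_subset _ _
    have hrest : Matchable E ((T.erase (g b)).biUnion t ∪ s.biUnion w) :=
      ih (fun a ha => hT a (hTe ha)) (hTd.subset (Finset.coe_subset.2 hTe))
        (hsd.subset (Set.subset_insert _ _))
        (fun a ha c hc => hTs a (hTe ha) c (Finset.mem_insert_of_mem hc))
        (fun c hc => Finset.mem_erase.2 ⟨fun h => hb <| by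
          rwa [← hinj (Set.mem_insert_of_mem _ hc) (Set.mem_insert _ _) h],
          hg (Set.mem_insert_of_mem _ hc)⟩)
        (hinj.mono (Set.subset_insert _ _)) fun c hc => hgw c (Finset.mem_insert_of_mem hc)
    have hset : T.biUnion t ∪ (insert b s).biUnion w =
        (t (g b) ∪ w b) ∪ ((T.erase (g b)).biUnion t ∪ s.biUnion w) := by
      conv_lhs => rw [← Finset.insert_erase hgb]
      rw [Finset.biUnion_insert, Finset.biUnion_insert, Finset.union_union_union_comm]
    rw [hset]
    refine (hgw b (Finset.mem_insert_self _ _)).union hrest ?_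
    simp only [Finset.disjoint_union_left, Finset.disjoint_union_right,
      Finset.disjoint_biUnion_right]
    exact ⟨fun a ha => ⟨hTd hgb (hTe ha) (Finset.ne_of_mem_erase ha).symm,
        (hTs a (hTe ha) b (Finset.mem_insert_self _ _)).symm⟩,
      fun c hc => ⟨hTs _ hgb c (Finset.mem_insert_of_mem hc),
        hsd (Set.mem_insert _ _) (Set.mem_insert_of_mem _ hc)
          (ne_of_mem_of_not_mem hc hb).symm⟩⟩

/-- The `i`-th row of a `3 × 3` array of vertices. -/
def arrayRow (g : Fin 3 × Fin 3 → V) (i : Fin 3) : Finset V := {g (i, 0), g (i, 1), g (i, 2)}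

/-- The first column of a `3 × 3` array of vertices. -/
def arrayColumn (g : Fin 3 × Fin 3 → V) : Finset V := Finset.univ.image fun i => g (i, 0)

/-- The array obtained from `g` by replacing its first column by `u`. -/
def exchange (g : Fin 3 × Fin 3 → V) (u : Fin 3 → V) (q : Fin 3 × Fin 3) : V :=
  if q.2 = 0 then u q.1 else g q

lemma matchable_image_of_row_mem {g : Fin 3 × Fin 3 → V} (hg : Function.Injective g)
    (hrow : ∀ i, arrayRow g i ∈ E) : Matchable E (Finset.univ.image g) := by
  have hrows (i : Fin 3) : arrayRow g i = Finset.univ.image fun j => g (i, j) := by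
    simp [arrayRow, Fin.univ_succ]
  have himage : Finset.univ.image g = Finset.univ.biUnion (arrayRow g) := by
    ext v
    simp [hrows]
  rw [himage]
  refine Matchable.biUnion _ _ (fun i _ => matchable_of_mem (hrow i)) fun i _ j _ hij => ?_
  simp only [Function.onFun, hrows, Finset.disjoint_left, Finset.mem_image, Finset.mem_univ,
    true_and, not_exists]
  rintro _ ⟨k, rfl⟩ l h
  exact hij (congrArg Prod.fst (hg h)).symm

lemma matchable_image_union_image {g : Fin 3 × Fin 3 → V} {u : Fin 3 → V}
    (hg : Function.Injective g) (hu : Function.Injective u) (hug : ∀ i q, u i ≠ g q)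
    (hcol : arrayColumn g ∈ E) (hrow : ∀ i, arrayRow (exchange g u) i ∈ E) :
    Matchable E (Finset.univ.image g ∪ Finset.univ.image u) := by
  have hset : Finset.univ.image g ∪ Finset.univ.image u =
      arrayColumn g ∪ Finset.univ.image (exchange g u) := by
    ext v
    simp only [Finset.mem_union, Finset.mem_image, Finset.mem_univ, true_and, arrayColumn,
      exchange, Prod.exists]
    constructor
    · rintro (⟨i, j, rfl⟩ | ⟨i, rfl⟩)
      · rcases eq_or_ne j 0 with rfl | hj
        · exact .inl ⟨i, rfl⟩
        · exact .inr ⟨i, j, if_neg hj⟩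
      · exact .inr ⟨i, 0, if_pos rfl⟩
    · rintro (⟨i, rfl⟩ | ⟨i, j, rfl⟩)
      · exact .inl ⟨i, 0, rfl⟩
      · split_ifs
        · exact .inr ⟨i, rfl⟩
        · exact .inl ⟨i, j, rfl⟩
  have hexchange : Function.Injective (exchange g u) := by
    rintro ⟨i, j⟩ ⟨i', j'⟩ h
    unfold exchange at h
    split_ifs at h with hj hj'
    · exact Prod.ext (hu h) (hj.trans hj'.symm)
    · exact absurd h (hug _ _)
    · exact absurd h.symm (hug _ _)
    · exact hg h
  have hdisj : Disjoint (arrayColumn g) (Finset.univ.image (exchange g u)) := by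
    simp only [arrayColumn, Finset.disjoint_left, Finset.mem_image, Finset.mem_univ, true_and,
      not_exists]
    rintro _ ⟨i, rfl⟩ q h
    unfold exchange at h
    split_ifs at h with hq
    · exact hug _ _ h
    · exact hq (congrArg Prod.snd (hg h))
  rw [hset]
  exact (matchable_of_mem hcol).union (matchable_image_of_row_mem hexchange hrow) hdisj

variable [Fintype V]

/-- The pairs that form an edge both with `x` and with `y`. -/
def commonLink (E : Finset (Finset V)) (x y : V) : Finset (V × V) :=
  Finset.univ.filter fun p => {x, p.1, p.2} ∈ E ∧ {y, p.1, p.2} ∈ E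

/-- The ordered edges whose `i`-th vertex lies in `P i`. -/
def partiteEdges (E : Finset (Finset V)) (P : Fin 3 → Finset V) : Finset (Fin 3 → V) :=
  Finset.univ.filter fun a => (∀ i, a i ∈ P i) ∧ Finset.univ.image a ∈ E

/-- The gadgets: arrays of nine distinct vertices whose rows and whose first column are edges. -/
def gadgets (E : Finset (Finset V)) : Finset (Fin 3 × Fin 3 → V) :=
  Finset.univ.filter fun g => Function.Injective g ∧ arrayColumn g ∈ E ∧ ∀ i, arrayRow g i ∈ E

/-- The gadgets that absorb the triple `u`: matched by their rows alone, and together with `u` by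
their first column and the rows with `u` exchanged for it. -/
def absorbers (E : Finset (Finset V)) (u : Fin 3 → V) : Finset (Fin 3 × Fin 3 → V) :=
  (gadgets E).filter fun g => ∀ i, arrayRow (exchange g u) i ∈ E

lemma matchable_image_of_mem_gadgets {g : Fin 3 × Fin 3 → V} (hg : g ∈ gadgets E) :
    Matchable E (Finset.univ.image g) := by
  obtain ⟨hinj, -, hrow⟩ := (Finset.mem_filter.1 hg).2
  exact matchable_image_of_row_mem hinj hrow

lemma matchable_image_union_of_mem_absorbers {g : Fin 3 × Fin 3 → V} {u : Fin 3 → V}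
    (hg : g ∈ absorbers E u) (hu : Function.Injective u)
    (hgu : Disjoint (Finset.univ.image g) (Finset.univ.image u)) :
    Matchable E (Finset.univ.image g ∪ Finset.univ.image u) := by
  obtain ⟨hgadget, hrow⟩ := Finset.mem_filter.1 hg
  obtain ⟨hinj, hcol, -⟩ := (Finset.mem_filter.1 hgadget).2
  refine matchable_image_union_image hinj hu (fun i q => ?_) hcol hrow
  exact (Finset.disjoint_iff_ne.1 hgu _ (Finset.mem_image_of_mem g (Finset.mem_univ q)) _
    (Finset.mem_image_of_mem u (Finset.mem_univ i))).symm

lemma card_sigma_commonLink_le (P : Fin 3 → Finset V) (u : Fin 3 → V) :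
    ((partiteEdges E P).sigma fun a => Fintype.piFinset fun i => commonLink E (u i) (a i)).card ≤
      (absorbers E u).card + 81 * Fintype.card V ^ 8 := by
  set bad := Finset.univ.filter fun g : Fin 3 × Fin 3 → V => ¬ Function.Injective g
  have hbad : bad.card ≤ 81 * Fintype.card V ^ 8 := by
    simpa using card_filter_not_injective_le (V := V) (ι := Fin 3 × Fin 3)
  refine le_trans ?_ ((Finset.card_union_le (absorbers E u) bad).trans (by gcongr))
  refine Finset.card_le_card_of_injOn
    (fun s q => ![s.1 q.1, (s.2 q.1).1, (s.2 q.1).2] q.2) ?_ ?_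
  · rintro ⟨a, p⟩ hap
    obtain ⟨ha, hp⟩ := Finset.mem_sigma.1 hap
    have hcol := (Finset.mem_filter.1 ha).2.2
    have hlink (i : Fin 3) := (Finset.mem_filter.1 (Fintype.mem_piFinset.1 hp i)).2
    simp only [Finset.coe_union, Set.mem_union, Finset.mem_coe]
    refine (em _).imp (fun hinj => ?_) fun hinj => Finset.mem_filter.2 ⟨Finset.mem_univ _, hinj⟩
    exact Finset.mem_filter.2 ⟨Finset.mem_filter.2 ⟨Finset.mem_univ _, hinj, hcol,
      fun i => (hlink i).2⟩, fun i => (hlink i).1⟩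
  · rintro ⟨a, p⟩ - ⟨a', p'⟩ - heq
    obtain rfl : a = a' := funext fun i => congrFun heq (i, 0)
    obtain rfl : p = p' := funext fun i => Prod.ext (congrFun heq (i, 1)) (congrFun heq (i, 2))
    rfl

variable {P : Fin 3 → Finset V} {η : ℝ}

lemma le_card_sigma_commonLink (hη : 0 ≤ η)
    (hP : η * (Fintype.card V : ℝ) ^ 3 ≤ (partiteEdges E P).card)
    (hlink : ∀ i, ∀ x ∈ P i, ∀ y ∈ P i, η * (Fintype.card V : ℝ) ^ 2 ≤ (commonLink E x y).card)
    {u : Fin 3 → V} (hu : ∀ i, u i ∈ P i) :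
    η ^ 4 * (Fintype.card V : ℝ) ^ 9 ≤ ((partiteEdges E P).sigma fun a =>
      Fintype.piFinset fun i => commonLink E (u i) (a i)).card := by
  set n := (Fintype.card V : ℝ)
  have hfiber : ∀ a ∈ partiteEdges E P, (η * n ^ 2) ^ 3 ≤
      ((Fintype.piFinset fun i => commonLink E (u i) (a i)).card : ℝ) := by
    intro a ha
    rw [Fintype.card_piFinset, Nat.cast_prod]
    calc (η * n ^ 2) ^ 3 = ∏ _i : Fin 3, η * n ^ 2 := by simp
      _ ≤ _ := Finset.prod_le_prod (fun _ _ => by positivity) fun i _ =>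
          hlink i _ (hu i) _ ((Finset.mem_filter.1 ha).2.1 i)
  calc η ^ 4 * n ^ 9 = η * n ^ 3 * (η * n ^ 2) ^ 3 := by ring
    _ ≤ (partiteEdges E P).card * (η * n ^ 2) ^ 3 := by gcongr
    _ ≤ _ := by
        rw [← nsmul_eq_mul, Finset.card_sigma, Nat.cast_sum]
        exact Finset.card_nsmul_le_sum _ _ _ hfiber

lemma le_card_absorbers (hη : 0 ≤ η)
    (hP : η * (Fintype.card V : ℝ) ^ 3 ≤ (partiteEdges E P).card)
    (hlink : ∀ i, ∀ x ∈ P i, ∀ y ∈ P i, η * (Fintype.card V : ℝ) ^ 2 ≤ (commonLink E x y).card)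
    (hn : 162 ≤ η ^ 4 * Fintype.card V) {u : Fin 3 → V} (hu : ∀ i, u i ∈ P i) :
    η ^ 4 * (Fintype.card V : ℝ) ^ 9 / 2 ≤ (absorbers E u).card := by
  set n := (Fintype.card V : ℝ) with hn_def
  have hlower := le_card_sigma_commonLink hη hP hlink hu
  have hupper : (((partiteEdges E P).sigma fun a =>
      Fintype.piFinset fun i => commonLink E (u i) (a i)).card : ℝ) ≤
      (absorbers E u).card + 81 * n ^ 8 := by
    rw [hn_def]
    exact_mod_cast card_sigma_commonLink_le P u
  have hbad : 162 * n ^ 8 ≤ η ^ 4 * n * n ^ 8 := by gcongr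
  linarith

lemma card_gadgets_le : ((gadgets E).card : ℝ) ≤ (Fintype.card V : ℝ) ^ 9 := by
  have hle := Finset.card_le_univ (gadgets E)
  rw [Fintype.card_fun, Fintype.card_prod, Fintype.card_fin] at hle
  exact_mod_cast hle

lemma card_filter_mem_gadgets_le (v : V) :
    (((gadgets E).filter fun g => v ∈ Finset.univ.image g).card : ℝ) ≤
      9 * (Fintype.card V : ℝ) ^ 8 := by
  have hrange := card_filter_mem_range_le (ι := Fin 3 × Fin 3) v
  rw [Fintype.card_prod, Fintype.card_fin] at hrange
  have hsub : ((gadgets E).filter fun g => v ∈ Finset.univ.image g) ⊆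
      Finset.univ.filter fun g => ∃ j, g j = v := by
    intro g hg
    simpa using (Finset.mem_filter.1 hg).2
  exact_mod_cast (Finset.card_le_card hsub).trans hrange

lemma exists_disjoint_gadgets (hη : 0 < η)
    (hP : η * (Fintype.card V : ℝ) ^ 3 ≤ (partiteEdges E P).card)
    (hlink : ∀ i, ∀ x ∈ P i, ∀ y ∈ P i, η * (Fintype.card V : ℝ) ^ 2 ≤ (commonLink E x y).card)
    (hn : 162 ≤ η ^ 4 * Fintype.card V) (m : ℕ) (hm : 324 * m ≤ η ^ 4 * Fintype.card V) :
    ∃ T ⊆ gadgets E, T.card = m ∧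
      (T : Set (Fin 3 × Fin 3 → V)).PairwiseDisjoint (fun g => Finset.univ.image g) ∧
      ∀ u : Fin 3 → V, (∀ i, u i ∈ P i) →
        η ^ 4 * m / 8 - 3 * Real.log (Fintype.card V) ≤ (T ∩ absorbers E u).card := by
  set n := (Fintype.card V : ℝ) with hn_def
  have hn₀ : 0 < n := pos_of_mul_pos_right (by linarith) (by positivity : 0 ≤ η ^ 4)
  let I := {u : Fin 3 → V // ∀ i, u i ∈ P i}
  have : Nonempty I := by
    have hpos : 0 < (partiteEdges E P).card := by
      exact_mod_cast (show 0 < η * n ^ 3 by positivity).trans_le hP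
    obtain ⟨a, ha⟩ := Finset.card_pos.1 hpos
    exact ⟨⟨a, (Finset.mem_filter.1 ha).2.1⟩⟩
  have hlog : Real.log (Fintype.card I) ≤ 3 * Real.log n := by
    have hI : Fintype.card I ≤ Fintype.card V ^ 3 := by
      simpa using Fintype.card_subtype_le fun u : Fin 3 → V => ∀ i, u i ∈ P i
    rw [← Real.log_rpow hn₀, hn_def]
    exact Real.log_le_log (by exact_mod_cast Fintype.card_pos) (by exact_mod_cast hI)
  have hm' : 324 * m * n ^ 8 ≤ η ^ 4 * n * n ^ 8 := by gcongr
  obtain ⟨T, hTA, hTm, hTd, -, hT⟩ := exists_disjoint_selection (I := I) (k := 9)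
    (τ := η ^ 4 * n ^ 9 / 4) (F := fun u => absorbers E u.1)
    (fun g _ => by simpa using Finset.card_image_le (s := Finset.univ) (f := g))
    (fun g _ => by simp) card_gadgets_le (by positivity) (by positivity)
    card_filter_mem_gadgets_le
    (fun u => Finset.filter_subset _ _)
    (fun u => by linarith [le_card_absorbers hη.le hP hlink hn u.2])
    ∅ m (by push_cast [Finset.card_empty]; linarith)
  refine ⟨T, hTA, hTm, hTd, fun u hu => ?_⟩
  have hτ : η ^ 4 * n ^ 9 / 4 / n ^ 9 * m / 2 = η ^ 4 * m / 8 := by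
    field_simp
    ring
  linarith [hT ⟨u, hu⟩]

theorem exists_absorber (hη : 0 < η)
    (hP : η * (Fintype.card V : ℝ) ^ 3 ≤ (partiteEdges E P).card)
    (hlink : ∀ i, ∀ x ∈ P i, ∀ y ∈ P i, η * (Fintype.card V : ℝ) ^ 2 ≤ (commonLink E x y).card)
    (hn : 162 ≤ η ^ 4 * Fintype.card V) (m : ℕ) (hm : 324 * m ≤ η ^ 4 * Fintype.card V) :
    ∃ A : Finset V, Matchable E A ∧ A.card ≤ 9 * m ∧ ∀ 𝒰 : Finset (Fin 3 → V),
      (𝒰.card : ℝ) ≤ η ^ 4 * m / 8 - 3 * Real.log (Fintype.card V) →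
      (∀ u ∈ 𝒰, Function.Injective u ∧ ∀ i, u i ∈ P i ∧ u i ∉ A) →
      (𝒰 : Set (Fin 3 → V)).PairwiseDisjoint (fun u => Finset.univ.image u) →
      Matchable E (A ∪ 𝒰.biUnion fun u => Finset.univ.image u) := by
  obtain ⟨T, hTA, rfl, hTd, hT⟩ := exists_disjoint_gadgets hη hP hlink hn m hm
  have hmatch : ∀ g ∈ T, Matchable E (Finset.univ.image g) :=
    fun g hg => matchable_image_of_mem_gadgets (hTA hg)
  refine ⟨T.biUnion fun g => Finset.univ.image g, Matchable.biUnion _ _ hmatch hTd, ?_, ?_⟩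
  · refine (Finset.card_biUnion_le_card_mul _ _ 9 fun g _ => ?_).trans_eq (mul_comm _ _)
    simpa using Finset.card_image_le (s := Finset.univ) (f := g)
  intro 𝒰 hcard hU hUd
  have hdisj : ∀ g ∈ T, ∀ u ∈ 𝒰, Disjoint (Finset.univ.image g) (Finset.univ.image u) := by
    refine fun g hg u hu => Finset.disjoint_left.2 fun v hvg hvu => ?_
    obtain ⟨i, -, rfl⟩ := Finset.mem_image.1 hvu
    exact ((hU u hu).2 i).2 (Finset.mem_biUnion.2 ⟨g, hg, hvg⟩)
  obtain ⟨g, hinj, hg⟩ := exists_injective_mem_of_card_le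
    (fun u : 𝒰 => T ∩ absorbers E u.1) fun u => by
      rw [Fintype.card_coe]
      exact_mod_cast hcard.trans (hT u.1 fun i => ((hU u.1 u.2).2 i).1)
  have hgT (u : 𝒰) : g u ∈ T := (Finset.mem_inter.1 (hg u)).1
  rw [← Finset.attach_biUnion (s := 𝒰)]
  exact Matchable.biUnion_union_biUnion hmatch hTd
    (fun u _ u' _ hne => hUd u.2 u'.2 (Subtype.coe_injective.ne hne))
    (fun a ha u _ => hdisj a ha u u.2) (fun u _ => hgT u) hinj.injOn fun u _ =>
      matchable_image_union_of_mem_absorbers (Finset.mem_inter.1 (hg u)).2 (hU u u.2).1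
        (hdisj _ (hgT u) u u.2)

end Absorption

/-! ### Almost perfect matchings -/

section PairCount

variable {V : Type*} {P Q R : V → V → Prop} {S T : Finset V}

lemma pairCount_le_pairCount (h : ∀ a ∈ S, ∀ b ∈ S, P a b → a ∈ T ∧ b ∈ T ∧ Q a b) :
    pairCount P S ≤ pairCount Q T := by
  classical
  have hcount (P : V → V → Prop) (S : Finset V) :
      pairCount P S = ((S ×ˢ S).filter fun p => P p.1 p.2).card := by
    rw [Finset.card_filter, Finset.sum_product]
    exact Finset.sum_congr rfl fun a _ => Finset.sum_congr rfl fun b _ => by unfold ind; congr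
  rw [hcount, hcount]
  refine Finset.card_le_card fun p hp => ?_
  simp only [Finset.mem_filter, Finset.mem_product] at hp ⊢
  obtain ⟨ha, hb, hQ⟩ := h p.1 hp.1.1 p.2 hp.1.2 hp.2
  exact ⟨⟨ha, hb⟩, hQ⟩

lemma pairCount_le_add (h : ∀ a ∈ S, ∀ b ∈ S, P a b → Q a b ∨ R a b) :
    pairCount P S ≤ pairCount Q S + pairCount R S := by
  unfold pairCount
  simp only [← Finset.sum_add_distrib]
  refine Finset.sum_le_sum fun a ha => Finset.sum_le_sum fun b hb => ?_
  by_cases hP : P a b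
  · rcases h a ha b hb hP with hQ | hR
    · rw [ind_of hQ]
      exact (ind_le_one _).trans (Nat.le_add_right _ _)
    · rw [ind_of hR]
      exact (ind_le_one _).trans (Nat.le_add_left _ _)
  · simp [ind_of_not hP]

lemma pairCount_add_pairCount_not (P : V → V → Prop) (S : Finset V) :
    pairCount P S + pairCount (fun a b => ¬P a b) S = S.card ^ 2 := by
  have hind (a b : V) : ind (P a b) + ind (¬P a b) = 1 := by
    by_cases h : P a b
    · rw [ind_of h, ind_of_not (not_not.2 h)]
    · rw [ind_of h, ind_of_not h]
  unfold pairCount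
  simp only [← Finset.sum_add_distrib, hind]
  simp [pow_two]

lemma pairCount_add_sq_le (P : V → V → Prop) (h : S ⊆ T) :
    pairCount P T + S.card ^ 2 ≤ pairCount P S + T.card ^ 2 := by
  have hnot := pairCount_mono_right (fun a b => ¬P a b) h
  have hS := pairCount_add_pairCount_not P S
  have hT := pairCount_add_pairCount_not P T
  omega

lemma pairCount_coe (P : V → V → Prop) (S : Finset V) :
    pairCount (fun a b : S => P a b) Finset.univ = pairCount P S := by
  unfold pairCount
  rw [← Finset.sum_coe_sort S]
  exact Finset.sum_congr rfl fun a _ => Finset.sum_coe_sort S fun b => ind (P a b)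

lemma pairCount_notMem [DecidableEq V] (W S : Finset V) :
    pairCount (fun a b => a ∉ W ∧ b ∉ W) S = (S \ W).card ^ 2 := by
  have hle := pairCount_le_pairCount (P := fun a b => a ∉ W ∧ b ∉ W) (S := S) (T := S \ W)
    (Q := fun _ _ => True) fun a ha b hb h => by simp [ha, hb, h]
  have hge := pairCount_le_pairCount (P := fun _ _ : V => True) (S := S \ W) (T := S)
    (Q := fun a b => a ∉ W ∧ b ∉ W) fun a ha b hb _ => by simp_all
  rw [le_antisymm hle hge]
  simp [pairCount, ind_of, pow_two]

lemma mul_sq_le_pairCount_of_density_le {c ξ : ℝ} (hS : S.Nonempty) (hT : T.Nonempty)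
    (hdens : density P T - ξ ≤ density P S) (hc : c * (T.card : ℝ) ^ 2 ≤ pairCount P T) :
    (c - ξ) * (S.card : ℝ) ^ 2 ≤ pairCount P S := by
  have : (0 : ℝ) < S.card := by exact_mod_cast hS.card_pos
  have : (0 : ℝ) < T.card := by exact_mod_cast hT.card_pos
  unfold density at hdens
  rw [← le_div_iff₀ (by positivity)] at hc ⊢
  linarith

variable [DecidableEq V] [Fintype V]

lemma cast_card_compl (W : Finset V) : ((Wᶜ).card : ℝ) = Fintype.card V - W.card := by
  rw [Finset.card_compl, Nat.cast_sub (Finset.card_le_univ _)]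

lemma pairCount_univ_le (P : V → V → Prop) (W : Finset V) :
    (pairCount P Finset.univ : ℝ) + ((Fintype.card V : ℝ) - W.card) ^ 2 ≤
      pairCount P Wᶜ + (Fintype.card V : ℝ) ^ 2 := by
  rw [← cast_card_compl]
  exact_mod_cast pairCount_add_sq_le P (Finset.subset_univ Wᶜ)

lemma pairCount_univ_le_add (P : V → V → Prop) (Z : Finset V) :
    (pairCount P Finset.univ : ℝ) ≤ pairCount P Zᶜ + 2 * Z.card * Fintype.card V := by
  linarith [pairCount_univ_le P Z, sq_nonneg (Z.card : ℝ)]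

end PairCount

section Link

variable {V : Type*} [DecidableEq V] {E : Finset (Finset V)} {S T W : Finset V}

/-- The link graph of the vertex `v` in the `3`-graph with edge set `E`, as a binary relation. -/
def link (E : Finset (Finset V)) (v a b : V) : Prop := {v, a, b} ∈ E

lemma link.swap_left {a b c : V} (h : link E a b c) : link E b a c := by
  unfold link at *
  rwa [Finset.insert_comm]

lemma link.swap_right {a b c : V} (h : link E a b c) : link E a c b := by
  unfold link at *
  rwa [Finset.pair_comm]

lemma pairCount_link (E : Finset (Finset V)) (v : V) (S : Finset V) :
    pairCount (link E v) S = ((S ×ˢ S).filter fun p => {v, p.1, p.2} ∈ E).card := by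
  rw [Finset.card_filter, Finset.sum_product]
  exact Finset.sum_congr rfl fun a _ => Finset.sum_congr rfl fun b _ => by unfold ind link; congr

lemma image_univ_fin_three (f : Fin 3 → V) : Finset.univ.image f = {f 0, f 1, f 2} := by
  simp [Fin.univ_succ]

lemma triples_link (E : Finset (Finset V)) (S : Finset V) :
    triples (fun a b c : S => link E a b c) = edgeTriples E S := by
  ext f
  simp only [triples, edgeTriples, link, entries, Set.mem_ofPred_eq, image_univ_fin_three]

/-- The degree conditions on the set `S`: the degrees in `S` of adjacent vertices have a large sum,
all degrees are positive and the vertices outside `W` are not light, in each case with a margin of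
`ξ * |S| ^ 2`. -/
structure IsRobustOn (E : Finset (Finset V)) (W : Finset V) (ξ : ℝ) (S : Finset V) : Prop where
  le_add : ∀ u ∈ S, ∀ v ∈ S, ∀ w ∈ S, link E u v w →
    (6 / 5 + 2 * ξ) * (S.card : ℝ) ^ 2 ≤ pairCount (link E u) S + pairCount (link E v) S
  le : ∀ v ∈ S, ξ * (S.card : ℝ) ^ 2 ≤ pairCount (link E v) S
  le_of_notMem : ∀ v ∈ S, v ∉ W → (3 / 5 + ξ) * (S.card : ℝ) ^ 2 ≤ pairCount (link E v) S

namespace IsRobustOn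

variable {ξ : ℝ}

lemma exists_isDecomposition (h : IsRobustOn E W ξ S) (hξ : 0 < ξ) (hS : S.Nonempty)
    (hW : 3 * (W ∩ S).card ≤ S.card) : ∃ x, IsDecomposition (edgeTriples E S) x := by
  have : Nonempty S := hS.to_subtype
  have : (0 : ℝ) < S.card := by exact_mod_cast hS.card_pos
  have hmargin : 0 < ξ * (S.card : ℝ) ^ 2 := by positivity
  rw [← triples_link]
  refine IsOreRelation.exists_isDecomposition
    ⟨fun _ _ _ => link.swap_left, fun _ _ _ => link.swap_right, fun v => ?_, fun u v w huvw => ?_⟩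
    ?_
  · by_contra! hno
    have hzero : pairCount (link E v) S = 0 := by
      rw [← pairCount_coe]
      exact Finset.sum_eq_zero fun a _ => Finset.sum_eq_zero fun b _ => ind_of_not (hno a b)
    have hdeg := h.le v v.2
    rw [hzero, Nat.cast_zero] at hdeg
    linarith
  · rw [pairCount_coe (link E u), pairCount_coe (link E v), Fintype.card_coe]
    linarith [h.le_add u u.2 v v.2 w w.2 huvw]
  · rw [Fintype.card_coe]
    refine le_trans (Nat.mul_le_mul_left 3 ?_) hW
    rw [← Set.ncard_coe_finset]
    refine Set.ncard_le_ncard_of_injOn Subtype.val (fun v hv => ?_) Subtype.val_injective.injOn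
    by_contra hvW
    have hdeg := h.le_of_notMem v v.2 fun hv => hvW (by simp [hv])
    have hlight : (pairCount (link E v) S : ℝ) < 3 / 5 * (S.card : ℝ) ^ 2 := by
      rw [← pairCount_coe, ← Fintype.card_coe S]
      exact hv
    linarith

lemma of_density_le {ζ : ℝ} (h : IsRobustOn E W ξ T) (hS : S.Nonempty) (hST : S ⊆ T)
    (hdens : ∀ v ∈ S, density (link E v) T - ζ ≤ density (link E v) S) :
    IsRobustOn E W (ξ - ζ) S := by
  have hT := hS.mono hST
  have : (0 : ℝ) < S.card := by exact_mod_cast hS.card_pos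
  have : (0 : ℝ) < T.card := by exact_mod_cast hT.card_pos
  have transfer (v : V) (hv : v ∈ S) {c : ℝ}
      (hc : c * (T.card : ℝ) ^ 2 ≤ pairCount (link E v) T) :
      (c - ζ) * (S.card : ℝ) ^ 2 ≤ pairCount (link E v) S :=
    mul_sq_le_pairCount_of_density_le hS hT (hdens v hv) hc
  refine ⟨fun u hu v hv w hw huvw => ?_, fun v hv => transfer v hv (h.le v (hST hv)),
    fun v hv hvW => ?_⟩
  · have hadj := h.le_add u (hST hu) v (hST hv) w (hST hw) huvw
    rw [← le_div_iff₀ (by positivity), add_div] at hadj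
    have hu' := transfer u hu (div_mul_cancel₀ _ (by positivity)).le
    have hv' := transfer v hv (div_mul_cancel₀ _ (by positivity)).le
    nlinarith [mul_le_mul_of_nonneg_right hadj (sq_nonneg (S.card : ℝ))]
  · linarith [transfer v hv (h.le_of_notMem v (hST hv) hvW)]

end IsRobustOn

end Link

section AlmostMatching

variable {γ ε n : ℝ}

/-- The number of vertices above which edges can be removed while all densities are preserved up to
`γ / 2`, until only an `ε`-proportion of the vertices is left. -/
noncomputable def guidedThreshold (γ ε : ℝ) : ℝ :=
  1 + 6 / ε + 625 / ε ^ 2 + 144 / (ε * γ / 50) ^ 4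

lemma le_of_guidedThreshold_le (hγ : 0 < γ) (hε : 0 < ε) (hn : guidedThreshold γ ε ≤ n) :
    1 ≤ n ∧ 6 ≤ ε * n ∧ 625 ≤ ε ^ 2 * n ∧ 144 ≤ (ε * γ / 50) ^ 4 * n := by
  have h₁ : 0 ≤ 6 / ε := by positivity
  have h₂ : 0 ≤ 625 / ε ^ 2 := by positivity
  have h₃ : 0 ≤ 144 / (ε * γ / 50) ^ 4 := by positivity
  unfold guidedThreshold at hn
  refine ⟨by linarith, ?_, ?_, ?_⟩ <;> rw [← div_le_iff₀' (by positivity)] <;> linarith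

lemma three_mul_add_one_le_exp (hγ : 0 < γ) (hε : 0 < ε) (hn : guidedThreshold γ ε ≤ n) :
    3 * (n + 1) ≤ Real.exp (ε * √n / 25 * (γ / 2)) := by
  obtain ⟨hn₁, -, -, hn₂⟩ := le_of_guidedThreshold_le hγ hε hn
  have hsqrt : √n ^ 4 = n * n := by
    rw [show √n ^ 4 = (√n ^ 2) ^ 2 by ring, Real.sq_sqrt (by linarith), pow_two]
  calc 3 * (n + 1) ≤ 144 * n / 24 := by linarith
    _ ≤ (ε * γ / 50) ^ 4 * n * n / 24 := by gcongr
    _ = (ε * √n / 25 * (γ / 2)) ^ 4 / Nat.factorial 4 := by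
        rw [show ε * √n / 25 * (γ / 2) = ε * γ / 50 * √n by ring, mul_pow, hsqrt, mul_assoc]
        norm_num [Nat.factorial]
    _ ≤ Real.exp (ε * √n / 25 * (γ / 2)) := Real.pow_div_factorial_le_exp _ (by positivity) 4

variable {V : Type*} [DecidableEq V] {E E' : Finset (Finset V)} {W V₀ : Finset V}

/-- Edges of `E'` are removed while the densities of all links and of the pairs outside `W` are
preserved; the latter keeps `W` small in the remainder. -/
theorem IsRobustOn.exists_matchable_sdiff (h : IsRobustOn E W γ V₀) (hγ : 0 < γ) (hε : 0 < ε)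
    (hE' : ∀ e ∈ E', e.card = 3) (hn : guidedThreshold γ ε ≤ V₀.card)
    (hW : ∀ S ⊆ V₀, Matchable E' (V₀ \ S) →
      density (fun a b => a ∉ W ∧ b ∉ W) V₀ - γ / 2 ≤ density (fun a b => a ∉ W ∧ b ∉ W) S →
      S.Nonempty → 3 * (W ∩ S).card ≤ S.card ∧
        ∀ x, IsDecomposition (edgeTriples E S) x → IsDecomposition (edgeTriples E' S) x) :
    ∃ S ⊆ V₀, Matchable E' (V₀ \ S) ∧ (S.card : ℝ) < ε * V₀.card := by
  set n : ℝ := (V₀.card : ℝ) with hn_def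
  obtain ⟨hn₁, hn₂, hn₃, -⟩ := le_of_guidedThreshold_le hγ hε hn
  have hsq : √n ^ 2 = n := Real.sq_sqrt (by linarith)
  have hsqrt : 1 ≤ √n := Real.one_le_sqrt.2 hn₁
  have hlam : 1 ≤ ε * √n / 25 := by
    rw [le_div_iff₀ (by norm_num), one_mul]
    refine le_of_sq_le_sq ?_ (by positivity)
    rw [mul_pow, hsq]
    linarith
  refine exists_matchable_sdiff_card_lt (J := Option V₀) hE'
    (P := fun j => j.elim (fun a b => a ∉ W ∧ b ∉ W) fun v => link E v)
    (lam := ε * √n / 25) (ξ := γ / 2) hn₂ hlam ?_ ?_ ?_ fun S hS hM hL hdens => ?_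
  · nlinarith [mul_pos hε (by linarith : 0 < √n)]
  · rw [← hn_def, div_mul_eq_mul_div, div_le_one (by positivity), div_pow,
      mul_pow, hsq]
    nlinarith [show 0 ≤ ε ^ 2 * n ^ 2 by positivity]
  · rw [Fintype.card_option, Fintype.card_coe, Nat.cast_add, Nat.cast_one, ← hn_def]
    exact three_mul_add_one_le_exp hγ hε hn
  · have hSne : S.Nonempty := by
      rw [Finset.nonempty_iff_ne_empty]
      rintro rfl
      norm_num at hL
      linarith
    obtain ⟨hWS, hE'S⟩ := hW S hS hM (hdens none) hSne
    have hrob := h.of_density_le hSne hS fun v hv => hdens (some ⟨v, hS hv⟩)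
    obtain ⟨x, hx⟩ := hrob.exists_isDecomposition (by linarith) hSne hWS
    exact ⟨x, hE'S x hx⟩

end AlmostMatching

/-! ### Absorbers and the degree conditions -/

section Absorber

variable {V : Type*} [DecidableEq V] {E : Finset (Finset V)} {S T W : Finset V}

lemma Matchable.three_dvd_card (hE : ∀ e ∈ E, e.card = 3) (h : Matchable E S) : 3 ∣ S.card := by
  obtain ⟨M, hM, hdisj, rfl⟩ := h
  rw [Finset.card_biUnion fun e he f hf hne => hdisj he hf hne]
  exact Finset.dvd_sum fun e he => by rw [id, hE e (hM he)]

lemma Matchable.three_mul_card_inter (hE : ∀ e ∈ E, e.card = 3 ∧ (W ∩ e).card = 1)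
    (h : Matchable E S) : 3 * (W ∩ S).card = S.card := by
  obtain ⟨M, hM, hdisj, rfl⟩ := h
  rw [Finset.inter_biUnion, Finset.card_biUnion fun e he f hf hne => hdisj he hf hne,
    Finset.card_biUnion fun e he f hf hne => (hdisj he hf hne).mono Finset.inter_subset_right
      Finset.inter_subset_right, Finset.mul_sum]
  exact Finset.sum_congr rfl fun e he => by rw [id, (hE e (hM he)).1, (hE e (hM he)).2, mul_one]

lemma Matchable.subset_of_forall (hE : ∀ e ∈ E, e ⊆ T) (h : Matchable E S) : S ⊆ T := by
  obtain ⟨M, hM, -, rfl⟩ := h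
  exact Finset.biUnion_subset.2 fun e he => hE e (hM he)

lemma exists_transversal_triples (R : Fin 3 → Finset V) {k : ℕ} (hk : ∀ i, (R i).card = k)
    (hd : Pairwise (Function.onFun Disjoint R)) :
    ∃ 𝒰 : Finset (Fin 3 → V), 𝒰.card ≤ k ∧ (∀ u ∈ 𝒰, Function.Injective u ∧ ∀ i, u i ∈ R i) ∧
      (𝒰 : Set (Fin 3 → V)).PairwiseDisjoint (fun u => Finset.univ.image u) ∧
      𝒰.biUnion (fun u => Finset.univ.image u) = Finset.univ.biUnion R := by
  let e (i : Fin 3) : R i ≃ Fin k := (R i).equivFinOfCardEq (hk i)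
  let u (c : Fin k) (i : Fin 3) : V := (e i).symm c
  have hu (c : Fin k) (i : Fin 3) : u c i ∈ R i := ((e i).symm c).2
  have hsep {c c' : Fin k} {i j : Fin 3} (h : u c i = u c' j) : i = j ∧ c = c' := by
    obtain rfl : i = j := by
      by_contra hne
      exact Finset.disjoint_left.1 (hd hne) (hu c i) (h ▸ hu c' j)
    exact ⟨rfl, (e i).symm.injective (Subtype.ext h)⟩
  refine ⟨Finset.univ.image u, Finset.card_image_le.trans (by simp), ?_, ?_, ?_⟩
  · simp only [Finset.mem_image, Finset.mem_univ, true_and, forall_exists_index,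
      forall_apply_eq_imp_iff]
    exact fun c => ⟨fun i j h => (hsep h).1, hu c⟩
  · rw [Finset.coe_image, Finset.coe_univ, Set.image_univ]
    rintro _ ⟨c, rfl⟩ _ ⟨c', rfl⟩ hne
    rw [Function.onFun, Finset.disjoint_left]
    simp only [Finset.mem_image, Finset.mem_univ, true_and, forall_exists_index,
      forall_apply_eq_imp_iff, not_exists]
    exact fun i j h => hne (congrArg u (hsep h).2.symm)
  · ext v
    simp only [Finset.mem_biUnion, Finset.mem_image, Finset.mem_univ, true_and]
    constructor
    · rintro ⟨_, ⟨c, rfl⟩, i, rfl⟩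
      exact ⟨i, hu c i⟩
    · rintro ⟨i, hi⟩
      exact ⟨u (e i ⟨v, hi⟩), ⟨_, rfl⟩, i, by simp [u]⟩

/-- The set `A` absorbs any `s ≤ k` vertices of `P₀` together with any `2 * s` vertices of `P₁`:
these vertices and `A` are jointly covered by disjoint edges. -/
def IsAbsorber (E : Finset (Finset V)) (P₀ P₁ : Finset V) (k : ℝ) (A : Finset V) : Prop :=
  ∀ S₀ ⊆ P₀, ∀ S₁ ⊆ P₁, S₁.card = 2 * S₀.card → (S₀.card : ℝ) ≤ k → Disjoint S₀ S₁ →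
    Disjoint A (S₀ ∪ S₁) → Matchable E (A ∪ (S₀ ∪ S₁))

lemma IsAbsorber.mono {P₀ P₁ A : Finset V} {k k' : ℝ} (h : IsAbsorber E P₀ P₁ k A) (hk : k' ≤ k) :
    IsAbsorber E P₀ P₁ k' A :=
  fun S₀ hS₀ S₁ hS₁ hcard hle => h S₀ hS₀ S₁ hS₁ hcard (hle.trans hk)

variable [Fintype V] {P₀ P₁ : Finset V} {η c : ℝ}

lemma card_mul_le_card_partiteEdges (h : ∀ x ∈ P₀, c ≤ pairCount (link E x) P₁) :
    P₀.card * c ≤ (partiteEdges E ![P₀, P₁, P₁]).card := by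
  have hinj : (P₀.sigma fun x => (P₁ ×ˢ P₁).filter fun p => {x, p.1, p.2} ∈ E).card ≤
      (partiteEdges E ![P₀, P₁, P₁]).card := by
    refine Finset.card_le_card_of_injOn (fun s => ![s.1, s.2.1, s.2.2]) ?_ ?_
    · rintro ⟨x, a, b⟩ hs
      simp only [Finset.coe_sigma, Set.mem_sigma_iff, Finset.mem_coe, Finset.mem_filter,
        Finset.mem_product] at hs
      simpa [partiteEdges, image_univ_fin_three, Fin.forall_fin_succ, and_assoc] using hs
    · rintro ⟨x, a, b⟩ - ⟨x', a', b'⟩ - heq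
      obtain rfl : x = x' := congrFun heq 0
      obtain rfl : a = a' := congrFun heq 1
      obtain rfl : b = b' := congrFun heq 2
      rfl
  calc (P₀.card : ℝ) * c = P₀.card • c := (nsmul_eq_mul _ _).symm
    _ ≤ ∑ x ∈ P₀, (pairCount (link E x) P₁ : ℝ) := Finset.card_nsmul_le_sum _ _ _ h
    _ ≤ (partiteEdges E ![P₀, P₁, P₁]).card := by
        rw [Finset.card_sigma] at hinj
        simp only [pairCount_link]
        exact_mod_cast hinj

lemma pairCount_add_pairCount_le_card_commonLink {x y : V} (Ω : Finset (V × V))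
    (hx : ∀ a b, link E x a b → (a, b) ∈ Ω) (hy : ∀ a b, link E y a b → (a, b) ∈ Ω) :
    pairCount (link E x) Finset.univ + pairCount (link E y) Finset.univ ≤
      Ω.card + (commonLink E x y).card := by
  rw [pairCount_link, pairCount_link, Finset.univ_product_univ, commonLink,
    ← Finset.card_union_add_card_inter, ← Finset.filter_and]
  refine Nat.add_le_add_right (Finset.card_le_card (Finset.union_subset ?_ ?_)) _
  · exact fun p hp => hx _ _ (Finset.mem_filter.1 hp).2
  · exact fun p hp => hy _ _ (Finset.mem_filter.1 hp).2

lemma exists_isAbsorber (hη : 0 < η) (hP₀ : η * (Fintype.card V : ℝ) ^ 3 ≤ P₀.card * c)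
    (hc : ∀ x ∈ P₀, c ≤ pairCount (link E x) P₁)
    (hlink₀ : ∀ x ∈ P₀, ∀ y ∈ P₀, η * (Fintype.card V : ℝ) ^ 2 ≤ (commonLink E x y).card)
    (hlink₁ : ∀ x ∈ P₁, ∀ y ∈ P₁, η * (Fintype.card V : ℝ) ^ 2 ≤ (commonLink E x y).card)
    (hn : 162 ≤ η ^ 4 * Fintype.card V) (m : ℕ) (hm : 324 * m ≤ η ^ 4 * Fintype.card V) :
    ∃ A, Matchable E A ∧ A.card ≤ 9 * m ∧
      IsAbsorber E P₀ P₁ (η ^ 4 * m / 8 - 3 * Real.log (Fintype.card V)) A := by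
  obtain ⟨A, hA, hAcard, habs⟩ := exists_absorber (P := ![P₀, P₁, P₁]) hη
    (hP₀.trans (card_mul_le_card_partiteEdges hc))
    (by simpa [Fin.forall_fin_succ] using ⟨hlink₀, hlink₁⟩) hn m hm
  refine ⟨A, hA, hAcard, fun S₀ hS₀ S₁ hS₁ hcard hle hdisj hdisjA => ?_⟩
  obtain ⟨R, hR, hRcard⟩ := Finset.exists_subset_card_eq (s := S₁) (n := S₀.card) (by omega)
  have hR' : (S₁ \ R).card = S₀.card := by
    rw [Finset.card_sdiff_of_subset hR]
    omega
  have hsplit : Finset.univ.biUnion ![S₀, R, S₁ \ R] = S₀ ∪ S₁ := by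
    ext v
    simpa [Fin.exists_fin_succ] using by grind
  obtain ⟨𝒰, h𝒰card, h𝒰, h𝒰disj, h𝒰union⟩ := exists_transversal_triples ![S₀, R, S₁ \ R]
    (k := S₀.card) (by simp [Fin.forall_fin_succ, hRcard, hR']) (by
      have h₁ := hdisj.mono_right hR
      have h₂ := hdisj.mono_right (Finset.sdiff_subset (s := S₁) (t := R))
      have h₃ : Disjoint R (S₁ \ R) := Finset.disjoint_sdiff
      simp [Pairwise, Function.onFun, Fin.forall_fin_succ, h₁, h₂, h₃, h₁.symm, h₂.symm, h₃.symm])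
  rw [← hsplit, ← h𝒰union]
  refine habs 𝒰 (le_trans (by exact_mod_cast h𝒰card) hle)
    (fun u hu => ⟨(h𝒰 u hu).1, fun i => ⟨?_, fun huA => ?_⟩⟩) h𝒰disj
  · have hmem := (h𝒰 u hu).2 i
    fin_cases i
    exacts [hS₀ hmem, hS₁ (hR hmem), hS₁ (Finset.sdiff_subset hmem)]
  · refine Finset.disjoint_left.1 hdisjA huA ?_
    rw [← hsplit]
    exact Finset.mem_biUnion.2 ⟨i, Finset.mem_univ i, (h𝒰 u hu).2 i⟩

end Absorber

section DegreeCond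

variable {V : Type*} [DecidableEq V]

lemma exists_eq_of_mem_of_mem_of_card_eq_three {e : Finset V} {u v : V} (he : e.card = 3)
    (hu : u ∈ e) (hv : v ∈ e) (huv : u ≠ v) : ∃ w, e = {u, v, w} := by
  have hv' : v ∈ e.erase u := Finset.mem_erase.2 ⟨huv.symm, hv⟩
  obtain ⟨w, hw⟩ := Finset.card_eq_one.1 (show ((e.erase u).erase v).card = 1 by
    rw [Finset.card_erase_of_mem hv', Finset.card_erase_of_mem hu, he])
  exact ⟨w, by rw [← hw, Finset.insert_erase hv', Finset.insert_erase hu]⟩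

lemma exists_matchable_union_pairs {E : Finset (Finset V)} {T : Finset (V × V)} {R : Finset V}
    (hT : (T : Set (V × V)).PairwiseDisjoint (fun p => ({p.1, p.2} : Finset V)))
    (hR : ∀ p ∈ T, p.1 ∉ R ∧ p.2 ∉ R)
    (h : ∀ w ∈ R, R.card ≤ (T.filter fun p => {w, p.1, p.2} ∈ E).card) :
    ∃ Q ⊆ T.biUnion (fun p => {p.1, p.2}), Matchable E (R ∪ Q) := by
  have hcard (w : R) : Fintype.card R ≤ (T.filter fun p => {(w : V), p.1, p.2} ∈ E).card := by
    rw [Fintype.card_coe]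
    exact h w w.2
  obtain ⟨g, hg, hgF⟩ := exists_injective_mem_of_card_le _ hcard
  have hgT (w : R) : g w ∈ T := (Finset.mem_filter.1 (hgF w)).1
  have hunion : R ∪ (Finset.univ.biUnion fun w : R => {(g w).1, (g w).2}) =
      Finset.univ.biUnion fun w : R => {(w : V), (g w).1, (g w).2} := by
    ext v
    simp only [Finset.mem_union, Finset.mem_biUnion, Finset.mem_univ, true_and,
      Finset.mem_insert, Finset.mem_singleton, Subtype.exists]
    constructor
    · rintro (hv | ⟨w, hw, hv⟩)
      exacts [⟨v, hv, .inl rfl⟩, ⟨w, hw, .inr hv⟩]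
    · rintro ⟨w, hw, rfl | hv⟩
      exacts [.inl hw, .inr ⟨w, hw, hv⟩]
  refine ⟨Finset.univ.biUnion fun w : R => {(g w).1, (g w).2}, ?_, ?_⟩
  · exact Finset.biUnion_subset.2 fun w _ =>
      Finset.subset_biUnion_of_mem (fun p : V × V => ({p.1, p.2} : Finset V)) (hgT w)
  · rw [hunion]
    refine Matchable.biUnion _ _
      (fun w _ => matchable_of_mem (Finset.mem_filter.1 (hgF w)).2) fun w _ w' _ hne => ?_
    have hpair := hT (hgT w) (hgT w') (hg.ne hne)
    have hval : (w : V) ≠ w' := fun heq => hne (Subtype.ext heq)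
    obtain ⟨h₁, h₂⟩ := hR _ (hgT w)
    obtain ⟨h₁', h₂'⟩ := hR _ (hgT w')
    simp only [Function.onFun, Finset.disjoint_insert_left, Finset.disjoint_singleton_left,
      Finset.mem_insert, Finset.mem_singleton, not_or] at hpair ⊢
    exact ⟨⟨hval, fun heq => h₁' (heq ▸ w.2), fun heq => h₂' (heq ▸ w.2)⟩,
      ⟨fun heq => h₁ (heq ▸ w'.2), hpair.1⟩, fun heq => h₂ (heq ▸ w'.2), hpair.2⟩

lemma card_filter_mem_pair_le [Fintype V] (A : Finset (V × V)) (v : V) :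
    (A.filter fun p => v ∈ ({p.1, p.2} : Finset V)).card ≤ 2 * Fintype.card V := by
  have hsub : (A.filter fun p => v ∈ ({p.1, p.2} : Finset V)) ⊆
      ({v} ×ˢ Finset.univ) ∪ (Finset.univ ×ˢ {v}) := by
    intro p hp
    simpa only [Finset.mem_union, Finset.mem_product, Finset.mem_univ, and_true, true_and,
      Finset.mem_insert, Finset.mem_singleton, eq_comm] using (Finset.mem_filter.1 hp).2
  refine ((Finset.card_le_card hsub).trans (Finset.card_union_le _ _)).trans_eq ?_
  rw [Finset.card_product, Finset.card_product, Finset.card_singleton, Finset.card_univ, one_mul,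
    mul_one, two_mul]

variable [Fintype V]

/-- The `3`-graph with edge set `E` has no isolated vertex, the degrees of adjacent vertices have a
large sum, and `W` is the set of the vertices of small degree. Degrees are counted by ordered pairs,
which doubles them. -/
structure OreCond (E : Finset (Finset V)) (γ : ℝ) (W : Finset V) : Prop where
  uniform : ∀ e ∈ E, e.card = 3
  adj : ∀ u v w, link E u v w → (6 / 5 + γ) * (Fintype.card V : ℝ) ^ 2 ≤
    pairCount (link E u) Finset.univ + pairCount (link E v) Finset.univ
  exists_link : ∀ v, ∃ a b, link E v a b
  mem_iff : ∀ v, v ∈ W ↔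
    (pairCount (link E v) Finset.univ : ℝ) < (3 / 5 + γ / 2) * (Fintype.card V : ℝ) ^ 2

/-- The degree conditions on a `3`-graph, together with the bound on the number of vertices of small
degree that is forced when the `3`-graph is not a subgraph of the extremal one. -/
structure DegreeCond (E : Finset (Finset V)) (γ : ℝ) (W : Finset V) : Prop
    extends OreCond E γ W where
  card_le : 3 * W.card ≤ Fintype.card V

variable {E : Finset (Finset V)} {γ : ℝ} {W : Finset V}

namespace OreCond

lemma notMem_of_mem (h : OreCond E γ W) {u v w : V} (hl : link E u v w) (hu : u ∈ W) :
    v ∉ W := by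
  intro hv
  linarith [h.adj _ _ _ hl, (h.mem_iff u).1 hu, (h.mem_iff v).1 hv]

lemma notMem_and_notMem_of_mem (h : OreCond E γ W) {w a b : V} (hl : link E w a b)
    (hw : w ∈ W) : a ∉ W ∧ b ∉ W :=
  ⟨h.notMem_of_mem hl hw, h.notMem_of_mem hl.swap_right hw⟩

lemma card_inter_le_one (h : OreCond E γ W) {e : Finset V} (he : e ∈ E) :
    (W ∩ e).card ≤ 1 := by
  rw [Finset.card_le_one]
  intro u hu v hv
  by_contra hne
  obtain ⟨huW, hue⟩ := Finset.mem_inter.1 hu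
  obtain ⟨hvW, hve⟩ := Finset.mem_inter.1 hv
  obtain ⟨w, rfl⟩ := exists_eq_of_mem_of_mem_of_card_eq_three (h.uniform e he) hue hve hne
  exact h.notMem_of_mem he huW hvW

end OreCond

namespace DegreeCond

lemma three_mul_card_le (h : DegreeCond E γ W) : 3 * (W.card : ℝ) ≤ Fintype.card V := by
  exact_mod_cast h.card_le

lemma le_degree (h : DegreeCond E γ W) (v : V) :
    (1 / 5 + γ) * (Fintype.card V : ℝ) ^ 2 ≤ pairCount (link E v) Finset.univ := by
  obtain ⟨a, b, hab⟩ := h.exists_link v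
  have hle : (pairCount (link E a) Finset.univ : ℝ) ≤ (Fintype.card V : ℝ) ^ 2 := by
    exact_mod_cast pairCount_le_sq (link E a) Finset.univ
  linarith [h.adj _ _ _ hab]

lemma le_degree_of_notMem (h : DegreeCond E γ W) {v : V} (hv : v ∉ W) :
    (3 / 5 + γ / 2) * (Fintype.card V : ℝ) ^ 2 ≤ pairCount (link E v) Finset.univ :=
  not_lt.1 (mt (h.mem_iff v).2 hv)

lemma le_pairCount_compl_of_notMem (h : DegreeCond E γ W) (hγ : 0 < γ) {v : V} (hv : v ∉ W) :
    1 / 25 * (Fintype.card V : ℝ) ^ 2 ≤ pairCount (link E v) Wᶜ := by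
  have hsq : (2 / 3 * (Fintype.card V : ℝ)) ^ 2 ≤ ((Fintype.card V : ℝ) - W.card) ^ 2 :=
    pow_le_pow_left₀ (by positivity) (by linarith [h.three_mul_card_le]) 2
  have : 0 ≤ γ * (Fintype.card V : ℝ) ^ 2 := by positivity
  nlinarith [pairCount_univ_le (link E v) W, h.le_degree_of_notMem hv]

lemma le_card_filter_pair (h : DegreeCond E γ W) (hγ : 0 < γ) {w : V} (hw : w ∈ W) :
    (Fintype.card V : ℝ) ^ 2 / 5 ≤ ((Finset.univ.filter fun p : V × V =>
      p.1 ≠ p.2 ∧ p.1 ∉ W ∧ p.2 ∉ W).filter fun p => {w, p.1, p.2} ∈ E).card := by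
  have : 0 ≤ γ * (Fintype.card V : ℝ) ^ 2 := by positivity
  have hdeg := h.le_degree w
  rw [pairCount_link] at hdeg
  refine le_trans (by linarith) (hdeg.trans (Nat.cast_le.2 (Finset.card_le_card fun p hp => ?_)))
  have hlink := (Finset.mem_filter.1 hp).2
  refine Finset.mem_filter.2 ⟨Finset.mem_filter.2 ⟨Finset.mem_univ _, fun heq => ?_,
    h.notMem_and_notMem_of_mem hlink hw⟩, hlink⟩
  have hcard := h.uniform _ hlink
  rw [heq, Finset.pair_eq_singleton] at hcard
  have := Finset.card_le_two (a := w) (b := p.2)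
  omega

lemma exists_reserved_pairs (h : DegreeCond E γ W) (hγ : 0 < γ) (hn : 0 < Fintype.card V)
    (Z : Finset V) (m : ℕ) (hm : 20 * ((Z.card : ℝ) + 2 * m) ≤ Fintype.card V) :
    ∃ T : Finset (V × V), T.card ≤ m ∧
      (T : Set (V × V)).PairwiseDisjoint (fun p => ({p.1, p.2} : Finset V)) ∧
      (∀ p ∈ T, p.1 ≠ p.2 ∧ p.1 ∉ W ∧ p.2 ∉ W ∧ p.1 ∉ Z ∧ p.2 ∉ Z) ∧
      ∀ w ∈ W, (m : ℝ) / 20 - Real.log (Fintype.card V) ≤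
        (T.filter fun p => {w, p.1, p.2} ∈ E).card := by
  rcases W.eq_empty_or_nonempty with rfl | hWne
  · exact ⟨∅, by simp, by simp, by simp, by simp⟩
  have : Nonempty W := hWne.to_subtype
  set n := (Fintype.card V : ℝ) with hn_def
  have hn₀ : 0 < n := by
    rw [hn_def]
    exact_mod_cast hn
  set A : Finset (V × V) := Finset.univ.filter fun p => p.1 ≠ p.2 ∧ p.1 ∉ W ∧ p.2 ∉ W
  have hAcard : (A.card : ℝ) ≤ n ^ 2 := by
    have hle := Finset.card_le_univ A
    rw [Fintype.card_prod, ← pow_two] at hle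
    rw [hn_def]
    exact_mod_cast hle
  obtain ⟨T, hTA, hTcard, hTdisj, hTZ, hT⟩ := exists_disjoint_selection (I := W) (A := A)
    (supp := fun p => {p.1, p.2}) (k := 2) (B := 2 * n) (τ := n ^ 2 / 10)
    (F := fun w => A.filter fun p => {(w : V), p.1, p.2} ∈ E) (fun p _ => Finset.card_le_two)
    (fun p _ => by simp) hAcard (by positivity) (by positivity)
    (fun v => by rw [hn_def]; exact_mod_cast card_filter_mem_pair_le A v)
    (fun w => Finset.filter_subset _ _)
    (fun w => by linarith [h.le_card_filter_pair hγ w.2]) Z m (by push_cast; nlinarith)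
  refine ⟨T, hTcard.le, hTdisj, fun p hp => ?_, fun w hw => ?_⟩
  · have hmem := (Finset.mem_filter.1 (hTA hp)).2
    have hdisj := Finset.disjoint_left.1 (hTZ p hp)
    exact ⟨hmem.1, hmem.2.1, hmem.2.2, hdisj (by simp), hdisj (by simp)⟩
  · have hselect := hT ⟨w, hw⟩
    have hlog : Real.log W.card ≤ Real.log n :=
      Real.log_le_log (by exact_mod_cast hWne.card_pos) (by
        rw [hn_def]
        exact_mod_cast Finset.card_le_univ W)
    have hsub : T ∩ A.filter (fun p => {w, p.1, p.2} ∈ E) ⊆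
        T.filter fun p => {w, p.1, p.2} ∈ E := fun p hp =>
      Finset.mem_filter.2 ⟨Finset.mem_of_mem_inter_left hp,
        (Finset.mem_filter.1 (Finset.mem_of_mem_inter_right hp)).2⟩
    have hcard : ((T ∩ A.filter fun p => {w, p.1, p.2} ∈ E).card : ℝ) ≤
        (T.filter fun p => {w, p.1, p.2} ∈ E).card := Nat.cast_le.2 (Finset.card_le_card hsub)
    rw [show n ^ 2 / 10 / n ^ 2 * m / 2 = m / 20 by field_simp; ring, Fintype.card_coe] at hselect
    linarith

lemma exists_reserve (h : DegreeCond E γ W) (hγ : 0 < γ) (hn : 0 < Fintype.card V)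
    (Z : Finset V) (m : ℕ) (hm : 20 * ((Z.card : ℝ) + 2 * m) ≤ Fintype.card V) :
    ∃ Q : Finset V, Q.card ≤ 2 * m ∧ Disjoint Q W ∧ Disjoint Q Z ∧
      ∀ R ⊆ W, (R.card : ℝ) ≤ m / 20 - Real.log (Fintype.card V) →
        ∃ Q' ⊆ Q, Matchable E (R ∪ Q') := by
  obtain ⟨T, hTcard, hTdisj, hTmem, hTlink⟩ := h.exists_reserved_pairs hγ hn Z m hm
  have hmem : ∀ v ∈ T.biUnion fun p => {p.1, p.2}, v ∉ W ∧ v ∉ Z := by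
    simp only [Finset.mem_biUnion, Finset.mem_insert, Finset.mem_singleton]
    rintro v ⟨p, hp, rfl | rfl⟩ <;> grind
  refine ⟨T.biUnion fun p => {p.1, p.2}, ?_, Finset.disjoint_left.2 fun v hv => (hmem v hv).1,
    Finset.disjoint_left.2 fun v hv => (hmem v hv).2, fun R hR hRcard => ?_⟩
  · have hle := Finset.card_biUnion_le_card_mul T (fun p => ({p.1, p.2} : Finset V)) 2
      fun p _ => Finset.card_le_two
    omega
  · refine exists_matchable_union_pairs hTdisj (fun p hp => ?_) fun w hw => ?_
    · exact ⟨fun hpR => (hTmem p hp).2.1 (hR hpR), fun hpR => (hTmem p hp).2.2.1 (hR hpR)⟩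
    · exact Nat.cast_le.1 (hRcard.trans (hTlink w (hR hw)))

end DegreeCond

end DegreeCond

/-! ### Fewer light vertices than a third -/

section LightCase

variable {V : Type*} [DecidableEq V] {W S : Finset V}

lemma sq_le_density_notMem {c : ℝ} (hc : 0 ≤ c) (hS : S.Nonempty)
    (h : c * (S.card : ℝ) ≤ (S \ W).card) : c ^ 2 ≤ density (fun a b => a ∉ W ∧ b ∉ W) S := by
  have : (0 : ℝ) < S.card := by exact_mod_cast hS.card_pos
  rw [density, pairCount_notMem, le_div_iff₀ (by positivity), ← mul_pow, Nat.cast_pow]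
  exact pow_le_pow_left₀ (by positivity) h 2

lemma three_mul_card_inter_le (hS : S.Nonempty)
    (h : 4 / 9 ≤ density (fun a b => a ∉ W ∧ b ∉ W) S) : 3 * (W ∩ S).card ≤ S.card := by
  have : (0 : ℝ) < S.card := by exact_mod_cast hS.card_pos
  rw [density, pairCount_notMem, le_div_iff₀ (by positivity), Nat.cast_pow,
    show (4 / 9 : ℝ) = (2 / 3) ^ 2 by norm_num, ← mul_pow,
    sq_le_sq₀ (by positivity) (by positivity)] at h
  have hsum : (((S \ W).card + (W ∩ S).card : ℕ) : ℝ) = S.card := by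
    rw [Finset.inter_comm, Finset.card_sdiff_add_card_inter]
  rw [Nat.cast_add] at hsum
  have hle : (3 * (W ∩ S).card : ℝ) ≤ S.card := by linarith
  exact_mod_cast hle

variable [Fintype V] {E E' : Finset (Finset V)} {γ γ₀ ε k : ℝ} {A P Q Q' Z : Finset V}

lemma DegreeCond.isRobustOn_compl (h : DegreeCond E γ W) (hγ₀ : 0 < γ₀) (hγ₀' : γ₀ ≤ γ / 4)
    (hZ : (Z.card : ℝ) ≤ γ / 20 * Fintype.card V) : IsRobustOn E W γ₀ Zᶜ := by
  set n := (Fintype.card V : ℝ) with hn_def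
  have hsq : ((Zᶜ).card : ℝ) ^ 2 ≤ n ^ 2 := by
    rw [hn_def]
    exact_mod_cast Nat.pow_le_pow_left (Finset.card_le_univ Zᶜ) 2
  have hscale {c : ℝ} (hc : 0 ≤ c) : c * ((Zᶜ).card : ℝ) ^ 2 ≤ c * n ^ 2 :=
    mul_le_mul_of_nonneg_left hsq hc
  have hγn : γ₀ * n ^ 2 ≤ γ / 4 * n ^ 2 := mul_le_mul_of_nonneg_right hγ₀' (sq_nonneg n)
  have hdeg (v : V) :
      (pairCount (link E v) Finset.univ : ℝ) - γ / 10 * n ^ 2 ≤ pairCount (link E v) Zᶜ := by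
    have hZn : 2 * (Z.card : ℝ) * n ≤ 2 * (γ / 20 * n) * n := by gcongr
    linarith [pairCount_univ_le_add (link E v) Z]
  have : 0 < γ := by linarith
  have hγn₀ : 0 ≤ γ * n ^ 2 := by positivity
  refine ⟨fun u _ v _ w _ hl => ?_, fun v _ => ?_, fun v _ hv => ?_⟩
  · linarith [h.adj u v w hl, hdeg u, hdeg v, hscale (c := 6 / 5 + 2 * γ₀) (by linarith)]
  · linarith [h.le_degree v, hdeg v, hscale (c := γ₀) (by linarith), sq_nonneg n]
  · linarith [h.le_degree_of_notMem hv, hdeg v, hscale (c := 3 / 5 + γ₀) (by linarith)]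

lemma DegreeCond.exists_matchable_compl_sdiff (h : DegreeCond E γ W) (hγ₁ : γ ≤ 1 / 100)
    (hγ₀ : 0 < γ₀) (hγ₀' : γ₀ ≤ γ / 4) (hε : 0 < ε)
    (hE' : ∀ e ∈ E', e.card = 3) (hZ : (Z.card : ℝ) ≤ γ / 20 * Fintype.card V)
    (hn : 2 * guidedThreshold γ₀ ε ≤ Fintype.card V)
    (hW : ∀ S ⊆ Zᶜ, Matchable E' (Zᶜ \ S) →
      density (fun a b => a ∉ W ∧ b ∉ W) Zᶜ - γ₀ / 2 ≤ density (fun a b => a ∉ W ∧ b ∉ W) S →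
      S.Nonempty → 3 * (W ∩ S).card ≤ S.card ∧
        ∀ x, IsDecomposition (edgeTriples E S) x → IsDecomposition (edgeTriples E' S) x) :
    ∃ S ⊆ Zᶜ, Matchable E' (Zᶜ \ S) ∧ (S.card : ℝ) ≤ ε * Fintype.card V := by
  have hcompl := cast_card_compl Z
  obtain ⟨S, hS, hM, hcard⟩ := (h.isRobustOn_compl hγ₀ hγ₀' hZ).exists_matchable_sdiff hγ₀ hε hE'
    (by rw [hcompl]; nlinarith [(Nat.cast_nonneg _ : (0 : ℝ) ≤ Fintype.card V)]) hW
  refine ⟨S, hS, hM, hcard.le.trans (mul_le_mul_of_nonneg_left ?_ hε.le)⟩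
  exact_mod_cast Finset.card_le_univ Zᶜ

lemma le_density_notMem_compl (hγ : 0 < γ) (hγ₁ : γ ≤ 1 / 100) (hV : 0 < Fintype.card V)
    (hW : (W.card : ℝ) ≤ (1 / 3 - γ / 100) * Fintype.card V)
    (hZ : (Z.card : ℝ) ≤ γ / 200 * Fintype.card V) :
    4 / 9 + γ / 400 ≤ density (fun a b => a ∉ W ∧ b ∉ W) Zᶜ := by
  have hV' : (0 : ℝ) < Fintype.card V := by exact_mod_cast hV
  have hcompl := cast_card_compl Z
  have hpos : (0 : ℝ) < (Zᶜ).card := by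
    rw [hcompl]
    linarith [mul_le_mul_of_nonneg_right hγ₁ hV'.le]
  have hsdiff : ((Zᶜ).card : ℝ) ≤ (Zᶜ \ W).card + W.card := by
    exact_mod_cast Finset.card_le_card_sdiff_add_card
  refine le_trans (by nlinarith) (sq_le_density_notMem (c := 2 / 3 + γ / 200) (by positivity)
    (Finset.card_pos.1 (by exact_mod_cast hpos)) ?_)
  rw [hcompl] at hsdiff ⊢
  have : 0 ≤ γ * (Z.card : ℝ) := by positivity
  linarith

lemma DegreeCond.exists_isAbsorber_compl (h : DegreeCond E γ W) (hγ : 0 < γ)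
    (hn : 162 * 10 ^ 8 ≤ (Fintype.card V : ℝ)) (m : ℕ)
    (hm : 324 * 10 ^ 8 * (m : ℝ) ≤ Fintype.card V) :
    ∃ A, Matchable E A ∧ A.card ≤ 9 * m ∧
      IsAbsorber E Wᶜ Wᶜ (m / (8 * 10 ^ 8) - 3 * Real.log (Fintype.card V)) A := by
  set n := (Fintype.card V : ℝ) with hn_def
  have hlink : ∀ x ∈ Wᶜ, ∀ y ∈ Wᶜ, 1 / 100 * n ^ 2 ≤ (commonLink E x y).card := by
    intro x hx y hy
    have hcommon := pairCount_add_pairCount_le_card_commonLink (E := E) (x := x) (y := y)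
      Finset.univ (fun _ _ _ => Finset.mem_univ _) (fun _ _ _ => Finset.mem_univ _)
    rw [Finset.card_univ, Fintype.card_prod, ← pow_two, ← Nat.cast_le (α := ℝ)] at hcommon
    push_cast [← hn_def] at hcommon
    have : 0 ≤ γ * n ^ 2 := by positivity
    linarith [h.le_degree_of_notMem (Finset.mem_compl.1 hx),
      h.le_degree_of_notMem (Finset.mem_compl.1 hy), sq_nonneg n]
  have hcompl : 2 / 3 * n ≤ (Wᶜ).card := by
    rw [cast_card_compl]
    linarith [h.three_mul_card_le]
  obtain ⟨A, hA, hAcard, habs⟩ := exists_isAbsorber (E := E) (P₀ := Wᶜ) (P₁ := Wᶜ) (η := 1 / 100)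
    (c := 1 / 25 * n ^ 2) (by norm_num) (by
      have : 2 / 3 * n * (1 / 25 * n ^ 2) ≤ (Wᶜ).card * (1 / 25 * n ^ 2) := by gcongr
      have : 0 ≤ n ^ 3 := by positivity
      linarith)
    (fun x hx => h.le_pairCount_compl_of_notMem hγ (Finset.mem_compl.1 hx)) hlink hlink
    (by linarith) m (by linarith)
  exact ⟨A, hA, hAcard, habs.mono (by linarith)⟩

lemma IsAbsorber.matchable_univ (habs : IsAbsorber E Wᶜ Wᶜ k A) (hE : ∀ e ∈ E, e.card = 3)
    (hV : 3 ∣ Fintype.card V) (hA : Matchable E A) (hQW : Disjoint Q W) (hQA : Disjoint Q A)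
    (hS : S ⊆ (A ∪ Q)ᶜ) (hM : Matchable E ((A ∪ Q)ᶜ \ S)) (hQ' : Q' ⊆ Q)
    (hMQ : Matchable E ((W ∩ S) ∪ Q')) (hcard : (S.card : ℝ) + Q.card ≤ 3 * k) :
    Matchable E Finset.univ := by
  have hdisj : Disjoint ((A ∪ Q)ᶜ \ S) ((W ∩ S) ∪ Q') := by
    rw [Finset.disjoint_left] at *
    grind [Finset.mem_compl]
  obtain ⟨Y, hY⟩ : ∃ Y, Y = ((A ∪ Q)ᶜ \ S) ∪ ((W ∩ S) ∪ Q') := ⟨_, rfl⟩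
  have hMY : Matchable E Y := hY ▸ hM.union hMQ hdisj
  have hAY : Disjoint A Y := by
    rw [Finset.disjoint_left] at *
    grind [Finset.mem_compl]
  have hRsub : (A ∪ Y)ᶜ ⊆ S ∪ Q := by grind [Finset.mem_compl]
  have hRW : (A ∪ Y)ᶜ ⊆ Wᶜ := by
    rw [Finset.disjoint_left] at hQW
    intro v hv
    have := hRsub hv
    grind [Finset.mem_compl]
  obtain ⟨r, hr⟩ : 3 ∣ ((A ∪ Y)ᶜ).card := by
    rw [Finset.card_compl]
    exact Nat.dvd_sub hV ((hA.union hMY hAY).three_dvd_card hE)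
  obtain ⟨S₀, hS₀, hS₀card⟩ := Finset.exists_subset_card_eq (s := (A ∪ Y)ᶜ) (n := r) (by omega)
  have hrest : Matchable E (A ∪ (S₀ ∪ (A ∪ Y)ᶜ \ S₀)) := by
    refine habs S₀ (hS₀.trans hRW) _ (Finset.sdiff_subset.trans hRW) ?_ ?_ Finset.disjoint_sdiff ?_
    · rw [Finset.card_sdiff_of_subset hS₀]
      omega
    · have hle : ((3 * r : ℕ) : ℝ) ≤ S.card + Q.card := by
        rw [← hr]
        exact_mod_cast (Finset.card_le_card hRsub).trans (Finset.card_union_le _ _)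
      push_cast at hle
      rw [hS₀card]
      linarith
    · rw [Finset.disjoint_left]
      grind [Finset.mem_compl]
  rw [Finset.union_sdiff_of_subset hS₀] at hrest
  convert hrest.union hMY (by rw [Finset.disjoint_left] at *; grind [Finset.mem_compl]) using 1
  grind [Finset.mem_compl]

/-- A choice of the parameters in terms of `γ` and the number `n` of vertices: at most `ε n`
vertices are left over by the greedy matching, the absorbing set is made of `m₁` gadgets and
`m₂` pairs are kept in reserve for the leftover light vertices. -/
structure IsParameterChoice (γ ε n : ℝ) (m₁ m₂ : ℕ) : Prop where
  pos : 0 < ε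
  le : 162 * 10 ^ 8 ≤ n
  guidedThreshold_le : 2 * guidedThreshold (γ / 200) ε ≤ n
  mul_le : 324 * 10 ^ 8 * (m₁ : ℝ) ≤ γ * n
  reserve_le : (m₂ : ℝ) ≤ m₁
  leftover_le_reserve : ε * n ≤ m₂ / 20 - Real.log n
  leftover_add_reserve_le : ε * n + 2 * m₂ ≤ m₁ / (8 * 10 ^ 8) - 3 * Real.log n

lemma exists_isParameterChoice (hγ : 0 < γ) :
    ∃ ε, ∀ᶠ n in Filter.atTop, ∃ m₁ m₂, IsParameterChoice γ ε n m₁ m₂ := by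
  obtain ⟨μ₁, hμ₁⟩ : ∃ μ₁, μ₁ = γ / 10 ^ 11 := ⟨_, rfl⟩
  obtain ⟨μ₂, hμ₂⟩ : ∃ μ₂, μ₂ = μ₁ / 10 ^ 10 := ⟨_, rfl⟩
  have hμ₁₀ : 0 < μ₁ := by rw [hμ₁]; positivity
  have hμ₂₀ : 0 < μ₂ := by rw [hμ₂]; positivity
  refine ⟨μ₂ / 40, ?_⟩
  filter_upwards [Real.isLittleO_log_id_atTop.def (c := μ₂ / 100) (by positivity),
    Filter.eventually_ge_atTop (100 / μ₂), Filter.eventually_ge_atTop (162 * 10 ^ 8),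
    Filter.eventually_ge_atTop (2 * guidedThreshold (γ / 200) (μ₂ / 40))]
    with n hlog hinv hle hthreshold
  have hn : 0 ≤ n := by linarith
  rw [id, Real.norm_of_nonneg hn] at hlog
  replace hlog := (Real.le_norm_self _).trans hlog
  rw [div_le_iff₀' hμ₂₀] at hinv
  have hμ₁n : μ₁ * n = γ * n / 10 ^ 11 := by rw [hμ₁]; ring
  have hμ₂n : μ₂ * n = μ₁ * n / 10 ^ 10 := by rw [hμ₂]; ring
  have hm₁ := Nat.floor_le (show 0 ≤ μ₁ * n by positivity)
  have hm₂ := Nat.floor_le (show 0 ≤ μ₂ * n by positivity)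
  have hm₁' := Nat.sub_one_lt_floor (μ₁ * n)
  have hm₂' := Nat.sub_one_lt_floor (μ₂ * n)
  exact ⟨⌊μ₁ * n⌋₊, ⌊μ₂ * n⌋₊, by positivity, hle, hthreshold,
    by linarith [mul_nonneg hγ.le hn], by linarith [mul_nonneg hγ.le hn],
    by linarith, by linarith⟩

lemma DegreeCond.matchable_of_card_le {m₁ m₂ : ℕ} (h : DegreeCond E γ W) (hγ : 0 < γ)
    (hγ₁ : γ ≤ 1 / 100) (hp : IsParameterChoice γ ε (Fintype.card V) m₁ m₂)
    (hV : 3 ∣ Fintype.card V) (hW : (W.card : ℝ) ≤ (1 / 3 - γ / 100) * Fintype.card V) :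
    Matchable E Finset.univ := by
  obtain ⟨hε, hle, hthreshold, hm₁, hm₂, hreserve, habsorb⟩ := hp
  set n := (Fintype.card V : ℝ) with hn_def
  have hn : 0 < Fintype.card V := by
    rw [← Nat.cast_pos (α := ℝ), ← hn_def]
    linarith
  have hγn : γ * n ≤ 1 / 100 * n := mul_le_mul_of_nonneg_right hγ₁ (Nat.cast_nonneg _)
  obtain ⟨A, hA, hAcard, habs⟩ := h.exists_isAbsorber_compl hγ hle m₁ (by linarith)
  rw [← Nat.cast_le (α := ℝ), Nat.cast_mul, Nat.cast_ofNat] at hAcard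
  obtain ⟨Q, hQcard, hQW, hQA, hQ⟩ := h.exists_reserve hγ hn A m₂ (by linarith)
  rw [← Nat.cast_le (α := ℝ), Nat.cast_mul, Nat.cast_ofNat] at hQcard
  have hAQ : ((A ∪ Q).card : ℝ) ≤ γ / 200 * n := by
    have hunion : ((A ∪ Q).card : ℝ) ≤ A.card + Q.card := by
      exact_mod_cast Finset.card_union_le _ _
    linarith
  have hdens := le_density_notMem_compl hγ hγ₁ hn hW hAQ
  obtain ⟨S, hS, hM, hScard⟩ := h.exists_matchable_compl_sdiff hγ₁ (γ₀ := γ / 200) (E' := E)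
    (by positivity) (by linarith) hε h.uniform (Z := A ∪ Q) (by linarith) hthreshold
    fun S _ _ hd hne => ⟨three_mul_card_inter_le hne (by linarith), fun x hx => hx⟩
  have hWS : ((W ∩ S).card : ℝ) ≤ S.card := by
    exact_mod_cast Finset.card_le_card Finset.inter_subset_right
  obtain ⟨Q', hQ', hMQ⟩ := hQ (W ∩ S) Finset.inter_subset_left (by linarith)
  exact habs.matchable_univ h.uniform hV hA hQW hQA hS hM hQ' hMQ (by linarith)

end LightCase

/-! ### Almost a third of the vertices is light -/

section TightCase

lemma sq_card_sub_card_le {V : Type*} [Fintype V] {W : Finset V}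
    (hW : 333 / 1000 * (Fintype.card V : ℝ) ≤ W.card) :
    ((Fintype.card V : ℝ) - W.card) ^ 2 ≤ 89 / 200 * (Fintype.card V : ℝ) ^ 2 := by
  have hle : (W.card : ℝ) ≤ Fintype.card V := by exact_mod_cast Finset.card_le_univ W
  refine (pow_le_pow_left₀ (by linarith)
    (by linarith : _ ≤ 667 / 1000 * (Fintype.card V : ℝ)) 2).trans ?_
  rw [mul_pow]
  exact mul_le_mul_of_nonneg_right (by norm_num) (sq_nonneg _)

variable {V : Type*} [DecidableEq V] {E : Finset (Finset V)} {A W S T : Finset V}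

/-- The edges inside `T` that meet `W` in exactly one vertex. If a third of the vertices of `T` lie
in `W`, then a perfect matching of `T` by edges meeting `W` at most once uses only such edges. -/
def transversal (E : Finset (Finset V)) (W T : Finset V) : Finset (Finset V) :=
  E.filter fun e => e ⊆ T ∧ (W ∩ e).card = 1

lemma transversal_subset (E : Finset (Finset V)) (W T : Finset V) : transversal E W T ⊆ E :=
  Finset.filter_subset _ _

lemma subset_of_mem_transversal {e : Finset V} (he : e ∈ transversal E W T) : e ⊆ T :=
  (Finset.mem_filter.1 he).2.1

lemma card_inter_of_mem_transversal {e : Finset V} (he : e ∈ transversal E W T) :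
    (W ∩ e).card = 1 :=
  (Finset.mem_filter.1 he).2.2

lemma sum_ite_mem_eq_card_inter_entries {κ : Type*} [Fintype κ] {f : κ → S}
    (hf : (entries f).card = Fintype.card κ) (W : Finset V) :
    ∑ i, (if (f i : V) ∈ W then (1 : ℝ) else 0) = (W ∩ entries f).card := by
  have hinj : Set.InjOn (fun i => (f i : V)) (Finset.univ : Finset κ) :=
    Finset.card_image_iff.1 hf
  rw [Finset.inter_comm, ← Finset.filter_mem_eq_inter, Finset.card_filter, entries,
    Finset.sum_image hinj, Nat.cast_sum]
  exact Finset.sum_congr rfl fun i _ => by rw [Nat.cast_ite, Nat.cast_one, Nat.cast_zero]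

lemma IsDecomposition.sum_mul_card_inter_entries (hE : ∀ e ∈ E, e.card = 3) (hS : S.Nonempty)
    (h : 3 * (W ∩ S).card = S.card) {x : (Fin 3 → S) → ℝ}
    (hx : IsDecomposition (edgeTriples E S) x) :
    ∑ f, x f * (W ∩ entries f).card = 1 := by
  have hpos : (S.card : ℝ) ≠ 0 := Nat.cast_ne_zero.2 hS.card_ne_zero
  have hcard : (3 * (W ∩ S).card : ℝ) = S.card := by exact_mod_cast h
  have hsum : ∑ v : S, (if (v : V) ∈ W then (1 : ℝ) else 0) = (W ∩ S).card := by
    rw [Finset.sum_coe_sort S fun v => if v ∈ W then (1 : ℝ) else 0, Finset.sum_boole,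
      Finset.filter_mem_eq_inter, Finset.inter_comm]
  have hmarginal := hx.marginal fun v => if (v : V) ∈ W then 1 else 0
  rw [hsum, Fintype.card_fin, Fintype.card_coe, Nat.cast_ofNat, div_mul_eq_mul_div, hcard,
    div_self hpos] at hmarginal
  rw [← hmarginal]
  refine Finset.sum_congr rfl fun f _ => ?_
  rcases eq_or_ne (x f) 0 with hf | hf
  · rw [hf, zero_mul, zero_mul]
  · rw [sum_ite_mem_eq_card_inter_entries ((hE _ (hx.mem f hf)).trans (Fintype.card_fin 3).symm)]

lemma IsDecomposition.card_inter_entries_eq_one (hE : ∀ e ∈ E, e.card = 3)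
    (hW : ∀ e ∈ E, (W ∩ e).card ≤ 1) (hS : S.Nonempty) (h : 3 * (W ∩ S).card = S.card)
    {x : (Fin 3 → S) → ℝ} (hx : IsDecomposition (edgeTriples E S) x) {f : Fin 3 → S}
    (hf : x f ≠ 0) : (W ∩ entries f).card = 1 := by
  have hle : ∀ f ∈ Finset.univ, x f * (W ∩ entries f).card ≤ x f := by
    intro f _
    rcases eq_or_ne (x f) 0 with hf | hf
    · rw [hf, zero_mul]
    · exact mul_le_of_le_one_right (hx.nonneg f) (by exact_mod_cast hW _ (hx.mem f hf))
  have heq := (Finset.sum_eq_sum_iff_of_le hle).1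
    ((hx.sum_mul_card_inter_entries hE hS h).trans hx.sum_eq_one.symm) f (Finset.mem_univ f)
  rw [mul_eq_left₀ hf] at heq
  exact_mod_cast heq

lemma IsDecomposition.transversal (hE : ∀ e ∈ E, e.card = 3) (hW : ∀ e ∈ E, (W ∩ e).card ≤ 1)
    (hS : S.Nonempty) (hST : S ⊆ T) (h : 3 * (W ∩ S).card = S.card) {x : (Fin 3 → S) → ℝ}
    (hx : IsDecomposition (edgeTriples E S) x) :
    IsDecomposition (edgeTriples (transversal E W T) S) x :=
  ⟨hx.nonneg, fun f hf => Finset.mem_filter.2 ⟨hx.mem f hf, (entries_subset f).trans hST,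
    hx.card_inter_entries_eq_one hE hW hS h hf⟩, hx.sum_eq_one, hx.marginal⟩

lemma three_mul_card_inter_of_matchable_transversal (hE : ∀ e ∈ E, e.card = 3) (hST : S ⊆ T)
    (hT : 3 * (W ∩ T).card = T.card) (hM : Matchable (transversal E W T) (T \ S)) :
    3 * (W ∩ S).card = S.card := by
  have hM' := hM.three_mul_card_inter fun e he =>
    ⟨hE e (transversal_subset _ _ _ he), card_inter_of_mem_transversal he⟩
  have hsplit : (W ∩ (T \ S)).card + (W ∩ S).card = (W ∩ T).card := by
    rw [← Finset.card_union_of_disjoint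
      (Finset.sdiff_disjoint.mono Finset.inter_subset_right Finset.inter_subset_right),
      ← Finset.inter_union_distrib_left, Finset.sdiff_union_of_subset hST]
  have := Finset.card_sdiff_add_card_eq_card hST
  omega

lemma three_mul_card_inter_of_matchable_sdiff (hE : ∀ e ∈ E, e.card = 3) (hAT : A ⊆ T)
    (hT : 3 * (W ∩ T).card = T.card) (hA : Matchable (transversal E W T) A) (hS : S ⊆ T \ A)
    (hM : Matchable (transversal E W T) ((T \ A) \ S)) : 3 * (W ∩ S).card = S.card := by
  have hST : S ⊆ T := hS.trans Finset.sdiff_subset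
  refine three_mul_card_inter_of_matchable_transversal hE hST hT ?_
  convert hA.union hM (Finset.disjoint_sdiff.mono_right Finset.sdiff_subset) using 1
  rw [sdiff_sdiff_comm, Finset.union_sdiff_of_subset]
  exact Finset.subset_sdiff.2 ⟨hAT, (Finset.subset_sdiff.1 hS).2.symm⟩

lemma IsAbsorber.matchable_of_three_mul_card_inter {k : ℝ} (habs : IsAbsorber E W (T \ W) k A)
    (hAT : A ⊆ T) (hS : S ⊆ T \ A) (hM : Matchable E ((T \ A) \ S)) (h : 3 * (W ∩ S).card = S.card)
    (hcard : (S.card : ℝ) ≤ k) : Matchable E T := by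
  have hsplit : W ∩ S ∪ S \ W = S := by
    rw [Finset.inter_comm, Finset.union_comm, Finset.sdiff_union_inter]
  have hWS : (W ∩ S).card ≤ S.card := Finset.card_le_card Finset.inter_subset_right
  have hsdiff : (S \ W).card + (W ∩ S).card = S.card := by
    rw [Finset.inter_comm, Finset.card_sdiff_add_card_inter]
  have hAS := habs (W ∩ S) Finset.inter_subset_left (S \ W)
    (Finset.sdiff_subset_sdiff (hS.trans Finset.sdiff_subset) subset_rfl) (by omega)
    ((Nat.cast_le.2 hWS).trans hcard)
    (Finset.disjoint_sdiff.mono_left Finset.inter_subset_left)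
  rw [hsplit] at hAS
  have hAST : A ∪ S ⊆ T := Finset.union_subset hAT (hS.trans Finset.sdiff_subset)
  rw [sdiff_sdiff_left, Finset.sup_eq_union] at hM
  rw [← Finset.union_sdiff_of_subset hAST]
  exact (hAS (Finset.subset_sdiff.1 hS).2.symm).union hM Finset.disjoint_sdiff

variable [Fintype V] {γ ε : ℝ} {Z : Finset V}

namespace DegreeCond

lemma mem_transversal (h : DegreeCond E γ W) {e : Finset V} (he : e ∈ E) (heT : e ⊆ T) {v : V}
    (hv : v ∈ W) (hve : v ∈ e) : e ∈ transversal E W T :=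
  Finset.mem_filter.2 ⟨he, heT, le_antisymm (h.card_inter_le_one he)
    (Finset.card_pos.2 ⟨v, Finset.mem_inter.2 ⟨hv, hve⟩⟩)⟩

lemma exists_edge_disjoint (h : DegreeCond E γ W) (hγ : 0 < γ) (hn : 0 < Fintype.card V)
    (hZW : Disjoint Z W) (hZ : 100 * Z.card ≤ Fintype.card V) :
    ∃ e ∈ E, Disjoint Z e ∧ Disjoint e W := by
  have hZsub : Z ⊆ Wᶜ := Finset.subset_compl_iff_disjoint_right.2 hZW
  have hcompl := Finset.card_compl W
  have hle := h.card_le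
  obtain ⟨u, hu, huZ⟩ : ∃ u ∈ Wᶜ, u ∉ Z := Finset.exists_mem_notMem_of_card_lt_card (by omega)
  rw [Finset.mem_compl] at hu
  have hpos : 0 < pairCount (link E u) (Wᶜ \ Z) := by
    have hn' : (0 : ℝ) < Fintype.card V := by exact_mod_cast hn
    have hZ' : (100 * Z.card : ℝ) ≤ Fintype.card V := by exact_mod_cast hZ
    have hcard : ((Wᶜ).card : ℝ) ≤ Fintype.card V := by exact_mod_cast Finset.card_le_univ Wᶜ
    have hmul : (Z.card : ℝ) * (Wᶜ).card ≤ Fintype.card V / 100 * Fintype.card V :=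
      mul_le_mul (by linarith) hcard (Nat.cast_nonneg _) (by linarith)
    have hremove : (pairCount (link E u) Wᶜ : ℝ) + ((Wᶜ).card - Z.card : ℝ) ^ 2 ≤
        pairCount (link E u) (Wᶜ \ Z) + ((Wᶜ).card : ℝ) ^ 2 := by
      rw [← Finset.cast_card_sdiff hZsub]
      exact_mod_cast pairCount_add_sq_le (link E u) Finset.sdiff_subset
    rw [← Nat.cast_pos (α := ℝ)]
    linarith [h.le_pairCount_compl_of_notMem hγ hu, sq_nonneg (Z.card : ℝ), mul_pos hn' hn']
  rw [pairCount_link, Finset.card_pos] at hpos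
  obtain ⟨⟨a, b⟩, hab⟩ := hpos
  simp only [Finset.mem_filter, Finset.mem_product, Finset.mem_sdiff, Finset.mem_compl] at hab
  obtain ⟨⟨⟨ha, haZ⟩, hb, hbZ⟩, he⟩ := hab
  refine ⟨_, he, ?_, ?_⟩
  · simp only [Finset.disjoint_insert_right, Finset.disjoint_singleton_right]
    exact ⟨huZ, haZ, hbZ⟩
  · simp only [Finset.disjoint_insert_left, Finset.disjoint_singleton_left]
    exact ⟨hu, ha, hb⟩

lemma exists_matchable_disjoint (h : DegreeCond E γ W) (hγ : 0 < γ) (t : ℕ)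
    (ht : 300 * t ≤ Fintype.card V) : ∃ Z, Matchable E Z ∧ Z.card = 3 * t ∧ Disjoint Z W := by
  induction t with
  | zero => exact ⟨∅, matchable_empty E, by simp, by simp⟩
  | succ t ih =>
    obtain ⟨Z, hZ, hZcard, hZW⟩ := ih (by omega)
    obtain ⟨e, he, hZe, heW⟩ := h.exists_edge_disjoint hγ (by omega) hZW (by omega)
    refine ⟨Z ∪ e, hZ.union (matchable_of_mem he) hZe, ?_, Finset.disjoint_union_left.2 ⟨hZW, heW⟩⟩
    rw [Finset.card_union_of_disjoint hZe, h.uniform e he, hZcard]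
    ring

lemma exists_matchable_three_mul_card_inter_compl (h : DegreeCond E γ W) (hγ : 0 < γ)
    (hV : 3 ∣ Fintype.card V) (hW : 33 / 100 * (Fintype.card V : ℝ) ≤ W.card) :
    ∃ Z, Matchable E Z ∧ Disjoint Z W ∧ 3 * (W ∩ Zᶜ).card = (Zᶜ).card ∧
      (Z.card : ℝ) = Fintype.card V - 3 * W.card := by
  obtain ⟨t, ht⟩ : ∃ t, Fintype.card V = 3 * (W.card + t) := by
    obtain ⟨k, hk⟩ := hV
    exact ⟨k - W.card, by have := h.card_le; omega⟩
  have ht' : (Fintype.card V : ℝ) = 3 * ((W.card : ℝ) + t) := by exact_mod_cast ht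
  obtain ⟨Z, hZ, hZcard, hZW⟩ := h.exists_matchable_disjoint hγ t (by
    have hle : (300 * t : ℝ) ≤ Fintype.card V := by linarith
    exact_mod_cast hle)
  refine ⟨Z, hZ, hZW, ?_, ?_⟩
  · rw [Finset.inter_eq_left.2 (Finset.subset_compl_iff_disjoint_left.2 hZW), Finset.card_compl]
    omega
  · rw [hZcard, ht']
    push_cast
    ring

lemma degree_le_of_mem (h : DegreeCond E γ W) {w : V} (hw : w ∈ W) :
    (pairCount (link E w) Finset.univ : ℝ) ≤ ((Fintype.card V : ℝ) - W.card) ^ 2 := by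
  rw [← cast_card_compl]
  have hle := pairCount_le_pairCount (P := link E w) (Q := link E w) (S := Finset.univ) (T := Wᶜ)
    fun a _ b _ hl => by simpa [hl] using h.notMem_and_notMem_of_mem hl hw
  exact_mod_cast hle.trans (pairCount_le_sq _ _)

lemma degree_le_sq_sub_sq (h : DegreeCond E γ W) (v : V) :
    (pairCount (link E v) Finset.univ : ℝ) ≤ (Fintype.card V : ℝ) ^ 2 - (W.card : ℝ) ^ 2 := by
  have hW := pairCount_le_pairCount (P := link E v) (Q := link E v) (S := W) (T := ∅)
    fun a ha b hb hl => absurd hb (h.notMem_of_mem hl.swap_left.swap_right ha)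
  have hsq := pairCount_add_sq_le (link E v) (Finset.subset_univ W)
  have hempty : pairCount (link E v) ∅ = 0 := by simp [pairCount]
  rw [Finset.card_univ] at hsq
  rw [le_sub_iff_add_le]
  exact_mod_cast (by omega : pairCount (link E v) Finset.univ + W.card ^ 2 ≤ Fintype.card V ^ 2)

lemma le_degree_add_sq (h : DegreeCond E γ W) (hγ : 0 < γ) (v : V) :
    1 / 5 * (Fintype.card V : ℝ) ^ 2 + (W.card : ℝ) ^ 2 ≤ pairCount (link E v) Finset.univ := by
  obtain ⟨a, b, hab⟩ := h.exists_link v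
  have : 0 ≤ γ * (Fintype.card V : ℝ) ^ 2 := by positivity
  linarith [h.adj _ _ _ hab, h.degree_le_sq_sub_sq a]

lemma exists_mem_link (h : DegreeCond E γ W) (hγ : 0 < γ) (hn : 0 < Fintype.card V)
    (hW : ((Fintype.card V : ℝ) - W.card) ^ 2 ≤ 9 / 20 * (Fintype.card V : ℝ) ^ 2)
    {u : V} (hu : u ∉ W) : ∃ w ∈ W, ∃ b, link E u w b := by
  by_contra! hcon
  have hle := pairCount_le_pairCount (P := link E u) (Q := link E u) (S := Finset.univ) (T := Wᶜ)
    fun a _ b _ hl => by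
      rw [Finset.mem_compl, Finset.mem_compl]
      exact ⟨fun ha => hcon a ha b hl, fun hb => hcon b hb a hl.swap_right, hl⟩
  have hsq : (pairCount (link E u) Finset.univ : ℝ) ≤ ((Wᶜ).card : ℝ) ^ 2 := by
    exact_mod_cast hle.trans (pairCount_le_sq _ _)
  rw [cast_card_compl] at hsq
  have hn' : (0 : ℝ) < Fintype.card V := by exact_mod_cast hn
  nlinarith [h.le_degree_of_notMem hu, mul_pos hγ (pow_pos hn' 2), pow_pos hn' 2]

lemma le_degree_of_notMem_sub_sq (h : DegreeCond E γ W) (hγ : 0 < γ) (hn : 0 < Fintype.card V)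
    (hW : ((Fintype.card V : ℝ) - W.card) ^ 2 ≤ 9 / 20 * (Fintype.card V : ℝ) ^ 2)
    {u : V} (hu : u ∉ W) :
    6 / 5 * (Fintype.card V : ℝ) ^ 2 - ((Fintype.card V : ℝ) - W.card) ^ 2 ≤
      pairCount (link E u) Finset.univ := by
  obtain ⟨w, hw, b, hl⟩ := h.exists_mem_link hγ hn hW hu
  have : 0 ≤ γ * (Fintype.card V : ℝ) ^ 2 := by positivity
  linarith [h.adj _ _ _ hl, h.degree_le_of_mem hw]

lemma degree_le_transversal_of_mem (h : DegreeCond E γ W) {w : V} (hw : w ∈ W) (hwZ : w ∉ Z) :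
    (pairCount (link E w) Finset.univ : ℝ) ≤
      pairCount (link (transversal E W Zᶜ) w) Finset.univ + 2 * Z.card * Fintype.card V := by
  have hle := pairCount_le_pairCount (P := link E w) (Q := link (transversal E W Zᶜ) w) (S := Zᶜ)
    (T := Finset.univ) fun a ha b hb hl => ⟨Finset.mem_univ a, Finset.mem_univ b,
      h.mem_transversal hl (by simp_all [Finset.insert_subset_iff]) hw (by simp)⟩
  have hcast : (pairCount (link E w) Zᶜ : ℝ) ≤
      pairCount (link (transversal E W Zᶜ) w) Finset.univ := Nat.cast_le.2 hle
  linarith [pairCount_univ_le_add (link E w) Z]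

lemma degree_le_transversal_of_notMem (h : DegreeCond E γ W) {u : V} (huZ : u ∉ Z) :
    (pairCount (link E u) Finset.univ : ℝ) ≤
      pairCount (link (transversal E W Zᶜ) u) Finset.univ + 2 * Z.card * Fintype.card V +
        ((Fintype.card V : ℝ) - W.card) ^ 2 := by
  have hle := (pairCount_le_add (P := link E u) (Q := link (transversal E W Zᶜ) u) (S := Zᶜ)
    (R := fun a b => a ∉ W ∧ b ∉ W) fun a ha b hb hl => by
      have hsub : {u, a, b} ⊆ Zᶜ := by simp_all [Finset.insert_subset_iff]
      by_cases haW : a ∈ W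
      · exact .inl (h.mem_transversal hl hsub haW (by simp))
      by_cases hbW : b ∈ W
      · exact .inl (h.mem_transversal hl hsub hbW (by simp))
      exact .inr ⟨haW, hbW⟩).trans (add_le_add (pairCount_mono_right _ (Finset.subset_univ _))
        (pairCount_mono_right _ (Finset.subset_univ _)))
  rw [pairCount_notMem, ← Finset.compl_eq_univ_sdiff, ← Nat.cast_le (α := ℝ), Nat.cast_add,
    Nat.cast_pow, cast_card_compl] at hle
  linarith [pairCount_univ_le_add (link E u) Z]

lemma le_degree_transversal (h : DegreeCond E γ W) (hγ : 0 < γ) (hn : 0 < Fintype.card V)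
    (hW : 333 / 1000 * (Fintype.card V : ℝ) ≤ W.card)
    (hZ : (Z.card : ℝ) ≤ 1 / 2000 * Fintype.card V) {v : V} (hv : v ∉ Z) :
    3 / 10 * (Fintype.card V : ℝ) ^ 2 ≤ pairCount (link (transversal E W Zᶜ) v) Finset.univ := by
  set n := (Fintype.card V : ℝ)
  have hn₀ : 0 ≤ n := Nat.cast_nonneg _
  have hZn : Z.card * n ≤ 1 / 2000 * n * n := mul_le_mul_of_nonneg_right hZ hn₀
  have hsq := sq_card_sub_card_le hW
  by_cases hvW : v ∈ W
  · have hWsq : (333 / 1000 * n) ^ 2 ≤ (W.card : ℝ) ^ 2 := pow_le_pow_left₀ (by positivity) hW 2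
    linarith [h.le_degree_add_sq hγ v, h.degree_le_transversal_of_mem hvW hv, sq_nonneg n]
  · linarith [h.le_degree_of_notMem_sub_sq hγ hn (by linarith [sq_nonneg n]) hvW,
      h.degree_le_transversal_of_notMem hv, sq_nonneg n]

lemma transversal_link_mem (h : DegreeCond E γ W) {u a b : V} (hu : u ∉ W)
    (hl : link (transversal E W T) u a b) : (a, b) ∈ W ×ˢ Wᶜ ∪ Wᶜ ×ˢ W := by
  have hlE : link E u a b := transversal_subset _ _ _ hl
  obtain ⟨v, hv⟩ := Finset.card_pos.1
    (zero_lt_one.trans_eq (card_inter_of_mem_transversal hl).symm)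
  simp only [Finset.mem_inter, Finset.mem_insert, Finset.mem_singleton] at hv
  simp only [Finset.mem_union, Finset.mem_product, Finset.mem_compl]
  obtain ⟨hvW, rfl | rfl | rfl⟩ := hv
  · exact absurd hvW hu
  · exact .inl ⟨hvW, h.notMem_of_mem hlE.swap_left.swap_right hvW⟩
  · exact .inr ⟨h.notMem_of_mem hlE.swap_left.swap_right.swap_left hvW, hvW⟩

lemma le_commonLink_transversal (h : DegreeCond E γ W) (hγ : 0 < γ) (hn : 0 < Fintype.card V)
    (hW : 333 / 1000 * (Fintype.card V : ℝ) ≤ W.card)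
    (hZ : (Z.card : ℝ) ≤ 1 / 2000 * Fintype.card V) {x y : V} (hx : x ∉ Z) (hy : y ∉ Z)
    (hxy : x ∈ W ↔ y ∈ W) :
    1 / 100 * (Fintype.card V : ℝ) ^ 2 ≤ (commonLink (transversal E W Zᶜ) x y).card := by
  set n := (Fintype.card V : ℝ) with hn_def
  obtain ⟨Ω, hΩ, hxΩ, hyΩ⟩ : ∃ Ω : Finset (V × V), (Ω.card : ℝ) ≤ 9 / 20 * n ^ 2 ∧
      (∀ a b, link (transversal E W Zᶜ) x a b → (a, b) ∈ Ω) ∧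
      ∀ a b, link (transversal E W Zᶜ) y a b → (a, b) ∈ Ω := by
    by_cases hxW : x ∈ W
    · have hsub {w : V} (hw : w ∈ W) (a b : V) (hl : link (transversal E W Zᶜ) w a b) :
          (a, b) ∈ Wᶜ ×ˢ Wᶜ := by
        simpa using h.notMem_and_notMem_of_mem (transversal_subset _ _ _ hl) hw
      refine ⟨Wᶜ ×ˢ Wᶜ, ?_, hsub hxW, hsub (hxy.1 hxW)⟩
      rw [Finset.card_product, ← pow_two, Nat.cast_pow, cast_card_compl]
      linarith [sq_card_sub_card_le hW, sq_nonneg n]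
    · refine ⟨_, ?_, fun a b => h.transversal_link_mem hxW,
        fun a b => h.transversal_link_mem (mt hxy.2 hxW)⟩
      have hunion := Finset.card_union_le (W ×ˢ Wᶜ) (Wᶜ ×ˢ W)
      rw [Finset.card_product, Finset.card_product, ← Nat.cast_le (α := ℝ), Nat.cast_add,
        Nat.cast_mul, Nat.cast_mul, cast_card_compl, ← hn_def] at hunion
      nlinarith [h.three_mul_card_le, sq_nonneg n]
  have hcommon := pairCount_add_pairCount_le_card_commonLink Ω hxΩ hyΩ
  rw [← Nat.cast_le (α := ℝ), Nat.cast_add, Nat.cast_add] at hcommon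
  linarith [h.le_degree_transversal hγ hn hW hZ hx, h.le_degree_transversal hγ hn hW hZ hy,
    sq_nonneg n]

lemma exists_isAbsorber_transversal (h : DegreeCond E γ W) (hγ : 0 < γ)
    (hn : 162 * 10 ^ 8 ≤ (Fintype.card V : ℝ))
    (hW : 333 / 1000 * (Fintype.card V : ℝ) ≤ W.card) (hZW : Disjoint Z W)
    (hZ : (Z.card : ℝ) ≤ 1 / 2000 * Fintype.card V)
    (m : ℕ) (hm : 324 * 10 ^ 8 * (m : ℝ) ≤ Fintype.card V) :
    ∃ A, Matchable (transversal E W Zᶜ) A ∧ A.card ≤ 9 * m ∧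
      IsAbsorber (transversal E W Zᶜ) W (Zᶜ \ W)
        (m / (8 * 10 ^ 8) - 3 * Real.log (Fintype.card V)) A := by
  set n := (Fintype.card V : ℝ) with hn_def
  have hV : 0 < Fintype.card V := by
    rw [← Nat.cast_pos (α := ℝ), ← hn_def]
    linarith
  have hnotMem : ∀ w ∈ W, w ∉ Z := fun w hw hwZ => Finset.disjoint_left.1 hZW hwZ hw
  obtain ⟨A, hA, hAcard, habs⟩ := exists_isAbsorber (E := transversal E W Zᶜ) (P₀ := W)
    (P₁ := Zᶜ \ W) (η := 1 / 100) (c := 3 / 10 * n ^ 2) (by norm_num) (by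
      have hmul : 333 / 1000 * n * (3 / 10 * n ^ 2) ≤ W.card * (3 / 10 * n ^ 2) :=
        mul_le_mul_of_nonneg_right hW (by positivity)
      linarith [pow_nonneg (Nat.cast_nonneg _ : 0 ≤ n) 3])
    (fun w hw => by
      refine (h.le_degree_transversal hγ hV hW hZ (hnotMem w hw)).trans (Nat.cast_le.2 ?_)
      refine pairCount_le_pairCount fun a _ b _ hl => ?_
      have hsub := subset_of_mem_transversal hl
      have hab := h.notMem_and_notMem_of_mem (transversal_subset _ _ _ hl) hw
      exact ⟨Finset.mem_sdiff.2 ⟨hsub (by simp), hab.1⟩,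
        Finset.mem_sdiff.2 ⟨hsub (by simp), hab.2⟩, hl⟩)
    (fun x hx y hy => h.le_commonLink_transversal hγ hV hW hZ (hnotMem x hx) (hnotMem y hy)
      (iff_of_true hx hy))
    (fun x hx y hy => by
      rw [Finset.mem_sdiff, Finset.mem_compl] at hx hy
      exact h.le_commonLink_transversal hγ hV hW hZ hx.1 hy.1 (iff_of_false hx.2 hy.2))
    (by linarith) m (by linarith)
  exact ⟨A, hA, hAcard, habs.mono (by linarith)⟩

lemma matchable_of_le_card {m₁ m₂ : ℕ} (h : DegreeCond E γ W) (hγ : 0 < γ) (hγ₁ : γ ≤ 1 / 100)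
    (hp : IsParameterChoice γ ε (Fintype.card V) m₁ m₂) (hV : 3 ∣ Fintype.card V)
    (hW : (1 / 3 - γ / 100) * Fintype.card V ≤ W.card) : Matchable E Finset.univ := by
  obtain ⟨hε, hle, hthreshold, hm₁, -, -, habsorb⟩ := hp
  have hγn : γ * Fintype.card V ≤ 1 / 100 * Fintype.card V :=
    mul_le_mul_of_nonneg_right hγ₁ (Nat.cast_nonneg _)
  obtain ⟨Z, hZ, hZW, hWZ, hZcard⟩ := h.exists_matchable_three_mul_card_inter_compl hγ hV
    (by linarith : 33 / 100 * (Fintype.card V : ℝ) ≤ W.card)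
  obtain ⟨A, hA, hAcard, habs⟩ := h.exists_isAbsorber_transversal hγ hle (by linarith) hZW
    (by linarith) m₁ (by linarith)
  rw [← Nat.cast_le (α := ℝ), Nat.cast_mul, Nat.cast_ofNat] at hAcard
  have hAZ : A ⊆ Zᶜ := hA.subset_of_forall fun e => subset_of_mem_transversal
  have hcompl : (Z ∪ A)ᶜ = Zᶜ \ A := by rw [Finset.compl_union, Finset.sdiff_eq_inter_compl]
  have hbalanced (S : Finset V) (hS : S ⊆ (Z ∪ A)ᶜ)
      (hM : Matchable (transversal E W Zᶜ) ((Z ∪ A)ᶜ \ S)) : 3 * (W ∩ S).card = S.card :=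
    three_mul_card_inter_of_matchable_sdiff h.uniform hAZ hWZ hA (hcompl ▸ hS) (hcompl ▸ hM)
  obtain ⟨S, hS, hM, hScard⟩ := h.exists_matchable_compl_sdiff hγ₁ (γ₀ := γ / 200)
    (E' := transversal E W Zᶜ) (by positivity) (by linarith) hε
    (fun e he => h.uniform e (transversal_subset _ _ _ he)) (Z := Z ∪ A) (by
      have hunion : ((Z ∪ A).card : ℝ) ≤ Z.card + A.card := by
        exact_mod_cast Finset.card_union_le _ _
      linarith) hthreshold
    fun S hS hM _ hne => ⟨(hbalanced S hS hM).le, fun x hx => hx.transversal h.uniform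
      (fun e => h.card_inter_le_one) hne
      (hS.trans (Finset.compl_subset_compl.2 Finset.subset_union_left)) (hbalanced S hS hM)⟩
  have hmatch := habs.matchable_of_three_mul_card_inter hAZ (hcompl ▸ hS) (hcompl ▸ hM)
    (hbalanced S hS hM) (by linarith [(Nat.cast_nonneg m₂ : (0 : ℝ) ≤ m₂)])
  convert hZ.union (hmatch.mono (transversal_subset _ _ _)) disjoint_compl_right
  exact (Finset.union_compl Z).symm

end DegreeCond

end TightCase

/-! ### From hypergraphs to finite set systems -/

section Translation

lemma Matchable.mul_card_le {V : Type*} [DecidableEq V] {E : Finset (Finset V)} {S T : Finset V}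
    {k ℓ : ℕ} (hE : ∀ e ∈ E, e.card = k ∧ ℓ ≤ (T ∩ e).card) (h : Matchable E S) :
    ℓ * S.card ≤ k * (T ∩ S).card := by
  obtain ⟨M, hM, hdisj, rfl⟩ := h
  rw [Finset.inter_biUnion, Finset.card_biUnion fun e he f hf hne => hdisj he hf hne,
    Finset.card_biUnion fun e he f hf hne => (hdisj he hf hne).mono Finset.inter_subset_right
      Finset.inter_subset_right, Finset.mul_sum, Finset.mul_sum]
  refine Finset.sum_le_sum fun e he => ?_
  rw [id, (hE e (hM he)).1, mul_comm]
  exact Nat.mul_le_mul_left k (hE e (hM he)).2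

lemma two_mul_card_filter_mem_le {V : Type*} [DecidableEq V] [Fintype V] {E : Finset (Finset V)}
    (hE : ∀ e ∈ E, e.card = 3) (v : V) :
    2 * (E.filter fun e => v ∈ e).card ≤ pairCount (link E v) Finset.univ := by
  rw [pairCount_link]
  refine Finset.mul_card_image_le_card_of_maps_to (f := fun p : V × V => {v, p.1, p.2})
    (fun p hp => Finset.mem_filter.2 ⟨(Finset.mem_filter.1 hp).2, Finset.mem_insert_self _ _⟩) 2
    fun e he => ?_
  obtain ⟨he, hv⟩ := Finset.mem_filter.1 he
  obtain ⟨a, b, hab, herase⟩ := Finset.card_eq_two.1 (show (e.erase v).card = 2 by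
    rw [Finset.card_erase_of_mem hv, hE e he])
  obtain rfl : {v, a, b} = e := by rw [← herase, Finset.insert_erase hv]
  rw [← Finset.card_pair (a := (a, b)) (b := (b, a)) fun h => hab (congrArg Prod.fst h)]
  refine Finset.card_le_card fun p hp => ?_
  rw [Finset.mem_insert, Finset.mem_singleton] at hp
  obtain rfl | rfl := hp
  · simpa using he
  · simpa [Finset.pair_comm b a] using he

lemma exists_equiv_forall_mem {α β : Type*} [Fintype α] [Fintype β]
    (h : Fintype.card α = Fintype.card β) {s : Finset α} {t : Finset β} (hst : s.card ≤ t.card) :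
    ∃ f : α ≃ β, ∀ a ∈ s, f a ∈ t := by
  classical
  obtain ⟨s', hs', hcard⟩ := Finset.exists_superset_card_eq hst (h ▸ Finset.card_le_univ t)
  let f := Fintype.equivOfCardEq h
  let g : {b // b ∈ s'.map f.toEmbedding} ≃ {b // b ∈ t} :=
    Finset.equivOfCardEq ((Finset.card_map _).trans hcard)
  exact ⟨f.trans g.extendSubtype, fun a ha =>
    g.extendSubtype_mem (f a) (Finset.mem_map_of_mem f.toEmbedding (hs' ha))⟩

variable {α : Type*} {H : Hypergraph α} [Fintype H.vertexSet]

open scoped Classical in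
/-- The edges of `H` as finite sets of elements of its vertex type. -/
noncomputable def edgeFinset (H : Hypergraph α) [Fintype H.vertexSet] :
    Finset (Finset H.vertexSet) :=
  Finset.univ.filter fun s => (↑) '' (s : Set H.vertexSet) ∈ H.edgeSet

lemma mem_edgeFinset {s : Finset H.vertexSet} :
    s ∈ edgeFinset H ↔ (↑) '' (s : Set H.vertexSet) ∈ H.edgeSet := by
  simp only [edgeFinset, Finset.mem_filter_univ]

lemma exists_mem_edgeFinset {e : Set α} (he : e ∈ H.edgeSet) :
    ∃ s ∈ edgeFinset H, (↑) '' (s : Set H.vertexSet) = e := by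
  classical
  have hcoe : (↑) '' (((↑) ⁻¹' e : Set H.vertexSet).toFinset : Set H.vertexSet) = e := by
    rw [Set.coe_toFinset, Subtype.image_preimage_coe,
      Set.inter_eq_right.2 (Hypergraph.subset_vertexSet_of_mem_edgeSet he)]
  exact ⟨_, mem_edgeFinset.2 (hcoe.symm ▸ he), hcoe⟩

lemma card_of_mem_edgeFinset {k : ℕ} (hH : H.IsUniform k) {s : Finset H.vertexSet}
    (hs : s ∈ edgeFinset H) : s.card = k := by
  rw [← hH _ (mem_edgeFinset.1 hs), Set.ncard_image_of_injective _ Subtype.val_injective,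
    Set.ncard_coe_finset]

lemma adj_of_mem_edgeFinset {s : Finset H.vertexSet} (hs : s ∈ edgeFinset H) {u v : H.vertexSet}
    (hu : u ∈ s) (hv : v ∈ s) : H.Adj u v :=
  ⟨_, mem_edgeFinset.1 hs, Set.mem_image_of_mem _ hu, Set.mem_image_of_mem _ hv⟩

variable [DecidableEq H.vertexSet]

lemma degree_le_card_filter_mem (v : H.vertexSet) :
    H.degree v ≤ ((edgeFinset H).filter fun s => v ∈ s).card := by
  have hsub : {e | e ∈ H.edgeSet ∧ (v : α) ∈ e} ⊆
      (fun s : Finset H.vertexSet => (↑) '' (s : Set H.vertexSet)) ''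
        ((edgeFinset H).filter fun s => v ∈ s) := by
    rintro e ⟨he, hv⟩
    obtain ⟨s, hs, rfl⟩ := exists_mem_edgeFinset he
    exact ⟨s, by simpa [hs] using hv, rfl⟩
  refine (Set.ncard_le_ncard hsub).trans ((Set.ncard_image_le (Set.toFinite _)).trans_eq ?_)
  rw [Set.ncard_coe_finset]

lemma two_mul_degree_le (hH : H.IsUniform 3) (v : H.vertexSet) :
    (2 * H.degree v : ℝ) ≤ pairCount (link (edgeFinset H) v) Finset.univ := by
  exact_mod_cast (Nat.mul_le_mul_left 2 (degree_le_card_filter_mem v)).trans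
    (two_mul_card_filter_mem_le (fun s => card_of_mem_edgeFinset hH) v)

lemma pairwiseDisjoint_image_coe_iff {X : Set α} {M : Set (Finset X)} :
    ((fun s : Finset X => ((↑) '' (s : Set X) : Set α)) '' M).PairwiseDisjoint id ↔
      M.PairwiseDisjoint id := by
  have hinj : (fun s : Finset X => ((↑) '' (s : Set X) : Set α)).Injective :=
    Subtype.val_injective.image_injective.comp Finset.coe_injective
  rw [hinj.injOn.pairwiseDisjoint_image]
  simp only [Set.PairwiseDisjoint, Set.Pairwise, Function.onFun, Function.comp_apply, id,
    Set.disjoint_image_iff Subtype.val_injective, Finset.disjoint_coe]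

lemma Matchable.exists_isPerfectMatching (h : Matchable (edgeFinset H) Finset.univ) :
    ∃ M, H.IsPerfectMatching M := by
  obtain ⟨M, hM, hdisj, hcover⟩ := h
  refine ⟨(fun s : Finset H.vertexSet => (↑) '' (s : Set H.vertexSet)) '' M,
    ⟨?_, pairwiseDisjoint_image_coe_iff.2 hdisj⟩, ?_⟩
  · rintro _ ⟨s, hs, rfl⟩
    exact mem_edgeFinset.1 (hM hs)
  · have hunion : ⋃ s ∈ (M : Set (Finset H.vertexSet)), (s : Set H.vertexSet) = Set.univ := by
      rw [← Finset.coe_univ, ← hcover, Finset.coe_biUnion]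
      simp only [Finset.mem_coe, id]
    rw [Set.sUnion_image, ← Set.image_iUnion₂, hunion, Set.image_univ, Subtype.range_coe]

lemma matchable_of_isPerfectMatching {M : Set (Set α)} (h : H.IsPerfectMatching M) :
    Matchable (edgeFinset H) Finset.univ := by
  classical
  obtain ⟨⟨hM, hdisj⟩, hcover⟩ := h
  refine ⟨(edgeFinset H).filter fun s => (↑) '' (s : Set H.vertexSet) ∈ M,
    Finset.filter_subset _ _, ?_, ?_⟩
  · refine pairwiseDisjoint_image_coe_iff.1 (hdisj.subset ?_)
    rintro _ ⟨s, hs, rfl⟩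
    exact (Finset.mem_filter.1 hs).2
  · refine Finset.eq_univ_iff_forall.2 fun v => ?_
    obtain ⟨e, he, hve⟩ : (v : α) ∈ ⋃₀ M := by rw [hcover]; exact v.2
    obtain ⟨s, hs, rfl⟩ := exists_mem_edgeFinset (hM he)
    exact Finset.mem_biUnion.2 ⟨s, Finset.mem_filter.2 ⟨hs, he⟩, by simpa using hve⟩

lemma exists_isPerfectMatching_iff :
    (∃ M, H.IsPerfectMatching M) ↔ Matchable (edgeFinset H) Finset.univ :=
  ⟨fun ⟨_, hM⟩ => matchable_of_isPerfectMatching hM, Matchable.exists_isPerfectMatching⟩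

lemma exists_card_le_of_isSubgraphOf_extremal {ℓ n m : ℕ}
    (h : H.IsSubgraphOf (Hypergraph.extremal ℓ n m)) :
    ∃ T : Finset H.vertexSet, T.card ≤ m * ℓ - 1 ∧ ∀ s ∈ edgeFinset H, ℓ ≤ (T ∩ s).card := by
  obtain ⟨f, hf, -, hfE⟩ := h
  refine ⟨Finset.univ.filter fun v => (f v : ℕ) < m * ℓ - 1, ?_, fun s hs => ?_⟩
  · rw [← Finset.card_range (m * ℓ - 1)]
    refine Finset.card_le_card_of_injOn (fun v => f v) (fun v hv => ?_) fun v _ w _ hvw =>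
      Subtype.ext (hf v.2 w.2 (Fin.ext hvw))
    simpa using hv
  · refine (hfE (Set.mem_image_of_mem _ (mem_edgeFinset.1 hs))).2.trans ?_
    rw [← Set.ncard_coe_finset]
    refine (Set.ncard_le_ncard ?_ (Set.toFinite _)).trans
      (Set.ncard_image_le (f := fun v : H.vertexSet => f v) (Set.toFinite _))
    rintro _ ⟨⟨_, ⟨v, hv, rfl⟩, rfl⟩, hi⟩
    exact ⟨v, by simpa using ⟨hi, hv⟩, rfl⟩

lemma isSubgraphOf_extremal {ℓ n m : ℕ} (hH : H.IsUniform 3) (hn : 0 < n)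
    (hcard : Fintype.card H.vertexSet = n) (hm : m * ℓ - 1 ≤ n) {T : Finset H.vertexSet}
    (hT : T.card ≤ m * ℓ - 1) (hTE : ∀ s ∈ edgeFinset H, ℓ ≤ (T ∩ s).card) :
    H.IsSubgraphOf (Hypergraph.extremal ℓ n m) := by
  obtain ⟨g, hg⟩ := exists_equiv_forall_mem (hcard.trans (Fintype.card_fin n).symm) (s := T)
    (t := Finset.univ.filter fun i => (i : ℕ) < m * ℓ - 1)
    (by rwa [Fin.card_filter_val_lt, min_eq_right hm])
  obtain ⟨f, hf⟩ : ∃ f : α → Fin n, ∀ v : H.vertexSet, f v = g v :=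
    ⟨Function.extend (↑) g fun _ => ⟨0, hn⟩, Subtype.val_injective.extend_apply _ _⟩
  have hinj : Set.InjOn f H.vertexSet := fun x hx y hy hxy =>
    congrArg Subtype.val (g.injective ((hf ⟨x, hx⟩).symm.trans (hxy.trans (hf ⟨y, hy⟩))))
  refine ⟨f, hinj, Set.subset_univ _, ?_⟩
  rintro _ ⟨e, he, rfl⟩
  refine ⟨((hinj.mono (H.subset_vertexSet_of_mem_edgeSet he)).ncard_image).trans (hH _ he), ?_⟩
  obtain ⟨s, hs, rfl⟩ := exists_mem_edgeFinset he
  refine (hTE s hs).trans ?_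
  rw [← Set.ncard_coe_finset, ← Set.ncard_image_of_injective _ g.injective]
  refine Set.ncard_le_ncard ?_ (Set.toFinite _)
  rintro _ ⟨v, hv, rfl⟩
  obtain ⟨hvT, hvs⟩ := Finset.mem_inter.1 hv
  exact ⟨⟨v, ⟨v, hvs, rfl⟩, hf v⟩, (Finset.mem_filter.1 (hg v hvT)).2⟩

lemma not_isSubgraphOf_extremal_of_matchable (h : Matchable (edgeFinset H) Finset.univ)
    (hH : H.IsUniform 3) {n : ℕ} (hn : 0 < n) (hcard : Fintype.card H.vertexSet = n) :
    ¬ H.IsSubgraphOf (Hypergraph.extremal 2 n (n / 3)) := by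
  intro hsub
  obtain ⟨T, hT, hTE⟩ := exists_card_le_of_isSubgraphOf_extremal hsub
  have hle := h.mul_card_le fun s hs => ⟨card_of_mem_edgeFinset hH hs, hTE s hs⟩
  rw [Finset.inter_univ, Finset.card_univ, hcard] at hle
  lia

lemma three_mul_card_le_of_not_isSubgraphOf (hH : H.IsUniform 3) {n : ℕ} (hn : 0 < n)
    (hn3 : 3 ∣ n) (hcard : Fintype.card H.vertexSet = n)
    (hsub : ¬ H.IsSubgraphOf (Hypergraph.extremal 2 n (n / 3))) {W : Finset H.vertexSet}
    (hW : ∀ s ∈ edgeFinset H, (W ∩ s).card ≤ 1) : 3 * W.card ≤ n := by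
  by_contra! hlt
  refine hsub (isSubgraphOf_extremal hH hn hcard (by lia) (T := Wᶜ) ?_ fun s hs => ?_)
  · rw [Finset.card_compl, hcard]
    lia
  · have hsplit := Finset.card_sdiff_add_card_inter s W
    rw [Finset.sdiff_eq_inter_compl, Finset.inter_comm s, Finset.inter_comm s,
      card_of_mem_edgeFinset hH hs] at hsplit
    have := hW s hs
    lia

/-- The vertices of small degree in the `3`-graph with edge set `E`, where degrees are counted by
ordered pairs. -/
noncomputable def lightVertices {V : Type*} [DecidableEq V] [Fintype V] (E : Finset (Finset V))
    (γ : ℝ) : Finset V :=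
  Finset.univ.filter fun v =>
    (pairCount (link E v) Finset.univ : ℝ) < (3 / 5 + γ / 2) * (Fintype.card V : ℝ) ^ 2

lemma oreCond_edgeFinset {γ : ℝ} (hH : H.IsUniform 3)
    (hiso : ∀ v ∈ H.vertexSet, ¬ H.IsIsolated v)
    (hdeg : ∀ u v : α, u ≠ v → H.Adj u v →
      (3 / 5 + γ) * (Fintype.card H.vertexSet : ℝ) ^ 2 ≤ (H.degree u : ℝ) + (H.degree v : ℝ))
    (hγ : 0 ≤ γ) : OreCond (edgeFinset H) γ (lightVertices (edgeFinset H) γ) := by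
  refine ⟨fun s => card_of_mem_edgeFinset hH, fun u v w hl => ?_, fun v => ?_,
    fun v => by simp only [lightVertices, Finset.mem_filter_univ]⟩
  · have huv : (u : α) ≠ v := fun h => by
      have hcard := card_of_mem_edgeFinset hH hl
      rw [Subtype.ext h, Finset.insert_eq_of_mem (Finset.mem_insert_self _ _)] at hcard
      exact absurd (Finset.card_le_two.trans_lt' hcard.ge) (lt_irrefl _)
    have : 0 ≤ γ * (Fintype.card H.vertexSet : ℝ) ^ 2 := by positivity
    linarith [hdeg u v huv (adj_of_mem_edgeFinset hl (by simp) (by simp)),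
      two_mul_degree_le hH u, two_mul_degree_le hH v]
  · obtain ⟨e, he, hve⟩ : ∃ e ∈ H.edgeSet, (v : α) ∈ e := by
      simpa [Hypergraph.IsIsolated] using hiso v v.2
    obtain ⟨s, hs, rfl⟩ := exists_mem_edgeFinset he
    replace hve : v ∈ s := by simpa using hve
    obtain ⟨a, ha, hav⟩ := Finset.exists_mem_ne
      (by rw [card_of_mem_edgeFinset hH hs]; norm_num) v
    obtain ⟨b, rfl⟩ := exists_eq_of_mem_of_mem_of_card_eq_three (card_of_mem_edgeFinset hH hs)
      hve ha hav.symm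
    exact ⟨a, b, hs⟩

end Translation

lemma DegreeCond.matchable {V : Type*} [DecidableEq V] [Fintype V] {E : Finset (Finset V)}
    {W : Finset V} {γ ε : ℝ} {m₁ m₂ : ℕ} (h : DegreeCond E γ W) (hγ : 0 < γ) (hγ₁ : γ ≤ 1 / 100)
    (hp : IsParameterChoice γ ε (Fintype.card V) m₁ m₂) (hV : 3 ∣ Fintype.card V) :
    Matchable E Finset.univ :=
  (le_total (W.card : ℝ) ((1 / 3 - γ / 100) * Fintype.card V)).elim
    (h.matchable_of_card_le hγ hγ₁ hp hV) (h.matchable_of_le_card hγ hγ₁ hp hV)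

end ThreeGraph

theorem theorem1p6 (γ : ℝ) (hγ : 0 < γ) :
    ∃ n₀ : ℕ, ∀ n : ℕ, n₀ ≤ n → 3 ∣ n →
      ∀ {α : Type*} (H : Hypergraph α),
        H.vertexSet.Finite → H.vertexSet.ncard = n →
        H.IsUniform 3 →
        (∀ v ∈ H.vertexSet, ¬ H.IsIsolated v) →
        (∀ u v : α, u ≠ v → H.Adj u v →
          (3 / 5 + γ) * (n : ℝ) ^ 2 < (H.degree u : ℝ) + (H.degree v : ℝ)) →
        ((∃ M : Set (Set α), H.IsPerfectMatching M) ↔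
          ¬ H.IsSubgraphOf (Hypergraph.extremal 2 n (n / 3))) := by
  classical
  obtain ⟨δ, hδ, hδ₁, hδγ⟩ : ∃ δ, 0 < δ ∧ δ ≤ 1 / 100 ∧ δ ≤ γ :=
    ⟨min γ (1 / 100), by positivity, min_le_right _ _, min_le_left _ _⟩
  obtain ⟨ε, hε⟩ := ThreeGraph.exists_isParameterChoice hδ
  obtain ⟨n₀, hn₀⟩ := Filter.eventually_atTop.1 (tendsto_natCast_atTop_atTop.eventually hε)
  refine ⟨n₀, fun n hn hn3 α H hfin hcard hH hiso hdeg => ?_⟩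
  have := hfin.fintype
  obtain rfl : Fintype.card H.vertexSet = n := by
    rw [← hcard, ← Nat.card_coe_set_eq, Nat.card_eq_fintype_card]
  obtain ⟨m₁, m₂, hp⟩ := hn₀ _ hn
  have hpos : 0 < Fintype.card H.vertexSet := Nat.cast_pos.1 (hp.le.trans_lt' (by norm_num))
  have hore := ThreeGraph.oreCond_edgeFinset hH hiso (fun u v huv hadj =>
    (hdeg u v huv hadj).le.trans' (by gcongr)) hδ.le
  rw [ThreeGraph.exists_isPerfectMatching_iff]
  refine ⟨fun h => ThreeGraph.not_isSubgraphOf_extremal_of_matchable h hH hpos rfl,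
    fun hsub => ?_⟩
  have hW := ThreeGraph.three_mul_card_le_of_not_isSubgraphOf hH hpos hn3 rfl hsub
    fun _ => hore.card_inter_le_one
  exact ThreeGraph.DegreeCond.matchable ⟨hore, hW⟩ hδ hδ₁ hp hn3
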